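/- **Matsuno's density formula.** Let $u_0:\mathbb{R}\to\mathbb{R}$ be a positive rational Klaus–Shaw potential. This means that $u_0\in L^1(\mathbb{R})$, that $u_0(x)>0$ for all $x$, and that $$u_0(x)=\sum_{p=1}^{P}\frac{c_p}{x-z_p}+\mathrm{c.c.},$$ where $c_p\neq 0$ and the $z_p$ have positive imaginary parts and real parts strictly increasing with $p$; and that there is $x_{\mathrm c}\in\mathbb{R}$ such that $u_0$ is strictly monotone on $(-\infty,x_{\mathrm c})$ and on $(x_{\mathrm c},+\infty)$, with $x_{\mathrm c}$ the only real critical point of $u_0$. Let $\mathcal{B}=\{\lambda\in\mathbb{R}:-\sup u_0<\lambda<-\inf u_0\}$ be the bulk. For $\lambda\in\mathcal{B}$ let $x_-(\lambda)<x_+(\lambda)$ be the two real solutions $x$ of $u_0(x)=-\lambda$, and set $$\rho_{\mathrm M}(\lambda):=\frac{x_+(\lambda)-x_-(\lambda)}{2\pi}.$$ For $\epsilon>0$ consider the operator $\mathcal{L}_\epsilon=-i\epsilon\,\partial_x-\mathcal{C}^+u_0\,\mathcal{C}^+$ on the Hardy space $H^+(\mathbb{R})\subset L^2(\mathbb{R})$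 of the upper half-plane (with domain the $f\in H^+(\mathbb{R})$ whose derivative is in $L^2(\mathbb{R})$), where $\mathcal{C}^+$ is the orthogonal projection of $L^2(\mathbb{R})$ onto $H^+(\mathbb{R})$. Let $[a,b]\subset\mathcal{B}$ with $a\le b$. Then $\rho_{\mathrm M}$ is integrable on $[a,b]$, for all sufficiently small $\epsilon>0$ the number $N_\epsilon[a,b]$ of eigenvalues of $\mathcal{L}_\epsilon$ in $[a,b]$ is finite, and $$N_\epsilon[a,b]=\frac{1}{\epsilon}\int_a^b\rho_{\mathrm M}(\lambda)\,d\lambda+O(1),\qquad \epsilon\to 0^+.$$ -/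

import Mathlib

open Set Filter Topology MeasureTheory Asymptotics
open scoped FourierTransform

noncomputable section

namespace BenjaminOno

/-- The complex Hilbert space `L²(ℝ)`. -/
abbrev L2 : Type := Lp ℂ 2 (volume : Measure ℝ)

/-- The Hardy space `H⁺(ℝ) ⊆ L²(ℝ)` of the upper half-plane: the functions whose Fourier transform
`𝓕 f (ξ) = ∫ f(x) exp(-2πi x ξ) dx` vanishes almost everywhere on `ξ < 0`. -/
def hardySpace : Submodule ℂ L2 where
  carrier := {f | ∀ᵐ ξ : ℝ, ξ < 0 → (𝓕 f : L2) ξ = 0}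
  zero_mem' := by
    have h0 : (𝓕 (0 : L2) : L2) = 0 := map_zero (Lp.fourierTransformₗᵢ ℝ ℂ)
    simp only [mem_ofPred_eq, h0]
    filter_upwards [Lp.coeFn_zero ℂ 2 (volume : Measure ℝ)] with ξ hξ _
    rw [hξ]; rfl
  add_mem' := by
    intro f g hf hg
    simp only [mem_ofPred_eq] at hf hg ⊢
    rw [FourierTransform.fourier_add]
    filter_upwards [hf, hg, Lp.coeFn_add (𝓕 f : L2) (𝓕 g : L2)] with ξ h1 h2 h3 h
    rw [h3, Pi.add_apply, h1 h, h2 h, add_zero]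
  smul_mem' := by
    intro c f hf
    simp only [mem_ofPred_eq] at hf ⊢
    rw [FourierTransform.fourier_smul]
    filter_upwards [hf, Lp.coeFn_smul c (𝓕 f : L2)] with ξ h1 h3 h
    rw [h3, Pi.smul_apply, h1 h, smul_zero]

theorem isClosed_hardySpace : IsClosed (hardySpace : Set L2) := by
  have hc : IsClosed {g : L2 | ∀ᵐ ξ : ℝ, ξ < 0 → g ξ = 0} := by
    refine IsSeqClosed.isClosed ?_
    intro s g hs hsg
    obtain ⟨ns, -, hns⟩ :=
      (tendstoInMeasure_of_tendsto_Lp hsg).exists_seq_tendsto_ae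
    have hall : ∀ᵐ ξ : ℝ, ∀ n, ξ < 0 → s n ξ = 0 := ae_all_iff.2 hs
    simp only [mem_ofPred_eq]
    filter_upwards [hall, hns] with ξ h1 h2 h
    refine tendsto_nhds_unique h2 ?_
    simp only [h1 _ h]
    exact tendsto_const_nhds
  exact hc.preimage (Lp.fourierTransformₗᵢ ℝ ℂ).continuous

instance : CompleteSpace hardySpace := isClosed_hardySpace.completeSpace_coe

/-- The self-adjoint orthogonal projection `𝒞⁺` of `L²(ℝ)` onto the Hardy space. -/
def cauchyProj : L2 →L[ℂ] L2 := hardySpace.starProjection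

/-- `g ∈ L²(ℝ)` is the derivative of `f ∈ L²(ℝ)`: `f` has a representative `F` which is locally
absolutely continuous, being a primitive of `g`. -/
def IsL2Deriv (f g : L2) : Prop :=
  ∃ F : ℝ → ℂ, f =ᵐ[volume] F ∧ ∀ x y : ℝ, ∫ t in x..y, g t = F y - F x

/-- The graph of the operator `ℒ = -iε ∂ₓ - 𝒞⁺ u 𝒞⁺` on `H⁺(ℝ)`, with its natural domain:
`f` is in the domain and `ℒ f = w`. -/
def LaxGraph (ε : ℝ) (u : ℝ → ℝ) (f w : L2) : Prop :=
  f ∈ hardySpace ∧ ∃ g v : L2, IsL2Deriv f g ∧ (v =ᵐ[volume] fun x => (u x : ℂ) * f x) ∧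
    w = -(Complex.I * (ε : ℂ)) • g - cauchyProj v

/-- `ev` is an eigenvalue of `ℒ` with dispersion parameter `ε` and potential `u`. -/
def IsEigenvalue (ε : ℝ) (u : ℝ → ℝ) (ev : ℝ) : Prop :=
  ∃ f : L2, f ≠ 0 ∧ LaxGraph ε u f ((ev : ℂ) • f)

/-- The eigenvalues of `ℒ` in `[a, b]`. -/
def eigenvaluesIn (ε : ℝ) (u : ℝ → ℝ) (a b : ℝ) : Set ℝ :=
  {ev | ev ∈ Icc a b ∧ IsEigenvalue ε u ev}

/-- Integrable rational functions `u(x) = ∑ₚ cₚ / (x - zₚ) + c.c.` with nonzero `cₚ` and with poles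
`zₚ` in the open upper half-plane whose real parts strictly increase with `p`. -/
def IsRationalPotential (u : ℝ → ℝ) : Prop :=
  (∃ (P : ℕ) (c z : Fin P → ℂ), (∀ p, c p ≠ 0) ∧ (∀ p, 0 < (z p).im) ∧
    StrictMono (fun p => (z p).re) ∧
    ∀ x : ℝ, (u x : ℂ) = ∑ p, c p / ((x : ℂ) - z p)
      + (starRingEnd ℂ) (∑ p, c p / ((x : ℂ) - z p))) ∧
  Integrable u

/-- Rational Klaus-Shaw potentials: rational potentials that are strictly monotone on each side of
a point `xc`, this point being the only real critical point. -/
def IsRKS (u : ℝ → ℝ) : Prop :=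
  IsRationalPotential u ∧ ∃ xc : ℝ,
    (StrictMonoOn u (Iio xc) ∨ StrictAntiOn u (Iio xc)) ∧
    (StrictMonoOn u (Ioi xc) ∨ StrictAntiOn u (Ioi xc)) ∧
    ∀ x : ℝ, deriv u x = 0 ↔ x = xc

/-- The bulk `{ev : -sup u < ev < -inf u}`. -/
def bulk (u : ℝ → ℝ) : Set ℝ := Ioo (-(⨆ x, u x)) (-(⨅ x, u x))

/-- The lower real branch of the inverse of `-u`. For `ev` in the bulk of a rational Klaus-Shaw
potential the set below has exactly two elements. -/
def xMinus (u : ℝ → ℝ) (ev : ℝ) : ℝ := sInf {x | u x = -ev}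

/-- The upper real branch of the inverse of `-u`. -/
def xPlus (u : ℝ → ℝ) (ev : ℝ) : ℝ := sSup {x | u x = -ev}

/-- Matsuno's density. -/
def matsunoDensity (u : ℝ → ℝ) (ev : ℝ) : ℝ := (xPlus u ev - xMinus u ev) / (2 * Real.pi)

end BenjaminOno

end

/-! The eigenvalue problem reduces to a scalar differential equation. For `f` in the Hardy space,
`𝒞⁺` only removes the poles of `u f` in the upper half-plane: `𝒞⁺(u f) = u f - ∑ c_p f(z_p) / (x -
z_p)`. An eigenfunction therefore solves `-iε F' = (u + λ) F - s` with a rational source `s`, and so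
does the resolvent applied to `k = 1 / (x + i)`, whose source has the extra term `-κ / (x + i)` with
`κ = 1`.

Multiplication by `exp(-iφ/ε)`, where `φ' = u + λ`, turns `F` into a primitive of an oscillatory
function whose only stationary points are the turning points `x₋, x₊`. Since `F` is square
integrable this primitive is negligible at both ends of the line, and stationary phase gives `ampL +
exp(-iA(λ)/ε) ampR → 0` (`tendsto_connection`). Here `A` is the action, the integral of `u + λ` over
the well, and the amplitudes are the values of the source at the turning points times nonzero
Fresnel constants.

The source is fixed by complex analysis. `F` continues to the upper half-plane, where the equation
and the maximum principle force the limiting source to vanish wherever `u + λ₀` does, to the same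
order (`SolSeq.isBigO`). Now `u + λ₀` has `2P` zeros, two of them real and simple, hence `P - 1` in
the upper half-plane. Counting zeros of polynomials (`eq_zero_of_vanish`) shows that for `κ = 0` the
limiting source is unique up to a factor and that it vanishes at neither turning point. So near `λ₀`
the number `exp(-iA(λ)/ε)` must be close to a fixed unimodular `R(λ₀)` at every eigenvalue
(`exists_ratio`, `eventually_osc_near`).

It remains to see that each phase period holds one eigenvalue. Inner products of solutions at levels
`O(ε)` apart converge, after scaling, to a nonzero multiple of the integral of `exp(iσx)` over the
well (`tendsto_inner`). Eigenfunctions are orthogonal, and this integral is nonzero for `0 ≤ σ (x₊ -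
x₋) < 2π`, so eigenvalues are separated (`eventually_separated`). On an interval without eigenvalues
the Weyl function `⟨k, (ℒ - λ)⁻¹ k⟩` is monotone, and its increments are governed by the same
integral: in the limit the increment over a full period is zero while that over a quarter is
positive, a contradiction (`eventually_exists_eigenvalue`).

Eigenvalues thus match integers in the coordinate `A / (2πε)`, suitably shifted, up to a bounded
error. Since `A' = x₊ - x₋`, this is the integral of the density, and a finite cover of `[a, b]`
gives the result. No rate of convergence is needed: the local statements are proved by contradiction
along sequences `εₙ → 0`, `λₙ → λ₀`, using compactness of the finite-dimensional source data. -/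

noncomputable section

namespace BenjaminOno

/-! ### Fourier transform, Hardy space and Cauchy kernels -/

section
open scoped SchwartzMap ContDiff

theorem ae_eq_of_forall_schwartz {f g : ℝ → ℂ} (hf : LocallyIntegrable f) (hg : LocallyIntegrable g)
    (h : ∀ ψ : 𝓢(ℝ, ℂ), ∫ x, ψ x • f x = ∫ x, ψ x • g x) : f =ᵐ[volume] g := by
  refine ae_eq_of_integral_contDiff_smul_eq hf hg fun φ hφ hc => ?_
  have hc' : HasCompactSupport (fun x => (φ x : ℂ)) := hc.comp_left (g := Complex.ofReal) rfl
  have hd : ContDiff ℝ ∞ (fun x => (φ x : ℂ)) := Complex.ofRealCLM.contDiff.comp hφ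
  have := h (hc'.toSchwartzMap hd)
  simpa using! this

theorem L2.locallyIntegrable (f : L2) : LocallyIntegrable f :=
  (Lp.memLp f).locallyIntegrable (by norm_num)

/-- The `L²` transform is compared with the Fourier integral by duality: both satisfy `∫ 𝓕f ψ = ∫ f
𝓕ψ` for Schwartz `ψ`, and both are locally integrable. -/
theorem fourier_coeFn (f : L2) (hf : Integrable f) :
    (𝓕 f : L2) =ᵐ[volume] 𝓕 (f : ℝ → ℂ) := by
  have hcont : Continuous (𝓕 (f : ℝ → ℂ)) :=
    VectorFourier.fourierIntegral_continuous Real.continuous_fourierChar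
      (by exact continuous_inner) hf
  refine ae_eq_of_forall_schwartz (L2.locallyIntegrable _) hcont.locallyIntegrable fun ψ => ?_
  have h1 := DFunLike.congr_fun (Lp.fourier_toTemperedDistribution_eq f) ψ
  rw [TemperedDistribution.fourier_apply, Lp.toTemperedDistribution_apply,
    Lp.toTemperedDistribution_apply] at h1
  rw [← h1]
  have h2 := VectorFourier.integral_fourierIntegral_smul_eq_flip (L := innerₗ ℝ)
    Real.continuous_fourierChar continuous_inner (ψ.integrable (μ := volume)) hf
  rw [flip_innerₗ] at h2
  simp only [SchwartzMap.fourier_coe]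
  exact h2

theorem fourierInv_coeFn (f : L2) (hf : Integrable f) :
    (𝓕⁻ f : L2) =ᵐ[volume] 𝓕⁻ (f : ℝ → ℂ) := by
  have hcont : Continuous (𝓕⁻ (f : ℝ → ℂ)) :=
    VectorFourier.fourierIntegral_continuous Real.continuous_fourierChar (L := -innerₗ ℝ)
      (by exact (continuous_inner (𝕜 := ℝ)).neg) hf
  refine ae_eq_of_forall_schwartz (L2.locallyIntegrable _) hcont.locallyIntegrable fun ψ => ?_
  have h1 := DFunLike.congr_fun (Lp.fourierInv_toTemperedDistribution_eq f) ψ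
  rw [TemperedDistribution.fourierInv_apply, Lp.toTemperedDistribution_apply,
    Lp.toTemperedDistribution_apply] at h1
  rw [← h1]
  have h2 := VectorFourier.integral_fourierIntegral_smul_eq_flip (L := -innerₗ ℝ)
    Real.continuous_fourierChar (continuous_inner (𝕜 := ℝ)).neg (ψ.integrable (μ := volume)) hf
  have h3 : (-innerₗ ℝ).flip = -innerₗ ℝ := by
    ext; simp
  rw [h3] at h2
  simp only [SchwartzMap.fourierInv_coe]
  exact h2


/-- The Cauchy kernel `x ↦ 1 / (x - a)`. -/
def cauchyKer (a : ℂ) (x : ℝ) : ℂ := 1 / ((x : ℂ) - a)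

theorem ofReal_sub_ne_zero {a : ℂ} (ha : a.im ≠ 0) (x : ℝ) : (x : ℂ) - a ≠ 0 := by
  intro h
  apply ha
  have := congrArg Complex.im h
  simpa using this

theorem continuous_cauchyKer {a : ℂ} (ha : a.im ≠ 0) : Continuous (cauchyKer a) := by
  unfold cauchyKer
  exact continuous_const.div (by fun_prop) (ofReal_sub_ne_zero ha)

/-- `|x - a|` dominates `1 + |x|`, uniformly for `a` in a bounded set away from the real axis. -/
theorem one_add_abs_le_norm_sub {a : ℂ} {y M : ℝ} (hy : 0 < y) (ha : y ≤ |a.im|) (hM : ‖a‖ ≤ M)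
    (x : ℝ) : 1 + |x| ≤ (1 + (1 + M) / y) * ‖(x : ℂ) - a‖ := by
  have h1 : y ≤ ‖(x : ℂ) - a‖ := ha.trans (by simpa using Complex.abs_im_le_norm ((x : ℂ) - a))
  have h2 : |x| ≤ ‖(x : ℂ) - a‖ + M := by
    have : ‖(x : ℂ)‖ ≤ ‖(x : ℂ) - a‖ + ‖a‖ := by simpa using norm_add_le ((x : ℂ) - a) a
    rw [Complex.norm_real, Real.norm_eq_abs] at this
    linarith
  have hM0 : 0 ≤ M := (norm_nonneg a).trans hM
  have h3 : 1 + M ≤ (1 + M) / y * ‖(x : ℂ) - a‖ := by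
    rw [div_mul_eq_mul_div, le_div_iff₀ hy]
    exact mul_le_mul_of_nonneg_left h1 (by linarith)
  linarith

theorem exists_norm_cauchyKer_le {a : ℂ} (ha : a.im ≠ 0) :
    ∃ C, 0 < C ∧ ∀ x, ‖cauchyKer a x‖ ≤ C / (1 + |x|) := by
  refine ⟨1 + (1 + ‖a‖) / |a.im|, by positivity, fun x => ?_⟩
  have h := one_add_abs_le_norm_sub (abs_pos.2 ha) le_rfl le_rfl x
  have h0 : 0 < ‖(x : ℂ) - a‖ := norm_pos_iff.2 (ofReal_sub_ne_zero ha x)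
  unfold cauchyKer
  rw [norm_div, norm_one, div_le_div_iff₀ h0 (by positivity)]
  linarith

theorem integrable_inv_one_add_abs_sq : Integrable (fun x : ℝ => 1 / (1 + |x|) ^ 2) := by
  refine integrable_inv_one_add_sq.mono' ?_ (ae_of_all _ fun x => ?_)
  · exact (Continuous.div continuous_const (by fun_prop)
      (fun x => by positivity)).aestronglyMeasurable
  · rw [Real.norm_of_nonneg (by positivity), ← one_div]
    apply one_div_le_one_div_of_le (by positivity)
    nlinarith [abs_nonneg x, sq_abs x]

theorem memLp_two_of_le {F : ℝ → ℂ} (hF : AEStronglyMeasurable F volume) {C : ℝ}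
    (h : ∀ x, ‖F x‖ ≤ C / (1 + |x|)) : MemLp F 2 volume := by
  rw [memLp_two_iff_integrable_sq_norm hF]
  refine (integrable_inv_one_add_abs_sq.const_mul (C ^ 2)).mono' (hF.norm.pow 2)
    (ae_of_all _ fun x => ?_)
  rw [Real.norm_of_nonneg (by positivity)]
  calc ‖F x‖ ^ 2 ≤ (C / (1 + |x|)) ^ 2 := pow_le_pow_left₀ (norm_nonneg _) (h x) 2
    _ = C ^ 2 * (1 / (1 + |x|) ^ 2) := by rw [div_pow]; ring

theorem memLp_cauchyKer {a : ℂ} (ha : a.im ≠ 0) : MemLp (cauchyKer a) 2 volume := by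
  obtain ⟨C, -, hC⟩ := exists_norm_cauchyKer_le ha
  exact memLp_two_of_le (continuous_cauchyKer ha).aestronglyMeasurable hC

/-- The Cauchy kernel as an element of `L²`. -/
def cauchyL2 {a : ℂ} (ha : a.im ≠ 0) : L2 := (memLp_cauchyKer ha).toLp _

theorem coeFn_cauchyL2 {a : ℂ} (ha : a.im ≠ 0) : cauchyL2 ha =ᵐ[volume] cauchyKer a :=
  MemLp.coeFn_toLp _

theorem conj_cauchyKer (a : ℂ) (x : ℝ) :
    (starRingEnd ℂ) (cauchyKer a x) = cauchyKer ((starRingEnd ℂ) a) x := by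
  simp [cauchyKer]

theorem inner_cauchyL2 {a : ℂ} (ha : a.im ≠ 0) (f : L2) :
    inner ℂ (cauchyL2 ha) f = ∫ x, f x * cauchyKer ((starRingEnd ℂ) a) x := by
  rw [L2.inner_def]
  refine integral_congr_ae ?_
  filter_upwards [coeFn_cauchyL2 ha] with x hx
  rw [hx, ← conj_cauchyKer]
  rfl

/-- One-sided exponentials, the Fourier transforms of Cauchy kernels with poles below the axis. -/
def expPos (a : ℂ) : ℝ → ℂ := (Ioi (0 : ℝ)).indicator fun ξ => Complex.exp (-(2 * Real.pi * Complex.I * a) * ξ)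

/-- One-sided exponentials, the Fourier transforms of Cauchy kernels with poles above the axis. -/
def expNeg (a : ℂ) : ℝ → ℂ := (Iio (0 : ℝ)).indicator fun ξ => Complex.exp (-(2 * Real.pi * Complex.I * a) * ξ)

theorem norm_exp_two_pi (a : ℂ) (ξ : ℝ) :
    ‖Complex.exp (-(2 * Real.pi * Complex.I * a) * ξ)‖ = Real.exp (2 * Real.pi * a.im * ξ) := by
  rw [Complex.norm_exp]; simp

theorem integrable_expPos {a : ℂ} (ha : a.im < 0) : Integrable (expPos a) := by
  rw [expPos, integrable_indicator_iff measurableSet_Ioi]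
  apply integrableOn_exp_mul_complex_Ioi
  simp; nlinarith [Real.pi_pos]

theorem integrable_expNeg {a : ℂ} (ha : 0 < a.im) : Integrable (expNeg a) := by
  rw [expNeg, integrable_indicator_iff measurableSet_Iio]
  apply (integrableOn_exp_mul_complex_Iic (a := -(2 * Real.pi * Complex.I * a)) ?_ 0).mono_set
    Iio_subset_Iic_self
  simp; positivity

theorem norm_expPos_le {a : ℂ} (ha : a.im < 0) (ξ : ℝ) : ‖expPos a ξ‖ ≤ 1 := by
  unfold expPos indicator
  split_ifs with h
  · rw [norm_exp_two_pi, Real.exp_le_one_iff]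
    have := mul_pos Real.pi_pos (mem_Ioi.1 h)
    nlinarith
  · simp

theorem norm_expNeg_le {a : ℂ} (ha : 0 < a.im) (ξ : ℝ) : ‖expNeg a ξ‖ ≤ 1 := by
  unfold expNeg indicator
  split_ifs with h
  · rw [norm_exp_two_pi, Real.exp_le_one_iff]
    have := mul_neg_of_pos_of_neg Real.pi_pos (mem_Iio.1 h)
    nlinarith
  · simp

theorem memLp_two_of_integrable_of_bounded {F : ℝ → ℂ} (hF : Integrable F) {C : ℝ}
    (h : ∀ x, ‖F x‖ ≤ C) : MemLp F 2 volume := by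
  rw [memLp_two_iff_integrable_sq_norm hF.1]
  refine (hF.norm.const_mul C).mono' (hF.1.norm.pow 2) (ae_of_all _ fun x => ?_)
  rw [Real.norm_of_nonneg (by positivity), pow_two]
  exact mul_le_mul_of_nonneg_right (h x) (norm_nonneg _)

theorem memLp_expPos {a : ℂ} (ha : a.im < 0) : MemLp (expPos a) 2 volume :=
  memLp_two_of_integrable_of_bounded (integrable_expPos ha) (norm_expPos_le ha)

theorem memLp_expNeg {a : ℂ} (ha : 0 < a.im) : MemLp (expNeg a) 2 volume :=
  memLp_two_of_integrable_of_bounded (integrable_expNeg ha) (norm_expNeg_le ha)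

theorem fourierInv_congr_ae' {f g : ℝ → ℂ} (h : f =ᵐ[volume] g) : 𝓕⁻ f = 𝓕⁻ g := by
  funext x
  rw [Real.fourierInv_eq, Real.fourierInv_eq]
  refine integral_congr_ae ?_
  filter_upwards [h] with ξ hξ
  rw [hξ]

theorem fourierInv_toLp_coeFn {f : ℝ → ℂ} (h2 : MemLp f 2 volume) (h1 : Integrable f) :
    (𝓕⁻ (h2.toLp f) : L2) =ᵐ[volume] 𝓕⁻ f := by
  have h := fourierInv_coeFn (h2.toLp f) (h1.congr h2.coeFn_toLp.symm)
  rwa [fourierInv_congr_ae' h2.coeFn_toLp] at h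

theorem fourierInv_expPos {a : ℂ} (ha : a.im < 0) (x : ℝ) :
    𝓕⁻ (expPos a) x = -(2 * Real.pi * Complex.I)⁻¹ * cauchyKer a x := by
  rw [Real.fourierInv_eq']
  have h0 := ofReal_sub_ne_zero ha.ne x
  have : ∀ ξ : ℝ, Complex.exp (((2 * Real.pi * inner ℝ ξ x : ℝ) : ℂ) * Complex.I) • expPos a ξ
      = (Ioi (0 : ℝ)).indicator
        (fun ξ : ℝ => Complex.exp ((2 * Real.pi * Complex.I * (x - a)) * ξ)) ξ := by
    intro ξ
    unfold expPos indicator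
    split_ifs
    · rw [smul_eq_mul, ← Complex.exp_add]
      congr 1
      simp
      ring
    · simp
  simp_rw [this]
  rw [integral_indicator measurableSet_Ioi, integral_exp_mul_complex_Ioi]
  · simp [cauchyKer]; field_simp
    rw [Complex.I_sq]
  · simp; nlinarith [Real.pi_pos]

theorem fourierInv_expNeg {a : ℂ} (ha : 0 < a.im) (x : ℝ) :
    𝓕⁻ (expNeg a) x = (2 * Real.pi * Complex.I)⁻¹ * cauchyKer a x := by
  rw [Real.fourierInv_eq']
  have h0 := ofReal_sub_ne_zero ha.ne' x
  have : ∀ ξ : ℝ, Complex.exp (((2 * Real.pi * inner ℝ ξ x : ℝ) : ℂ) * Complex.I) • expNeg a ξ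
      = (Iio (0 : ℝ)).indicator
        (fun ξ : ℝ => Complex.exp ((2 * Real.pi * Complex.I * (x - a)) * ξ)) ξ := by
    intro ξ
    unfold expNeg indicator
    split_ifs
    · rw [smul_eq_mul, ← Complex.exp_add]
      congr 1
      simp
      ring
    · simp
  simp_rw [this]
  rw [integral_indicator measurableSet_Iio, ← integral_Iic_eq_integral_Iio,
    integral_exp_mul_complex_Iic]
  · simp [cauchyKer]; field_simp
  · simp; positivity

theorem fourier_cauchyL2_of_neg {a : ℂ} (ha : a.im < 0) :
    𝓕 (cauchyL2 ha.ne) = -(2 * Real.pi * Complex.I : ℂ) • ((memLp_expPos ha).toLp _ : L2) := by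
  have h : cauchyL2 ha.ne
      = -(2 * Real.pi * Complex.I : ℂ) • (𝓕⁻ ((memLp_expPos ha).toLp _ : L2) : L2) := by
    refine Lp.ext ?_
    filter_upwards [coeFn_cauchyL2 ha.ne, fourierInv_toLp_coeFn (memLp_expPos ha)
      (integrable_expPos ha), Lp.coeFn_smul (-(2 * Real.pi * Complex.I : ℂ))
      (𝓕⁻ ((memLp_expPos ha).toLp _ : L2) : L2)] with x h1 h2 h3
    rw [h1, h3, Pi.smul_apply, h2, fourierInv_expPos ha, smul_eq_mul]
    field_simp
  rw [h, FourierTransform.fourier_smul, FourierTransform.fourier_fourierInv_eq]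

theorem fourier_cauchyL2_of_pos {a : ℂ} (ha : 0 < a.im) :
    𝓕 (cauchyL2 ha.ne') = (2 * Real.pi * Complex.I : ℂ) • ((memLp_expNeg ha).toLp _ : L2) := by
  have h : cauchyL2 ha.ne'
      = (2 * Real.pi * Complex.I : ℂ) • (𝓕⁻ ((memLp_expNeg ha).toLp _ : L2) : L2) := by
    refine Lp.ext ?_
    filter_upwards [coeFn_cauchyL2 ha.ne', fourierInv_toLp_coeFn (memLp_expNeg ha)
      (integrable_expNeg ha), Lp.coeFn_smul (2 * Real.pi * Complex.I : ℂ)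
      (𝓕⁻ ((memLp_expNeg ha).toLp _ : L2) : L2)] with x h1 h2 h3
    rw [h1, h3, Pi.smul_apply, h2, fourierInv_expNeg ha, smul_eq_mul]
    field_simp
  rw [h, FourierTransform.fourier_smul, FourierTransform.fourier_fourierInv_eq]

theorem mem_hardySpace_iff {f : L2} : f ∈ hardySpace ↔ ∀ᵐ ξ : ℝ, ξ < 0 → (𝓕 f : L2) ξ = 0 :=
  Iff.rfl

theorem cauchyL2_mem_hardySpace {a : ℂ} (ha : a.im < 0) : cauchyL2 ha.ne ∈ hardySpace := by
  rw [mem_hardySpace_iff, fourier_cauchyL2_of_neg ha]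
  filter_upwards [Lp.coeFn_smul (-(2 * Real.pi * Complex.I : ℂ)) ((memLp_expPos ha).toLp _ : L2),
    (memLp_expPos ha).coeFn_toLp] with ξ h1 h2 hξ
  rw [h1, Pi.smul_apply, h2, expPos, indicator_of_notMem (by simpa using hξ.le), smul_zero]

/-- The two Fourier transforms live on opposite half-lines. -/
theorem inner_cauchyL2_eq_zero {a : ℂ} (ha : 0 < a.im) {f : L2} (hf : f ∈ hardySpace) :
    inner ℂ (cauchyL2 ha.ne') f = 0 := by
  rw [← Lp.inner_fourier_eq, fourier_cauchyL2_of_pos ha, inner_smul_left, L2.inner_def]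
  refine mul_eq_zero_of_right _ (integral_eq_zero_of_ae ?_)
  filter_upwards [mem_hardySpace_iff.1 hf, (memLp_expNeg ha).coeFn_toLp] with ξ h1 h2
  rw [h2]
  by_cases h : ξ < 0
  · rw [h1 h]; simp
  · rw [expNeg, indicator_of_notMem (by simpa using h)]; simp

theorem integral_mul_cauchyKer_eq_zero {a : ℂ} (ha : a.im < 0) {f : L2} (hf : f ∈ hardySpace) :
    ∫ x, f x * cauchyKer a x = 0 := by
  have h : 0 < ((starRingEnd ℂ) a).im := by simpa using ha
  simpa using (inner_cauchyL2 h.ne' f).symm.trans (inner_cauchyL2_eq_zero h hf)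

/-- One horizontal line of test points is enough: the Cauchy integral at `x - iy` is, up to a
constant, the inverse Fourier transform at `x` of `exp(2πyξ) 𝓕f(ξ)` restricted to `ξ < 0`, and the
exponential never vanishes. The freedom in `y` allows the line to avoid the poles of the potential.
-/
theorem mem_hardySpace_of_integral_eq_zero {f : L2} {y : ℝ} (hy : 0 < y)
    (h : ∀ a : ℂ, a.im = -y → ∫ x, f x * cauchyKer a x = 0) : f ∈ hardySpace := by
  set g : ℝ → ℂ := fun ξ => expNeg (y * Complex.I) ξ * (𝓕 f : L2) ξ with hg
  have hI : 0 < (y * Complex.I).im := by simpa using hy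
  have h1 : Integrable g := (memLp_expNeg hI).integrable_mul (Lp.memLp (𝓕 f : L2))
  have h2 : MemLp g 2 volume := by
    refine (Lp.memLp (𝓕 f : L2)).of_le h1.1 (ae_of_all _ fun ξ => ?_)
    rw [hg, norm_mul]
    exact mul_le_of_le_one_left (norm_nonneg _) (norm_expNeg_le hI ξ)
  have h3 : 𝓕⁻ g = 0 := by
    funext x
    have ha : 0 < ((x : ℂ) + y * Complex.I).im := by simpa using hy
    have h4 := h ((starRingEnd ℂ) ((x : ℂ) + y * Complex.I)) (by simp)
    rw [← inner_cauchyL2 ha.ne', ← Lp.inner_fourier_eq, fourier_cauchyL2_of_pos ha,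
      inner_smul_left, L2.inner_def] at h4
    have h5 := (mul_eq_zero.1 h4).resolve_left (by simp [Real.pi_ne_zero])
    rw [Real.fourierInv_eq', Pi.zero_apply, ← h5]
    refine integral_congr_ae ?_
    filter_upwards [(memLp_expNeg ha).coeFn_toLp] with ξ h6
    rw [h6, hg]
    simp only [expNeg, indicator, RCLike.inner_apply]
    split_ifs with h7
    · rw [← Complex.exp_conj, smul_eq_mul, ← mul_assoc, ← Complex.exp_add, mul_comm]
      congr 2
      simp only [map_mul, map_neg, map_add, Complex.conj_I, Complex.conj_ofReal, map_ofNat,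
        conj_trivial]
      push_cast
      ring_nf
    · simp
  have h4 : (𝓕⁻ (h2.toLp g) : L2) = 0 := by
    refine Lp.ext ?_
    filter_upwards [fourierInv_toLp_coeFn h2 h1, Lp.coeFn_zero ℂ 2 volume] with x h5 h6
    rw [h5, h6, h3]
  have h5 : h2.toLp g = 0 := (Lp.fourierTransformₗᵢ ℝ ℂ).symm.map_eq_zero_iff.1 h4
  rw [mem_hardySpace_iff]
  have h6 : g =ᵐ[volume] 0 := h2.coeFn_toLp.symm.trans ((Lp.eq_zero_iff_ae_eq_zero).1 h5)
  filter_upwards [h6] with ξ h7 hξ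
  refine (mul_eq_zero.1 h7).resolve_left ?_
  rw [expNeg, indicator_of_mem (by simpa using hξ)]
  exact Complex.exp_ne_zero _

theorem integral_cauchyKer_mul_of_neg_of_neg {a b : ℂ} (ha : a.im < 0) (hb : b.im < 0) :
    ∫ x, cauchyKer a x * cauchyKer b x = 0 := by
  rw [← integral_mul_cauchyKer_eq_zero hb (cauchyL2_mem_hardySpace ha)]
  refine integral_congr_ae ?_
  filter_upwards [coeFn_cauchyL2 ha.ne] with x hx
  rw [hx]

theorem integral_cauchyKer_mul_of_pos_of_pos {a b : ℂ} (ha : 0 < a.im) (hb : 0 < b.im) :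
    ∫ x, cauchyKer a x * cauchyKer b x = 0 := by
  have h := integral_cauchyKer_mul_of_neg_of_neg (a := (starRingEnd ℂ) a)
    (b := (starRingEnd ℂ) b) (by simpa using ha) (by simpa using hb)
  simp_rw [← conj_cauchyKer, ← map_mul] at h
  rw [integral_conj] at h
  simpa using h

/-- The residue value, obtained from Plancherel as the integral of an exponential over a half-line.
-/
theorem integral_cauchyKer_mul_of_pos_of_neg {a b : ℂ} (ha : 0 < a.im) (hb : b.im < 0) :
    ∫ x, cauchyKer a x * cauchyKer b x = 2 * Real.pi * Complex.I / (a - b) := by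
  have ha' : ((starRingEnd ℂ) a).im < 0 := by simpa using ha
  have hab : a - b ≠ 0 := fun h => by
    have := congrArg Complex.im h
    simp at this; linarith
  have h1 := inner_cauchyL2 ha'.ne (cauchyL2 hb.ne)
  rw [← Lp.inner_fourier_eq, fourier_cauchyL2_of_neg ha', fourier_cauchyL2_of_neg hb,
    inner_smul_left, inner_smul_right, L2.inner_def] at h1
  have h2 : ∫ x, cauchyL2 hb.ne x * cauchyKer ((starRingEnd ℂ) ((starRingEnd ℂ) a)) x
      = ∫ x, cauchyKer a x * cauchyKer b x := by
    refine integral_congr_ae ?_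
    filter_upwards [coeFn_cauchyL2 hb.ne] with x hx
    rw [hx, mul_comm, Complex.conj_conj]
  rw [← h2, ← h1]
  have h3 : ∫ ξ : ℝ, inner ℂ (((memLp_expPos ha').toLp _ : L2) ξ) (((memLp_expPos hb).toLp _ : L2) ξ)
      = ∫ ξ : ℝ in Ioi 0, Complex.exp ((2 * Real.pi * Complex.I * (a - b)) * ξ) := by
    rw [← integral_indicator measurableSet_Ioi]
    refine integral_congr_ae ?_
    filter_upwards [(memLp_expPos ha').coeFn_toLp, (memLp_expPos hb).coeFn_toLp] with ξ h4 h5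
    rw [h4, h5]
    simp only [expPos, indicator, RCLike.inner_apply]
    split_ifs
    · rw [← Complex.exp_conj, ← Complex.exp_add]
      congr 1
      simp [map_ofNat]
      ring
    · simp
  rw [h3, integral_exp_mul_complex_Ioi]
  · simp [map_ofNat]
    field_simp
  · simp; nlinarith [Real.pi_pos]

end

/-! ### Partial fractions and the Cauchy transform -/

theorem cauchyKer_mul_cauchyKer {a b : ℂ} (ha : a.im ≠ 0) (hb : b.im ≠ 0) (hab : a ≠ b) (x : ℝ) :
    cauchyKer a x * cauchyKer b x = (a - b)⁻¹ * (cauchyKer a x - cauchyKer b x) := by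
  have h1 := ofReal_sub_ne_zero ha x
  have h2 := ofReal_sub_ne_zero hb x
  have h3 := sub_ne_zero.2 hab
  unfold cauchyKer
  field_simp
  ring

theorem integrable_mul_cauchyKer {F : ℝ → ℂ} (hF : MemLp F 2 volume) {a : ℂ} (ha : a.im ≠ 0) :
    Integrable fun x => F x * cauchyKer a x :=
  hF.integrable_mul (memLp_cauchyKer ha)

theorem norm_cauchyKer_le {a : ℂ} (ha : a.im ≠ 0) (x : ℝ) : ‖cauchyKer a x‖ ≤ 1 / |a.im| := by
  unfold cauchyKer
  rw [norm_div, norm_one]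
  apply one_div_le_one_div_of_le (abs_pos.2 ha)
  simpa using Complex.abs_im_le_norm ((x : ℂ) - a)

theorem MemLp.mul_cauchyKer {F : ℝ → ℂ} (hF : MemLp F 2 volume) {a : ℂ} (ha : a.im ≠ 0) :
    MemLp (fun x => F x * cauchyKer a x) 2 volume := by
  refine (hF.norm.const_mul (1 / |a.im|)).of_le
    (hF.1.mul (continuous_cauchyKer ha).aestronglyMeasurable) (ae_of_all _ fun x => ?_)
  rw [norm_mul, norm_mul, norm_norm, mul_comm, Real.norm_of_nonneg (by positivity)]
  exact mul_le_mul_of_nonneg_right (norm_cauchyKer_le ha x) (norm_nonneg _)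

theorem integral_mul_cauchyKer_mul_cauchyKer {F : ℝ → ℂ} (hF : MemLp F 2 volume) {a b : ℂ}
    (ha : a.im ≠ 0) (hb : b.im ≠ 0) (hab : a ≠ b) :
    ∫ x, F x * cauchyKer a x * cauchyKer b x
      = (a - b)⁻¹ * (∫ x, F x * cauchyKer a x) - (a - b)⁻¹ * ∫ x, F x * cauchyKer b x := by
  rw [← mul_sub, ← integral_sub (integrable_mul_cauchyKer hF ha) (integrable_mul_cauchyKer hF hb),
    ← integral_const_mul]
  refine integral_congr_ae (ae_of_all _ fun x => ?_)
  have := cauchyKer_mul_cauchyKer ha hb hab x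
  simp only
  rw [mul_assoc, this]
  ring

/-- The Cauchy transform of `F`, which for `F` in the Hardy space is its analytic extension. -/
def cauchyT (F : ℝ → ℂ) (ζ : ℂ) : ℂ := (2 * Real.pi * Complex.I)⁻¹ * ∫ x, F x * cauchyKer ζ x

/-- The derivative of the Cauchy transform. -/
def cauchyT' (F : ℝ → ℂ) (ζ : ℂ) : ℂ :=
  (2 * Real.pi * Complex.I)⁻¹ * ∫ x, F x * cauchyKer ζ x * cauchyKer ζ x

theorem two_pi_I_ne_zero : (2 * Real.pi * Complex.I : ℂ) ≠ 0 := by simp [Real.pi_ne_zero]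

theorem integral_eq_cauchyT (F : ℝ → ℂ) (ζ : ℂ) :
    ∫ x, F x * cauchyKer ζ x = 2 * Real.pi * Complex.I * cauchyT F ζ := by
  rw [cauchyT, mul_inv_cancel_left₀ two_pi_I_ne_zero]

/-- A pole expansion of a rational potential. -/
structure RatData (u : ℝ → ℝ) where
  /-- the number of poles in the upper half-plane -/
  P : ℕ
  /-- the residues -/
  c : Fin P → ℂ
  /-- the poles in the upper half-plane -/
  z : Fin P → ℂ
  c_ne : ∀ p, c p ≠ 0
  z_im : ∀ p, 0 < (z p).im
  z_inj : Function.Injective z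
  eq : ∀ x : ℝ, (u x : ℂ) = ∑ p, c p / ((x : ℂ) - z p)
      + (starRingEnd ℂ) (∑ p, c p / ((x : ℂ) - z p))

/-! ### Rational potentials: the equation on the line and in the upper half-plane -/

namespace RatData

variable {u : ℝ → ℝ} (d : RatData u)

/-- The rational function extending `u` to the complex plane. -/
def ext (ζ : ℂ) : ℂ :=
  ∑ p, d.c p / (ζ - d.z p) + ∑ p, (starRingEnd ℂ) (d.c p) / (ζ - (starRingEnd ℂ) (d.z p))

/-- The rational functions occurring as right-hand sides. -/
def src (a : Fin d.P → ℂ) (κ : ℂ) (ζ : ℂ) : ℂ := ∑ p, a p / (ζ - d.z p) - κ / (ζ + Complex.I)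

theorem ofReal_eq_ext (x : ℝ) : (u x : ℂ) = d.ext x := by
  rw [d.eq, ext, map_sum]
  simp

theorem ofReal_eq_sum_cauchyKer (x : ℝ) : (u x : ℂ) = ∑ p, d.c p * cauchyKer (d.z p) x
    + ∑ p, (starRingEnd ℂ) (d.c p) * cauchyKer ((starRingEnd ℂ) (d.z p)) x := by
  rw [d.ofReal_eq_ext, ext]
  simp [cauchyKer, div_eq_mul_inv]

theorem src_eq_sum_cauchyKer (a : Fin d.P → ℂ) (κ : ℂ) (x : ℝ) :
    d.src a κ x = ∑ p, a p * cauchyKer (d.z p) x - κ * cauchyKer (-Complex.I) x := by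
  simp [src, cauchyKer, div_eq_mul_inv]

theorem conj_z_im (p : Fin d.P) : ((starRingEnd ℂ) (d.z p)).im < 0 := by
  simpa using d.z_im p

theorem continuous_u (d : RatData u) : Continuous u := by
  have h : Continuous fun x => (u x : ℂ) := by
    simp_rw [d.ofReal_eq_sum_cauchyKer]
    exact (continuous_finsetSum _ fun p _ => continuous_const.mul
      (continuous_cauchyKer (d.z_im p).ne')).add (continuous_finsetSum _ fun p _ =>
        continuous_const.mul (continuous_cauchyKer (d.conj_z_im p).ne))
  exact (Complex.continuous_re.comp h)

theorem continuous_src (a : Fin d.P → ℂ) (κ : ℂ) : Continuous fun x : ℝ => d.src a κ x := by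
  simp_rw [d.src_eq_sum_cauchyKer]
  exact (continuous_finsetSum _ fun p _ => continuous_const.mul
      (continuous_cauchyKer (d.z_im p).ne')).sub (continuous_const.mul
        (continuous_cauchyKer (by simp)))

theorem memLp_src (a : Fin d.P → ℂ) (κ : ℂ) : MemLp (fun x : ℝ => d.src a κ x) 2 volume := by
  simp_rw [d.src_eq_sum_cauchyKer]
  exact (memLp_finsetSum _ fun p _ => (memLp_cauchyKer (d.z_im p).ne').const_mul _).sub
    ((memLp_cauchyKer (by simp)).const_mul _)

theorem exists_abs_le (d : RatData u) : ∃ C, 0 < C ∧ ∀ x, |u x| ≤ C / (1 + |x|) := by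
  choose C hC0 hC using fun p => exists_norm_cauchyKer_le (d.z_im p).ne'
  choose C' hC0' hC' using fun p => exists_norm_cauchyKer_le (d.conj_z_im p).ne
  refine ⟨∑ p, ‖d.c p‖ * C p + ∑ p, ‖d.c p‖ * C' p + 1, ?_, fun x => ?_⟩
  · have h1 : 0 ≤ ∑ p, ‖d.c p‖ * C p := Finset.sum_nonneg fun p _ => by have := hC0 p; positivity
    have h2 : 0 ≤ ∑ p, ‖d.c p‖ * C' p := Finset.sum_nonneg fun p _ => by have := hC0' p; positivity
    linarith
  · rw [← Real.norm_eq_abs, ← Complex.norm_real, d.ofReal_eq_sum_cauchyKer, add_div, add_div,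
      Finset.sum_div, Finset.sum_div]
    have h3 : 0 ≤ 1 / (1 + |x|) := by positivity
    refine (norm_add_le _ _).trans ((add_le_add (norm_sum_le _ _) (norm_sum_le _ _)).trans ?_)
    refine le_add_of_le_of_nonneg (add_le_add (Finset.sum_le_sum fun p _ => ?_)
      (Finset.sum_le_sum fun p _ => ?_)) h3
    · rw [norm_mul, mul_div_assoc]
      exact mul_le_mul_of_nonneg_left (hC p x) (norm_nonneg _)
    · rw [norm_mul, mul_div_assoc, RCLike.norm_conj]
      exact mul_le_mul_of_nonneg_left (hC' p x) (norm_nonneg _)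

theorem memLp_u_mul (d : RatData u) {F : ℝ → ℂ} (hF : MemLp F 2 volume) :
    MemLp (fun x => (u x : ℂ) * F x) 2 volume := by
  obtain ⟨C, hC0, hC⟩ := d.exists_abs_le
  refine (hF.norm.const_mul C).of_le
    ((Complex.continuous_ofReal.comp d.continuous_u).aestronglyMeasurable.mul hF.1)
    (ae_of_all _ fun x => ?_)
  rw [norm_mul, norm_mul, norm_norm, Real.norm_of_nonneg hC0.le, Complex.norm_real,
    Real.norm_eq_abs]
  refine mul_le_mul_of_nonneg_right ((hC x).trans ?_) (norm_nonneg _)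
  exact div_le_self hC0.le (by linarith [abs_nonneg x])

/-- Partial fractions: the Cauchy transform of `u F` for `F` in the Hardy space. -/
theorem integral_u_mul_cauchyKer {F : ℝ → ℂ} (hF : MemLp F 2 volume)
    (hH : ∀ a : ℂ, a.im < 0 → ∫ x, F x * cauchyKer a x = 0) {ζ : ℂ} (hζ : ζ.im ≠ 0)
    (h1 : ∀ p, d.z p ≠ ζ) (h2 : ∀ p, (starRingEnd ℂ) (d.z p) ≠ ζ) :
    ∫ x, (u x : ℂ) * F x * cauchyKer ζ x
      = 2 * Real.pi * Complex.I * (d.ext ζ * cauchyT F ζ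
        - ∑ p, d.c p * cauchyT F (d.z p) / (ζ - d.z p)) := by
  have e1 : ∀ x : ℝ, (u x : ℂ) * F x * cauchyKer ζ x
      = ∑ p, d.c p * (F x * cauchyKer (d.z p) x * cauchyKer ζ x)
        + ∑ p, (starRingEnd ℂ) (d.c p)
          * (F x * cauchyKer ((starRingEnd ℂ) (d.z p)) x * cauchyKer ζ x) := by
    intro x
    rw [d.ofReal_eq_sum_cauchyKer, add_mul, add_mul, Finset.sum_mul, Finset.sum_mul,
      Finset.sum_mul, Finset.sum_mul]
    congr 1 <;> exact Finset.sum_congr rfl fun p _ => by ring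
  have i1 : ∀ {a : ℂ}, a.im ≠ 0 → Integrable fun x => F x * cauchyKer a x * cauchyKer ζ x :=
    fun ha => integrable_mul_cauchyKer (MemLp.mul_cauchyKer hF ha) hζ
  have i2 : ∀ p : Fin d.P, (d.z p).im ≠ 0 := fun p => (d.z_im p).ne'
  have i3 : ∀ p : Fin d.P, ((starRingEnd ℂ) (d.z p)).im ≠ 0 := fun p => (d.conj_z_im p).ne
  simp_rw [e1]
  rw [integral_add (integrable_finsetSum _ fun p _ => (i1 (i2 p)).const_mul _)
      (integrable_finsetSum _ fun p _ => (i1 (i3 p)).const_mul _),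
    integral_finsetSum _ fun p _ => (i1 (i2 p)).const_mul _,
    integral_finsetSum _ fun p _ => (i1 (i3 p)).const_mul _]
  simp_rw [integral_const_mul]
  have e2 : ∀ p, ∫ x, F x * cauchyKer (d.z p) x * cauchyKer ζ x = _ := fun p =>
    integral_mul_cauchyKer_mul_cauchyKer hF (i2 p) hζ (h1 p)
  have e3 : ∀ p, ∫ x, F x * cauchyKer ((starRingEnd ℂ) (d.z p)) x * cauchyKer ζ x = _ := fun p =>
    integral_mul_cauchyKer_mul_cauchyKer hF (i3 p) hζ (h2 p)
  simp_rw [e2, e3, hH _ (d.conj_z_im _), integral_eq_cauchyT]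
  rw [ext, add_mul, mul_sub, mul_add, Finset.sum_mul, Finset.sum_mul, Finset.mul_sum,
    Finset.mul_sum, Finset.mul_sum, add_sub_right_comm, ← Finset.sum_sub_distrib]
  congr 1
  · refine Finset.sum_congr rfl fun p _ => ?_
    have h3 : d.z p - ζ ≠ 0 := sub_ne_zero.2 (h1 p)
    have h4 : ζ - d.z p ≠ 0 := sub_ne_zero.2 (h1 p).symm
    have h5 : (d.z p - ζ)⁻¹ = -(ζ - d.z p)⁻¹ := by rw [← inv_neg, neg_sub]
    rw [h5]
    field_simp
    ring
  · refine Finset.sum_congr rfl fun p _ => ?_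
    have h3 : (starRingEnd ℂ) (d.z p) - ζ ≠ 0 := sub_ne_zero.2 (h2 p)
    have h4 : ζ - (starRingEnd ℂ) (d.z p) ≠ 0 := sub_ne_zero.2 (h2 p).symm
    have h5 : ((starRingEnd ℂ) (d.z p) - ζ)⁻¹ = -(ζ - (starRingEnd ℂ) (d.z p))⁻¹ := by rw [← inv_neg, neg_sub]
    rw [h5]
    field_simp
    ring

theorem exists_pos_ne (n : ℕ) (y : Fin n → ℝ) : ∃ t : ℝ, 0 < t ∧ ∀ p, y p ≠ t := by
  have h : (Ioi (0 : ℝ) \ range y).Nonempty :=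
    ((Ioi_infinite (0 : ℝ)).sdiff (finite_range y)).nonempty
  obtain ⟨t, ht, hn⟩ := h
  exact ⟨t, ht, fun p hp => hn ⟨p, hp⟩⟩

theorem coeFn_sum_cauchyL2 (a : Fin d.P → ℂ) :
    (∑ p, a p • cauchyL2 (d.z_im p).ne' : L2) =ᵐ[volume]
      fun x => ∑ p, a p * cauchyKer (d.z p) x := by
  have h1 : ∀ᵐ x : ℝ, ∀ p : Fin d.P, (a p • cauchyL2 (d.z_im p).ne' : L2) x
      = a p * cauchyKer (d.z p) x := by
    rw [ae_all_iff]
    intro p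
    filter_upwards [Lp.coeFn_smul (a p) (cauchyL2 (d.z_im p).ne'),
      coeFn_cauchyL2 (d.z_im p).ne'] with x h2 h3
    rw [h2, Pi.smul_apply, h3, smul_eq_mul]
  have h2 := Lp.coeFn_fun_finsetSum (p := 2) (μ := (volume : Measure ℝ)) Finset.univ
    fun p => (a p • cauchyL2 (d.z_im p).ne' : L2)
  filter_upwards [h1, h2] with x h3 h4
  rw [h4]
  exact Finset.sum_congr rfl fun p _ => h3 p

/-- The Szegő projection of `u f` for `f` in the Hardy space. -/
theorem cauchyProj_u_mul {f v : L2} (hf : f ∈ hardySpace)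
    (hv : v =ᵐ[volume] fun x => (u x : ℂ) * f x) :
    cauchyProj v = v - ∑ p, (d.c p * cauchyT f (d.z p)) • cauchyL2 (d.z_im p).ne' := by
  set s : L2 := ∑ p, (d.c p * cauchyT f (d.z p)) • cauchyL2 (d.z_im p).ne' with hs
  have hsx : s =ᵐ[volume] fun x => ∑ p, d.c p * cauchyT f (d.z p) * cauchyKer (d.z p) x :=
    d.coeFn_sum_cauchyL2 _
  have hmem : v - s ∈ hardySpace := by
    -- The test line `Im b = -y` must miss the conjugate poles, where the partial fraction formula
    -- degenerates.
    obtain ⟨y, hy, hyp⟩ := exists_pos_ne d.P fun p => (d.z p).im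
    refine mem_hardySpace_of_integral_eq_zero hy fun b hb => ?_
    have hb0 : b.im < 0 := by linarith
    have e1 : ∫ x, (v - s : L2) x * cauchyKer b x = ∫ x, ((u x : ℂ) * f x * cauchyKer b x
        - ∑ p, d.c p * cauchyT f (d.z p) * (cauchyKer (d.z p) x * cauchyKer b x)) := by
      refine integral_congr_ae ?_
      filter_upwards [Lp.coeFn_sub v s, hv, hsx] with x h1 h2 h3
      rw [h1, Pi.sub_apply, h2, h3, sub_mul, Finset.sum_mul]
      congr 1
      exact Finset.sum_congr rfl fun p _ => by ring
    have i1 : ∀ p : Fin d.P, Integrable fun x => cauchyKer (d.z p) x * cauchyKer b x := fun p =>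
      integrable_mul_cauchyKer (memLp_cauchyKer (d.z_im p).ne') hb0.ne
    rw [e1, integral_sub (integrable_mul_cauchyKer (d.memLp_u_mul (Lp.memLp f)) hb0.ne)
      (integrable_finsetSum _ fun p _ => (i1 p).const_mul _),
      integral_finsetSum _ fun p _ => (i1 p).const_mul _,
      d.integral_u_mul_cauchyKer (Lp.memLp f) (fun a ha => integral_mul_cauchyKer_eq_zero ha hf)
        hb0.ne (fun p h => by have := d.z_im p; rw [h] at this; linarith)
        (fun p h => hyp p (by have := congrArg Complex.im h; simp at this; linarith))]
    simp_rw [integral_const_mul, integral_cauchyKer_mul_of_pos_of_neg (d.z_im _) hb0]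
    rw [cauchyT, integral_mul_cauchyKer_eq_zero hb0 hf, mul_zero, mul_zero, zero_sub, mul_neg,
      Finset.mul_sum, ← neg_add', neg_eq_zero, ← Finset.sum_add_distrib]
    refine Finset.sum_eq_zero fun p _ => ?_
    rw [← neg_sub b, div_neg]
    ring
  have hperp : ∀ w ∈ hardySpace, inner ℂ w s = 0 := by
    intro w hw
    rw [hs, inner_sum]
    refine Finset.sum_eq_zero fun p _ => ?_
    rw [inner_smul_right, ← inner_conj_symm, inner_cauchyL2_eq_zero (d.z_im p) hw]
    simp
  refine Submodule.eq_starProjection_of_mem_of_inner_eq_zero hmem fun w hw => ?_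
  rw [sub_sub_cancel, ← inner_conj_symm, hperp w hw, map_zero]


/-- Solutions `F` of `-iε F' = (u + lam) F - src` in the Hardy space, with the equation continued
to the upper half-plane. -/
structure Sol (ε lam : ℝ) (a : Fin d.P → ℂ) (κ : ℂ) (F : ℝ → ℂ) : Prop where
  deriv : ∀ x, HasDerivAt F (Complex.I / ε * (((u x : ℂ) + lam) * F x - d.src a κ x)) x
  memLp : MemLp F 2 volume
  hardy : ∀ b : ℂ, b.im < 0 → ∫ x, F x * cauchyKer b x = 0
  cauchy : ∀ ζ : ℂ, 0 < ζ.im → (∀ p, d.z p ≠ ζ) →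
    -(Complex.I * ε) * cauchyT' F ζ = (d.ext ζ + lam) * cauchyT F ζ - d.src a κ ζ

theorem hasDerivAt_cauchyKer {a : ℂ} (ha : a.im ≠ 0) (x : ℝ) :
    HasDerivAt (cauchyKer a) (-(cauchyKer a x * cauchyKer a x)) x := by
  have h0 := ofReal_sub_ne_zero ha x
  have h1 : HasDerivAt (fun y : ℝ => (y : ℂ) - a) 1 x :=
    (Complex.ofRealCLM.hasDerivAt (x := x)).sub_const a
  convert! (hasDerivAt_const x (1 : ℂ)).div h1 h0 using 1
  unfold cauchyKer
  field_simp
  ring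

theorem integral_src_mul_cauchyKer (a : Fin d.P → ℂ) (κ : ℂ) {ζ : ℂ} (hζ : 0 < ζ.im) :
    ∫ x : ℝ, d.src a κ x * cauchyKer ζ x = -(κ * (2 * Real.pi * Complex.I / (ζ + Complex.I))) := by
  have i1 : ∀ p : Fin d.P, Integrable fun x => cauchyKer (d.z p) x * cauchyKer ζ x := fun p =>
    integrable_mul_cauchyKer (memLp_cauchyKer (d.z_im p).ne') hζ.ne'
  have hI : (-Complex.I).im < 0 := by simp
  have i2 : Integrable fun x => cauchyKer (-Complex.I) x * cauchyKer ζ x :=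
    integrable_mul_cauchyKer (memLp_cauchyKer hI.ne) hζ.ne'
  have e1 : ∀ x : ℝ, d.src a κ x * cauchyKer ζ x
      = ∑ p, a p * (cauchyKer (d.z p) x * cauchyKer ζ x)
        - κ * (cauchyKer (-Complex.I) x * cauchyKer ζ x) := by
    intro x
    rw [d.src_eq_sum_cauchyKer, sub_mul, Finset.sum_mul]
    simp_rw [mul_assoc]
  simp_rw [e1]
  rw [integral_sub (integrable_finsetSum _ fun p _ => (i1 p).const_mul _) (i2.const_mul _),
    integral_finsetSum _ fun p _ => (i1 p).const_mul _]
  simp_rw [integral_const_mul, integral_cauchyKer_mul_of_pos_of_pos (d.z_im _) hζ,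
    mul_comm (cauchyKer (-Complex.I) _), integral_cauchyKer_mul_of_pos_of_neg hζ hI]
  simp

/-- The continued equation follows from the equation on the real line. -/
theorem Sol.mk' {ε lam : ℝ} (hε : ε ≠ 0) {κ : ℂ} {F : ℝ → ℂ} (hF : MemLp F 2 volume)
    (hH : ∀ b : ℂ, b.im < 0 → ∫ x, F x * cauchyKer b x = 0)
    (hd : ∀ x, HasDerivAt F (Complex.I / ε * (((u x : ℂ) + lam) * F x
      - d.src (fun p => d.c p * cauchyT F (d.z p)) κ x)) x) :
    d.Sol ε lam (fun p => d.c p * cauchyT F (d.z p)) κ F := by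
  refine ⟨hd, hF, hH, fun ζ hζ hp => ?_⟩
  set a := fun p => d.c p * cauchyT F (d.z p) with ha
  have j1 := integrable_mul_cauchyKer (d.memLp_u_mul hF) hζ.ne'
  have j2 := integrable_mul_cauchyKer hF hζ.ne'
  have j3 := integrable_mul_cauchyKer (d.memLp_src a κ) hζ.ne'
  have j4 := integrable_mul_cauchyKer (MemLp.mul_cauchyKer hF hζ.ne') hζ.ne'
  have hε' : (ε : ℂ) ≠ 0 := by exact_mod_cast hε
  -- The derivative of `F` times the Cauchy kernel integrates to zero. As the kernel has derivative
  -- minus its square, the second term is `cauchyT'`; in the first, partial fractions for `u F`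
  -- produce exactly the coefficients `c_p F(z_p)` of the source.
  have key : ∫ x, (Complex.I / ε * (((u x : ℂ) * F x * cauchyKer ζ x + lam * (F x * cauchyKer ζ x))
      - d.src a κ x * cauchyKer ζ x) - F x * cauchyKer ζ x * cauchyKer ζ x) = 0 := by
    refine integral_eq_zero_of_hasDerivAt_of_integrable (f := fun x => F x * cauchyKer ζ x)
      (fun x => ?_) ((((j1.add (j2.const_mul _)).sub j3).const_mul _).sub j4) j2
    convert! (hd x).mul (hasDerivAt_cauchyKer hζ.ne' x) using 1
    ring
  have j5 : Integrable fun x : ℝ => (u x : ℂ) * F x * cauchyKer ζ x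
      + lam * (F x * cauchyKer ζ x) := j1.add (j2.const_mul (lam : ℂ))
  have j6 : Integrable fun x : ℝ => (u x : ℂ) * F x * cauchyKer ζ x
      + lam * (F x * cauchyKer ζ x) - d.src a κ x * cauchyKer ζ x := j5.sub j3
  rw [integral_sub (j6.const_mul _) j4, integral_const_mul, integral_sub j5 j3, integral_add j1 (j2.const_mul (lam : ℂ)),
    integral_const_mul, d.integral_u_mul_cauchyKer hF hH hζ.ne' hp
      (fun p h => by have := d.conj_z_im p; rw [h] at this; linarith),
    d.integral_src_mul_cauchyKer a κ hζ, integral_eq_cauchyT, sub_eq_zero] at key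
  rw [cauchyT', ← key, src]
  have h0 := two_pi_I_ne_zero
  field_simp
  simp only [Complex.I_sq]
  ring

theorem Sol.smul {ε lam : ℝ} {a : Fin d.P → ℂ} {κ : ℂ} {F : ℝ → ℂ} (h : d.Sol ε lam a κ F) (t : ℂ) :
    d.Sol ε lam (fun p => t * a p) (t * κ) (fun x => t * F x) := by
  have hs : ∀ ζ : ℂ, d.src (fun p => t * a p) (t * κ) ζ = t * d.src a κ ζ := fun ζ => by
    simp only [src, mul_sub, Finset.mul_sum, mul_div_assoc]
  refine ⟨fun x => ?_, h.memLp.const_mul t, fun b hb => ?_, fun ζ hζ hp => ?_⟩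
  · convert! (h.deriv x).const_mul t using 1
    rw [hs]; ring
  · simp_rw [mul_assoc, integral_const_mul, h.hardy b hb, mul_zero]
  · have := h.cauchy ζ hζ hp
    rw [hs]
    unfold cauchyT cauchyT' at *
    simp_rw [mul_assoc t, integral_const_mul]
    linear_combination t * this

/-- Conjugation moves the poles of the source to the lower half-plane, where the Hardy condition
kills their contribution whatever the coefficients. Only the `κ` term survives; this is the symmetry
behind the Lagrange identity. -/
theorem integral_conj_src_mul (a : Fin d.P → ℂ) (κ : ℂ) {F : ℝ → ℂ} (hF : MemLp F 2 volume)
    (hH : ∀ b : ℂ, b.im < 0 → ∫ x, F x * cauchyKer b x = 0) :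
    ∫ x : ℝ, (starRingEnd ℂ) (d.src a κ x) * F x
      = -((starRingEnd ℂ) κ * ∫ x, F x * cauchyKer Complex.I x) := by
  have e1 : ∀ x : ℝ, (starRingEnd ℂ) (d.src a κ x) * F x
      = ∑ p, (starRingEnd ℂ) (a p) * (F x * cauchyKer ((starRingEnd ℂ) (d.z p)) x)
        - (starRingEnd ℂ) κ * (F x * cauchyKer Complex.I x) := by
    intro x
    rw [d.src_eq_sum_cauchyKer, map_sub, map_sum, sub_mul, Finset.sum_mul]
    simp_rw [map_mul, conj_cauchyKer]
    simp only [map_neg, Complex.conj_I, neg_neg]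
    congr 1
    · exact Finset.sum_congr rfl fun p _ => by ring
    · ring
  have i1 : ∀ p : Fin d.P, Integrable fun x => F x * cauchyKer ((starRingEnd ℂ) (d.z p)) x :=
    fun p => integrable_mul_cauchyKer hF (d.conj_z_im p).ne
  have i2 : Integrable fun x => F x * cauchyKer Complex.I x :=
    integrable_mul_cauchyKer hF (by simp)
  simp_rw [e1]
  rw [integral_sub (integrable_finsetSum _ fun p _ => (i1 p).const_mul _) (i2.const_mul _),
    integral_finsetSum _ fun p _ => (i1 p).const_mul _]
  simp_rw [integral_const_mul, hH _ (d.conj_z_im _)]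
  simp

theorem MemLp.conj {F : ℝ → ℂ} (hF : MemLp F 2 volume) :
    MemLp (fun x => (starRingEnd ℂ) (F x)) 2 volume :=
  hF.star

/-- The Lagrange identity for two solutions. -/
theorem Sol.lagrange {ε lam mu : ℝ} (hε : ε ≠ 0) {a a' : Fin d.P → ℂ} {κ κ' : ℂ} {F F' : ℝ → ℂ}
    (h : d.Sol ε lam a κ F) (h' : d.Sol ε mu a' κ' F') :
    ((mu : ℂ) - lam) * ∫ x, (starRingEnd ℂ) (F x) * F' x
      = (starRingEnd ℂ) κ * (∫ x, F' x * cauchyKer Complex.I x)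
        - κ' * (starRingEnd ℂ) (∫ x, F x * cauchyKer Complex.I x) := by
  have hε' : (ε : ℂ) ≠ 0 := by exact_mod_cast hε
  have j1 : Integrable fun x => (starRingEnd ℂ) (F x) * F' x :=
    (MemLp.conj h.memLp).integrable_mul h'.memLp
  have j2 : Integrable fun x : ℝ => (starRingEnd ℂ) (d.src a κ x) * F' x :=
    (MemLp.conj (d.memLp_src a κ)).integrable_mul h'.memLp
  have j3 : Integrable fun x : ℝ => (starRingEnd ℂ) (d.src a' κ' x) * F x :=
    (MemLp.conj (d.memLp_src a' κ')).integrable_mul h.memLp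
  have j3' : Integrable fun x : ℝ => (starRingEnd ℂ) ((starRingEnd ℂ) (d.src a' κ' x) * F x) :=
    (Complex.conjCLE : ℂ →L[ℝ] ℂ).integrable_comp j3
  have key : ∫ x, Complex.I / ε * (((mu : ℂ) - lam) * ((starRingEnd ℂ) (F x) * F' x)
      + (starRingEnd ℂ) (d.src a κ x) * F' x
      - (starRingEnd ℂ) ((starRingEnd ℂ) (d.src a' κ' x) * F x)) = 0 := by
    refine integral_eq_zero_of_hasDerivAt_of_integrable
      (f := fun x => (starRingEnd ℂ) (F x) * F' x)
      (fun x => ?_) ((((j1.const_mul _).add j2).sub j3').const_mul _) j1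
    have hc : HasDerivAt (fun x => (starRingEnd ℂ) (F x))
        ((starRingEnd ℂ) (Complex.I / ε * (((u x : ℂ) + lam) * F x - d.src a κ x))) x :=
      (h.deriv x).star
    convert! hc.mul (h'.deriv x) using 1
    simp only [map_mul, map_sub, map_add, map_div₀, Complex.conj_I, Complex.conj_ofReal,
      Complex.conj_conj]
    field_simp
    ring
  rw [integral_const_mul] at key
  have key2 := (mul_eq_zero.1 key).resolve_left (div_ne_zero Complex.I_ne_zero hε')
  have j4 : Integrable fun x : ℝ => ((mu : ℂ) - lam) * ((starRingEnd ℂ) (F x) * F' x)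
      + (starRingEnd ℂ) (d.src a κ x) * F' x := (j1.const_mul _).add j2
  rw [integral_sub j4 j3', integral_add (j1.const_mul _) j2,
    integral_const_mul, integral_conj, d.integral_conj_src_mul a κ h'.memLp h'.hardy,
    d.integral_conj_src_mul a' κ' h.memLp h.hardy] at key2
  simp only [map_neg, map_mul, Complex.conj_conj] at key2
  linear_combination key2

end RatData

/-- Equations `(ℒ - lam) f = κ k` yield solutions of the differential equation. -/
theorem RatData.exists_sol_of_laxGraph {u : ℝ → ℝ} (d : RatData u) {ε lam : ℝ} (hε : ε ≠ 0)
    {f : L2} {κ : ℂ} {k : L2} (hk : k =ᵐ[volume] cauchyKer (-Complex.I))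
    (h : LaxGraph ε u f ((lam : ℂ) • f + κ • k)) :
    ∃ F : ℝ → ℂ, f =ᵐ[volume] F ∧
      d.Sol ε lam (fun p => d.c p * cauchyT F (d.z p)) κ F := by
  obtain ⟨hf, g, v, ⟨F, hfF, hF⟩, hv, hw⟩ := h
  have hε' : (ε : ℂ) ≠ 0 := by exact_mod_cast hε
  rw [d.cauchyProj_u_mul hf hv] at hw
  set a : Fin d.P → ℂ := fun p => d.c p * cauchyT f (d.z p) with ha
  have haF : a = fun p => d.c p * cauchyT F (d.z p) := by
    funext p
    simp only [ha, cauchyT]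
    congr 2
    refine integral_congr_ae ?_
    filter_upwards [hfF] with x hx
    rw [hx]
  have hg : g =ᵐ[volume]
      fun x => Complex.I / ε * (((u x : ℂ) + lam) * F x - d.src a κ x) := by
    have h1 : ∀ᵐ x : ℝ, ((lam : ℂ) • f + κ • k : L2) x
        = (-(Complex.I * (ε : ℂ)) • g - (v - ∑ p, a p • cauchyL2 (d.z_im p).ne') : L2) x := by
      rw [hw]; exact ae_of_all _ fun x => rfl
    filter_upwards [h1, hfF, hk, hv, d.coeFn_sum_cauchyL2 a,
      Lp.coeFn_add ((lam : ℂ) • f) (κ • k), Lp.coeFn_smul (lam : ℂ) f, Lp.coeFn_smul κ k,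
      Lp.coeFn_sub (-(Complex.I * (ε : ℂ)) • g) (v - ∑ p, a p • cauchyL2 (d.z_im p).ne'),
      Lp.coeFn_sub v (∑ p, a p • cauchyL2 (d.z_im p).ne'),
      Lp.coeFn_smul (-(Complex.I * (ε : ℂ))) g]
      with x e1 e2 e3 e4 e5 e6 e7 e8 e9 e10 e11
    rw [e6, Pi.add_apply, e7, e8, e9, Pi.sub_apply, e11, e10, Pi.sub_apply, e4, e5, Pi.smul_apply,
      Pi.smul_apply, Pi.smul_apply, e3, e2] at e1
    simp only [smul_eq_mul] at e1
    rw [d.src_eq_sum_cauchyKer]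
    field_simp
    linear_combination (-Complex.I) * e1 + (ε : ℂ) * g x * Complex.I_sq
  have hFc : Continuous F := by
    have h1 : F = fun y => F 0 + ∫ t in (0 : ℝ)..y, g t := by
      funext y; rw [hF]; ring
    rw [h1]
    refine continuous_const.add (intervalIntegral.continuous_primitive (fun x y => ?_) 0)
    exact ((L2.locallyIntegrable g).integrableOn_isCompact isCompact_uIcc).intervalIntegrable
  have hGc : Continuous fun x : ℝ => Complex.I / ε * (((u x : ℂ) + lam) * F x - d.src a κ x) :=
    continuous_const.mul ((((Complex.continuous_ofReal.comp d.continuous_u).add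
      continuous_const).mul hFc).sub (d.continuous_src a κ))
  refine ⟨F, hfF, ?_⟩
  have hmem : MemLp F 2 volume := (memLp_congr_ae hfF).1 (Lp.memLp f)
  refine RatData.Sol.mk' d hε hmem (fun b hb => ?_) fun x => ?_
  · rw [← integral_mul_cauchyKer_eq_zero hb hf]
    refine integral_congr_ae ?_
    filter_upwards [hfF] with x hx
    rw [hx]
  · rw [← haF]
    -- The formula for `g` holds only almost everywhere, but its right-hand side is continuous and
    -- `F` is a primitive of it, so the equation holds at every point.
    have h1 : F = fun y => F 0
        + ∫ t in (0 : ℝ)..y, Complex.I / ε * (((u t : ℂ) + lam) * F t - d.src a κ t) := by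
      funext y
      rw [← intervalIntegral.integral_congr_ae (hg.mono fun t ht _ => ht), hF]; ring
    have h2 : HasDerivAt (fun y => F 0
        + ∫ t in (0 : ℝ)..y, Complex.I / ε * (((u t : ℂ) + lam) * F t - d.src a κ t))
        (Complex.I / ε * (((u x : ℂ) + lam) * F x - d.src a κ x)) x :=
      (intervalIntegral.integral_hasDerivAt_right (hGc.intervalIntegrable _ _)
      (hGc.stronglyMeasurableAtFilter _ _) hGc.continuousAt).const_add _
    rwa [← h1] at h2

/-! ### The free resolvent, compactness and the Weyl function -/

theorem memLp_bounded_mul {m : ℝ → ℂ} (hm : Measurable m) {C : ℝ} (hC : ∀ x, ‖m x‖ ≤ C)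
    (f : L2) : MemLp (fun x => m x * f x) 2 volume := by
  refine ((Lp.memLp f).norm.const_mul C).of_le
    (hm.aestronglyMeasurable.mul (Lp.memLp f).1) (ae_of_all _ fun x => ?_)
  rw [norm_mul, norm_mul, norm_norm, Real.norm_of_nonneg ((norm_nonneg _).trans (hC x))]
  exact mul_le_mul_of_nonneg_right (hC x) (norm_nonneg _)

/-- Multiplication of `L²` functions by a bounded measurable function, as a linear map. -/
def mulL2Lin (m : ℝ → ℂ) (hm : Measurable m) (C : ℝ) (hC : ∀ x, ‖m x‖ ≤ C) : L2 →ₗ[ℂ] L2 where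
  toFun := fun f => (memLp_bounded_mul hm hC f).toLp _
  map_add' := fun f g => by
    rw [← MemLp.toLp_add]
    refine MemLp.toLp_congr _ _ ?_
    filter_upwards [Lp.coeFn_add f g] with x hx
    rw [hx, Pi.add_apply, Pi.add_apply, mul_add]
  map_smul' := fun c f => by
    rw [RingHom.id_apply, ← MemLp.toLp_const_smul]
    refine MemLp.toLp_congr _ _ ?_
    filter_upwards [Lp.coeFn_smul c f] with x hx
    rw [hx, Pi.smul_apply, Pi.smul_apply, smul_eq_mul, smul_eq_mul]
    ring

theorem mulL2Lin_coeFn {m : ℝ → ℂ} (hm : Measurable m) {C : ℝ} (hC : ∀ x, ‖m x‖ ≤ C) (f : L2) :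
    mulL2Lin m hm C hC f =ᵐ[volume] fun x => m x * f x :=
  (memLp_bounded_mul hm hC f).coeFn_toLp

theorem norm_mulL2Lin_le {m : ℝ → ℂ} (hm : Measurable m) {C : ℝ} (hC : ∀ x, ‖m x‖ ≤ C) (f : L2) :
    ‖mulL2Lin m hm C hC f‖ ≤ C * ‖f‖ := by
  refine Lp.norm_le_mul_norm_of_ae_le_mul ?_
  filter_upwards [mulL2Lin_coeFn hm hC f] with x hx
  rw [hx, norm_mul]
  exact mul_le_mul_of_nonneg_right (hC x) (norm_nonneg _)

/-- Multiplication of `L²` functions by a bounded measurable function. -/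
def mulL2 (m : ℝ → ℂ) (hm : Measurable m) (C : ℝ) (hC : ∀ x, ‖m x‖ ≤ C) : L2 →L[ℂ] L2 :=
  (mulL2Lin m hm C hC).mkContinuous C (norm_mulL2Lin_le hm hC)

theorem mulL2_coeFn {m : ℝ → ℂ} (hm : Measurable m) {C : ℝ} (hC : ∀ x, ‖m x‖ ≤ C) (f : L2) :
    mulL2 m hm C hC f =ᵐ[volume] fun x => m x * f x :=
  mulL2Lin_coeFn hm hC f

theorem fourier_indicator_Ioc {x y : ℝ} (hxy : x ≤ y) {ξ : ℝ} (hξ : ξ ≠ 0) :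
    𝓕 ((Ioc x y).indicator fun _ => (1 : ℂ)) ξ
      = (2 * Real.pi * Complex.I * ξ)⁻¹ * (Complex.exp (-(2 * Real.pi * Complex.I * ξ) * x)
        - Complex.exp (-(2 * Real.pi * Complex.I * ξ) * y)) := by
  have hc : -(2 * Real.pi * Complex.I * ξ : ℂ) ≠ 0 := by
    simp [Real.pi_ne_zero, hξ]
  rw [Real.fourier_real_eq_integral_exp_smul]
  have e : ∀ t : ℝ, Complex.exp (((-2 * Real.pi * t * ξ : ℝ) : ℂ) * Complex.I)
      • (Ioc x y).indicator (fun _ => (1 : ℂ)) t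
      = (Ioc x y).indicator (fun t : ℝ => Complex.exp (-(2 * Real.pi * Complex.I * ξ) * t)) t := by
    intro t
    unfold indicator
    split_ifs
    · rw [smul_eq_mul, mul_one]
      congr 1
      push_cast
      ring
    · simp
  simp_rw [e]
  rw [integral_indicator measurableSet_Ioc, ← intervalIntegral.integral_of_le hxy,
    integral_exp_mul_complex hc]
  field_simp
  ring

/-- Cauchy-Schwarz: `(1 + iξ) f` and `1 / (ξ - i)` are both square integrable, and `1 + iξ = i (ξ -
i)`. -/
theorem integrable_of_mul_L2 {f g : L2}
    (h : g =ᵐ[volume] fun ξ : ℝ => 2 * Real.pi * Complex.I * ξ * f ξ) : Integrable f := by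
  have h1 : MemLp (fun ξ : ℝ => (1 + (ξ : ℂ) * Complex.I) * f ξ) 2 volume := by
    have h2 := (Lp.memLp f).add ((Lp.memLp g).const_mul (2 * Real.pi)⁻¹)
    refine (memLp_congr_ae ?_).1 h2
    filter_upwards [h] with ξ hξ
    have : (Real.pi : ℂ) ≠ 0 := by exact_mod_cast Real.pi_ne_zero
    rw [Pi.add_apply, hξ]
    field_simp
  have h3 : MemLp (cauchyKer Complex.I) 2 volume := memLp_cauchyKer (by simp)
  refine (((h1.integrable_mul h3).const_mul (-Complex.I)).congr (ae_of_all _ fun ξ => ?_))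
  have h0 := ofReal_sub_ne_zero (a := Complex.I) (by simp) ξ
  have h5 : (1 + (ξ : ℂ) * Complex.I) = Complex.I * (ξ - Complex.I) := by
    linear_combination Complex.I_sq
  simp only [cauchyKer, Pi.mul_apply]
  rw [h5]
  field_simp
  rw [Complex.I_sq]; ring

/-- Functions with square integrable `ξ 𝓕f(ξ)` have an `L²` derivative. -/
theorem isL2Deriv_of_fourier {f g : L2}
    (h : (𝓕 g : L2) =ᵐ[volume] fun ξ : ℝ => 2 * Real.pi * Complex.I * ξ * (𝓕 f : L2) ξ) :
    IsL2Deriv f g := by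
  have hi : Integrable (𝓕 f : L2) := integrable_of_mul_L2 h
  refine ⟨𝓕⁻ ((𝓕 f : L2) : ℝ → ℂ), ?_, ?_⟩
  · have := fourierInv_coeFn (𝓕 f : L2) hi
    rwa [FourierTransform.fourierInv_fourier_eq] at this
  have key : ∀ x y : ℝ, x ≤ y → ∫ t in x..y, g t
      = 𝓕⁻ ((𝓕 f : L2) : ℝ → ℂ) y - 𝓕⁻ ((𝓕 f : L2) : ℝ → ℂ) x := by
    intro x y hxy
    have hm : MemLp ((Ioc x y).indicator fun _ => (1 : ℂ)) 2 volume :=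
      memLp_indicator_const 2 measurableSet_Ioc 1 (Or.inr (by simp))
    have hm1 : Integrable ((Ioc x y).indicator fun _ => (1 : ℂ)) :=
      (integrable_indicator_iff measurableSet_Ioc).2 (integrableOn_const (by simp) (by simp))
    -- The integral is an inner product with an indicator. After Plancherel the denominator in the
    -- transform of the indicator cancels the factor `2πiξ` in that of `g`, leaving a difference of
    -- two Fourier inversion integrals.
    have e1 : ∫ t in x..y, g t = inner ℂ (hm.toLp _ : L2) g := by
      rw [intervalIntegral.integral_of_le hxy, ← integral_indicator measurableSet_Ioc, L2.inner_def]
      refine integral_congr_ae ?_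
      filter_upwards [hm.coeFn_toLp] with t ht
      rw [ht]
      unfold indicator
      split_ifs <;> simp
    have e2 : (𝓕 (hm.toLp _ : L2) : L2) =ᵐ[volume] 𝓕 ((Ioc x y).indicator fun _ => (1 : ℂ)) := by
      have := fourier_coeFn (hm.toLp _ : L2) (hm1.congr hm.coeFn_toLp.symm)
      refine this.trans (ae_of_all _ fun ξ => ?_)
      rw [Real.fourier_eq, Real.fourier_eq]
      refine integral_congr_ae ?_
      filter_upwards [hm.coeFn_toLp] with t ht
      rw [ht]
    have i1 : ∀ w : ℝ, Integrable fun ξ : ℝ =>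
        Complex.exp (((2 * Real.pi * inner ℝ ξ w : ℝ) : ℂ) * Complex.I) • (𝓕 f : L2) ξ := by
      intro w
      refine hi.norm.mono' (AEStronglyMeasurable.smul
        (by fun_prop : Continuous fun ξ : ℝ => Complex.exp (((2 * Real.pi * inner ℝ ξ w : ℝ) : ℂ)
          * Complex.I)).aestronglyMeasurable hi.1) (ae_of_all _ fun ξ => ?_)
      rw [norm_smul, Complex.norm_exp_ofReal_mul_I, one_mul]
    rw [e1, ← Lp.inner_fourier_eq, L2.inner_def, Real.fourierInv_eq', Real.fourierInv_eq',
      ← integral_sub (i1 y) (i1 x)]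
    refine integral_congr_ae ?_
    have hne : ∀ᵐ ξ : ℝ, ξ ≠ 0 := by
      rw [ae_iff]; simp
    filter_upwards [e2, h, hne] with ξ h1 h2 h3
    have h3' : (ξ : ℂ) ≠ 0 := by exact_mod_cast h3
    have h4 : (Real.pi : ℂ) ≠ 0 := by exact_mod_cast Real.pi_ne_zero
    rw [h1, h2, fourier_indicator_Ioc hxy h3, RCLike.inner_apply]
    simp only [map_mul, map_sub, map_inv₀, ← Complex.exp_conj, map_neg, Complex.conj_I,
      Complex.conj_ofReal, map_ofNat, smul_eq_mul]
    have e5 : ∀ w : ℝ, -(2 * (Real.pi : ℂ) * -Complex.I * ξ) * w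
        = ((2 * Real.pi * inner ℝ ξ w : ℝ) : ℂ) * Complex.I := by
      intro w; simp; ring
    rw [e5, e5]
    field_simp
    ring
  intro x y
  rcases le_total x y with hxy | hxy
  · exact key x y hxy
  · rw [intervalIntegral.integral_symm, key y x hxy]; ring

/-- The Fourier multiplier of the free resolvent on the Hardy space. -/
def freeMult (ε lam : ℝ) : ℝ → ℂ :=
  (Ioi (0 : ℝ)).indicator fun ξ => ((1 / (2 * Real.pi * ε * ξ - lam) : ℝ) : ℂ)

theorem measurable_freeMult (ε lam : ℝ) : Measurable (freeMult ε lam) :=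
  Measurable.indicator (by fun_prop) measurableSet_Ioi

theorem freeMult_denom_pos {ε lam ξ : ℝ} (h : 0 < ε ∧ lam < 0) (hξ : 0 < ξ) :
    0 < 2 * Real.pi * ε * ξ - lam := by
  have := mul_pos (mul_pos Real.two_pi_pos h.1) hξ
  linarith [h.2]

theorem norm_freeMult_le {ε lam : ℝ} (h : 0 < ε ∧ lam < 0) (ξ : ℝ) :
    ‖freeMult ε lam ξ‖ ≤ 1 / (-lam) := by
  have h0 : 0 < -lam := by linarith [h.2]
  unfold freeMult indicator
  split_ifs with hξ
  · have h1 := freeMult_denom_pos h hξ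
    rw [Complex.norm_real, Real.norm_of_nonneg (by positivity)]
    apply one_div_le_one_div_of_le h0
    have := mul_pos (mul_pos Real.two_pi_pos h.1) hξ
    linarith
  · rw [norm_zero]; positivity

theorem exists_norm_freeMult_le {ε lam : ℝ} (h : 0 < ε ∧ lam < 0) :
    ∃ C, ∀ ξ, ‖freeMult ε lam ξ‖ ≤ C / (1 + |ξ|) := by
  have h0 : 0 < -lam := by linarith [h.2]
  have h2 : 0 < 2 * Real.pi * ε := mul_pos Real.two_pi_pos h.1
  refine ⟨1 / (-lam) + 1 / (2 * Real.pi * ε), fun ξ => ?_⟩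
  unfold freeMult indicator
  split_ifs with hξ
  · have h1 := freeMult_denom_pos h hξ
    have hξ' : 0 < ξ := hξ
    rw [Complex.norm_real, Real.norm_of_nonneg (by positivity), abs_of_pos hξ', div_add_div _ _ h0.ne' h2.ne',
      div_div, div_le_div_iff₀ h1 (by positivity)]
    nlinarith [mul_pos h0 h2, mul_pos hξ' h2, mul_pos (mul_pos hξ' h2) h2, mul_pos h0 h0,
      mul_pos (mul_pos h0 h0) hξ']
  · rw [norm_zero]; positivity

open Classical in
/-- The free resolvent `(-iε∂ - lam)⁻¹` on the Hardy space, extended by zero to its orthogonal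
complement. -/
def freeRes (ε lam : ℝ) : L2 →L[ℂ] L2 :=
  if h : 0 < ε ∧ lam < 0 then
    ((Lp.fourierTransformₗᵢ ℝ ℂ).symm.toContinuousLinearEquiv : L2 →L[ℂ] L2) ∘L
      mulL2 (freeMult ε lam) (measurable_freeMult ε lam) (1 / (-lam)) (norm_freeMult_le h) ∘L
      ((Lp.fourierTransformₗᵢ ℝ ℂ).toContinuousLinearEquiv : L2 →L[ℂ] L2)
  else 0

theorem freeRes_apply {ε lam : ℝ} (h : 0 < ε ∧ lam < 0) (f : L2) :
    freeRes ε lam f = 𝓕⁻ (mulL2 (freeMult ε lam) (measurable_freeMult ε lam) (1 / (-lam))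
      (norm_freeMult_le h) (𝓕 f) : L2) := by
  rw [freeRes, dif_pos h]; rfl

theorem fourier_freeRes {ε lam : ℝ} (h : 0 < ε ∧ lam < 0) (f : L2) :
    (𝓕 (freeRes ε lam f) : L2) =ᵐ[volume] fun ξ => freeMult ε lam ξ * (𝓕 f : L2) ξ := by
  rw [freeRes_apply h, FourierTransform.fourier_fourierInv_eq]
  exact mulL2_coeFn _ _ _

theorem freeRes_mem {ε lam : ℝ} (h : 0 < ε ∧ lam < 0) (f : L2) : freeRes ε lam f ∈ hardySpace := by
  rw [mem_hardySpace_iff]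
  filter_upwards [fourier_freeRes h f] with ξ h1 h2
  rw [h1, freeMult, indicator_of_notMem (by simpa using h2.le), zero_mul]

theorem fourier_sub' (f g : L2) : (𝓕 (f - g) : L2) = 𝓕 f - 𝓕 g :=
  map_sub (Lp.fourierTransformₗᵢ ℝ ℂ) f g

theorem ae_eq_of_fourier {f g : L2} (h : (𝓕 f : L2) =ᵐ[volume] (𝓕 g : L2)) : f = g :=
  (Lp.fourierTransformₗᵢ ℝ ℂ).injective (Lp.ext h)

/-- On the Fourier side the derivative is the multiplier `2πiξ` times that of the resolvent, bounded
by `1/ε` since `lam < 0`; the equation is the pointwise identity `(2πεξ - lam) m(ξ) = 1` on `ξ > 0`.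
-/
theorem exists_isL2Deriv_freeRes {ε lam : ℝ} (h : 0 < ε ∧ lam < 0) {f : L2} (hf : f ∈ hardySpace) :
    ∃ g : L2, IsL2Deriv (freeRes ε lam f) g ∧
      -(Complex.I * (ε : ℂ)) • g - (lam : ℂ) • freeRes ε lam f = f := by
  have hm : Measurable fun ξ : ℝ => 2 * Real.pi * Complex.I * ξ * freeMult ε lam ξ :=
    Measurable.mul (by fun_prop) (measurable_freeMult ε lam)
  have hC : ∀ ξ : ℝ, ‖2 * Real.pi * Complex.I * ξ * freeMult ε lam ξ‖ ≤ 1 / ε := by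
    intro ξ
    unfold freeMult indicator
    split_ifs with hξ
    · have h1 := freeMult_denom_pos h hξ
      have hξ' : 0 < ξ := hξ
      have h2 := h.1
      rw [norm_mul, Complex.norm_real, Real.norm_of_nonneg (one_div_pos.2 h1).le]
      simp only [norm_mul, Complex.norm_ofNat, Complex.norm_real, Complex.norm_I,
        Real.norm_of_nonneg Real.pi_pos.le, Real.norm_of_nonneg hξ'.le]
      rw [mul_one_div, div_le_div_iff₀ h1 h2]
      nlinarith [h.2]
    · rw [mul_zero, norm_zero]; have := h.1; positivity
  set g : L2 := 𝓕⁻ (mulL2 _ hm (1 / ε) hC (𝓕 f : L2) : L2) with hg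
  have hgF : (𝓕 g : L2) =ᵐ[volume]
      fun ξ : ℝ => 2 * Real.pi * Complex.I * ξ * freeMult ε lam ξ * (𝓕 f : L2) ξ := by
    rw [hg, FourierTransform.fourier_fourierInv_eq]
    exact mulL2_coeFn hm hC _
  refine ⟨g, isL2Deriv_of_fourier ?_, ae_eq_of_fourier ?_⟩
  · filter_upwards [hgF, fourier_freeRes h f] with ξ h1 h2
    rw [h1, h2]; ring
  · have hne : ∀ᵐ ξ : ℝ, ξ ≠ 0 := by
      rw [ae_iff]; simp
    rw [fourier_sub', FourierTransform.fourier_smul, FourierTransform.fourier_smul]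
    filter_upwards [hgF, fourier_freeRes h f, hne, mem_hardySpace_iff.1 hf,
      Lp.coeFn_sub (-(Complex.I * (ε : ℂ)) • (𝓕 g : L2)) ((lam : ℂ) • (𝓕 (freeRes ε lam f) : L2)),
      Lp.coeFn_smul (-(Complex.I * (ε : ℂ))) (𝓕 g : L2),
      Lp.coeFn_smul (lam : ℂ) (𝓕 (freeRes ε lam f) : L2)] with ξ h1 h2 h3 h4 h5 h6 h7
    rw [h5, Pi.sub_apply, h6, h7, Pi.smul_apply, Pi.smul_apply, h1, h2]
    rcases lt_or_gt_of_ne h3 with h8 | h8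
    · rw [h4 h8]; simp
    · rw [freeMult, indicator_of_mem (by simpa using h8)]
      have h9 : (2 * Real.pi * ε * ξ - lam : ℂ) ≠ 0 := by
        exact_mod_cast (freeMult_denom_pos h h8).ne'
      have h10 := mul_one_div_cancel h9
      push_cast
      simp only [smul_eq_mul]
      linear_combination (𝓕 f : L2) ξ * h10 - 2 * Real.pi * ε * ξ
        * (1 / (2 * Real.pi * ε * ξ - lam)) * (𝓕 f : L2) ξ * Complex.I_sq

theorem norm_freeRes_sub_le {ε lam mu : ℝ} (h : 0 < ε ∧ lam < 0) (h' : 0 < ε ∧ mu < 0) :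
    ‖freeRes ε lam - freeRes ε mu‖ ≤ |lam - mu| * (1 / (-lam) * (1 / (-mu))) := by
  have hl : 0 < -lam := by linarith [h.2]
  have hl' : 0 < -mu := by linarith [h'.2]
  refine ContinuousLinearMap.opNorm_le_bound _ (by positivity) fun f => ?_
  rw [← Lp.norm_fourier_eq f, ← Lp.norm_fourier_eq, sub_apply, fourier_sub']
  refine Lp.norm_le_mul_norm_of_ae_le_mul ?_
  filter_upwards [Lp.coeFn_sub (𝓕 (freeRes ε lam f) : L2) (𝓕 (freeRes ε mu f) : L2),
    fourier_freeRes h f, fourier_freeRes h' f] with ξ h1 h2 h3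
  rw [h1, Pi.sub_apply, h2, h3, ← sub_mul, norm_mul]
  refine mul_le_mul_of_nonneg_right ?_ (norm_nonneg _)
  have e : freeMult ε lam ξ - freeMult ε mu ξ
      = ((lam - mu : ℝ) : ℂ) * (freeMult ε lam ξ * freeMult ε mu ξ) := by
    unfold freeMult indicator
    split_ifs with hξ
    · have i1 := (freeMult_denom_pos h hξ).ne'
      have i2 := (freeMult_denom_pos h' hξ).ne'
      rw [← Complex.ofReal_sub, ← Complex.ofReal_mul, ← Complex.ofReal_mul]
      congr 1
      field_simp
      ring
    · simp
  rw [e, norm_mul, norm_mul, Complex.norm_real, Real.norm_eq_abs]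
  gcongr
  · exact norm_freeMult_le h ξ
  · exact norm_freeMult_le h' ξ

/-- Point evaluation of the free resolvent is a bounded functional. -/
theorem exists_freeRes_eval {ε lam : ℝ} (h : 0 < ε ∧ lam < 0) :
    ∃ (w : ℝ → L2) (C : ℝ), (∀ x, ‖w x‖ ≤ C) ∧
      ∀ f, freeRes ε lam f =ᵐ[volume] fun x => inner ℂ (w x) f := by
  obtain ⟨C, hC⟩ := exists_norm_freeMult_le h
  have hm : MemLp (freeMult ε lam) 2 volume :=
    memLp_two_of_le (measurable_freeMult ε lam).aestronglyMeasurable hC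
  set e : ℝ → ℝ → ℂ := fun x ξ => Complex.exp (((2 * Real.pi * inner ℝ ξ x : ℝ) : ℂ) * Complex.I)
    with he
  have hwm : ∀ x, MemLp (fun ξ => (starRingEnd ℂ) (e x ξ * freeMult ε lam ξ)) 2 volume := by
    intro x
    refine MemLp.star (hm.of_le (AEStronglyMeasurable.mul
      (by fun_prop : Continuous (e x)).aestronglyMeasurable hm.1) (ae_of_all _ fun ξ => ?_))
    rw [norm_mul, he, Complex.norm_exp_ofReal_mul_I, one_mul]
  refine ⟨fun x => 𝓕⁻ ((hwm x).toLp _ : L2), ‖(hm.toLp _ : L2)‖, fun x => ?_, fun f => ?_⟩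
  · rw [← Lp.norm_fourier_eq, FourierTransform.fourier_fourierInv_eq]
    refine Lp.norm_le_norm_of_ae_le ?_
    filter_upwards [(hwm x).coeFn_toLp, hm.coeFn_toLp] with ξ h1 h2
    rw [h1, h2, RCLike.norm_conj, norm_mul, he, Complex.norm_exp_ofReal_mul_I, one_mul]
  · have hi : Integrable (𝓕 (freeRes ε lam f) : L2) :=
      ((hm.integrable_mul (Lp.memLp (𝓕 f : L2)))).congr (fourier_freeRes h f).symm
    have h1 := fourierInv_coeFn (𝓕 (freeRes ε lam f) : L2) hi
    rw [FourierTransform.fourierInv_fourier_eq] at h1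
    filter_upwards [h1] with x hx
    rw [hx, ← Lp.inner_fourier_eq, FourierTransform.fourier_fourierInv_eq, L2.inner_def,
      Real.fourierInv_eq']
    refine integral_congr_ae ?_
    filter_upwards [(hwm x).coeFn_toLp, fourier_freeRes h f] with ξ h2 h3
    rw [h2, h3, RCLike.inner_apply (𝕜 := ℂ), Complex.conj_conj, smul_eq_mul]
    simp only [he]
    ring

theorem norm_sq_L2_eq (f : L2) : ‖f‖ ^ 2 = ∫ x, ‖f x‖ ^ 2 := by
  have h1 : inner ℂ f f = ((∫ x, ‖f x‖ ^ 2 : ℝ) : ℂ) := by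
    rw [L2.inner_def, ← integral_complex_ofReal]
    refine integral_congr_ae (ae_of_all _ fun x => ?_)
    simp only [inner_self_eq_norm_sq_to_K]
    simp
  rw [inner_self_eq_norm_sq_to_K] at h1
  apply Complex.ofReal_injective
  rw [← h1]
  simp

/-- Bounded sequences in `L²` have weakly convergent subsequences. -/
theorem exists_weakly_convergent_subseq {h : ℕ → L2} {r : ℝ} (hr : ∀ n, ‖h n‖ ≤ r) :
    ∃ (f : L2) (φ : ℕ → ℕ), ‖f‖ ≤ r ∧ StrictMono φ ∧
      ∀ w, Tendsto (fun n => inner ℂ w (h (φ n))) atTop (𝓝 (inner ℂ w f)) := by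
  have : Fact ((2 : ENNReal) ≠ ⊤) := ⟨by simp⟩
  have hs := WeakDual.isSeqCompact_closedBall (𝕜 := ℂ) (E := L2) 0 r
  obtain ⟨ψ, hψ, φ, hφ, hlim⟩ := hs (x := fun n => StrongDual.toWeakDual (InnerProductSpace.toDual ℂ L2 (h n)))
    (fun n => by simpa using hr n)
  refine ⟨(InnerProductSpace.toDual ℂ L2).symm (WeakDual.toStrongDual ψ), φ, ?_, hφ, fun w => ?_⟩
  · rw [LinearIsometryEquiv.norm_map]
    simpa using hψ
  · have h1 : Tendsto (fun n => inner ℂ (h (φ n)) w) atTop (𝓝 (ψ w)) :=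
      ((WeakDual.eval_continuous w).tendsto ψ).comp hlim
    have h2 := (Complex.continuous_conj.tendsto _).comp h1
    have h3 : (starRingEnd ℂ) (ψ w)
        = inner ℂ w ((InnerProductSpace.toDual ℂ L2).symm (WeakDual.toStrongDual ψ)) := by
      rw [← inner_conj_symm, InnerProductSpace.toDual_symm_apply]
      rfl
    rw [← h3]
    refine h2.congr fun n => ?_
    simp

namespace RatData
variable {u : ℝ → ℝ} (d : RatData u)

theorem exists_bound (d : RatData u) : ∃ C, ∀ x, ‖(u x : ℂ)‖ ≤ C := by
  obtain ⟨C, hC0, hC⟩ := d.exists_abs_le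
  refine ⟨C, fun x => ?_⟩
  rw [Complex.norm_real, Real.norm_eq_abs]
  exact (hC x).trans (div_le_self hC0.le (by linarith [abs_nonneg x]))

/-- Multiplication by `u` on `L²`. -/
def mulU : L2 →L[ℂ] L2 :=
  mulL2 (fun x => (u x : ℂ)) (Complex.continuous_ofReal.comp d.continuous_u).measurable
    d.exists_bound.choose d.exists_bound.choose_spec

theorem mulU_coeFn (f : L2) : d.mulU f =ᵐ[volume] fun x => (u x : ℂ) * f x :=
  mulL2_coeFn _ _ _

/-- Point evaluations of the free resolvent are uniformly bounded functionals, so weak convergence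
becomes pointwise convergence with a uniform bound. The decay of `u` supplies a square integrable
majorant, and dominated convergence gives norm convergence. -/
theorem isCompactOperator_mulU_freeRes {ε lam : ℝ} (h : 0 < ε ∧ lam < 0) :
    IsCompactOperator (d.mulU ∘L freeRes ε lam : L2 →L[ℂ] L2) := by
  obtain ⟨w, C, hw, hev⟩ := exists_freeRes_eval h
  obtain ⟨K, hK0, hK⟩ := d.exists_abs_le
  have hC0 : 0 ≤ C := (norm_nonneg _).trans (hw 0)
  have hcoe : ∀ f : L2, d.mulU (freeRes ε lam f) =ᵐ[volume] fun x => (u x : ℂ) * inner ℂ (w x) f := by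
    intro f
    filter_upwards [d.mulU_coeFn (freeRes ε lam f), hev f] with x h1 h2
    rw [h1, h2]
  refine (isCompactOperator_iff_image_closedBall_subset_compact
    ((d.mulU ∘L freeRes ε lam : L2 →L[ℂ] L2) : L2 →ₗ[ℂ] L2) one_pos).2
    ⟨_, IsSeqCompact.isCompact ?_, subset_rfl⟩
  intro y hy
  choose g hg hgy using hy
  obtain ⟨f, φ, hf, hφ, hlim⟩ := exists_weakly_convergent_subseq (h := g) (r := 1)
    (fun n => by simpa using hg n)
  refine ⟨_, ⟨f, by simpa using hf, rfl⟩, φ, hφ, ?_⟩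
  have hy' : ∀ n, y n = d.mulU (freeRes ε lam (g n)) := fun n => (hgy n).symm
  have hnorm : Tendsto (fun n => ‖y (φ n) - d.mulU (freeRes ε lam f)‖ ^ 2) atTop (𝓝 0) := by
    have e1 : ∀ n, ‖y (φ n) - d.mulU (freeRes ε lam f)‖ ^ 2
        = ∫ x, ‖(u x : ℂ) * (inner ℂ (w x) (g (φ n)) - inner ℂ (w x) f)‖ ^ 2 := by
      intro n
      rw [norm_sq_L2_eq, hy']
      refine integral_congr_ae ?_
      filter_upwards [Lp.coeFn_sub (d.mulU (freeRes ε lam (g (φ n)))) (d.mulU (freeRes ε lam f)),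
        hcoe (g (φ n)), hcoe f] with x h1 h2 h3
      rw [h1, Pi.sub_apply, h2, h3, mul_sub]
    simp_rw [e1]
    have e2 : (0 : ℝ) = ∫ _ : ℝ, (0 : ℝ) := by simp
    rw [e2]
    refine tendsto_integral_of_dominated_convergence
      (fun x => (K * (2 * C)) ^ 2 * (1 / (1 + |x|) ^ 2)) (fun n => ?_)
      (integrable_inv_one_add_abs_sq.const_mul _) (fun n => ae_of_all _ fun x => ?_)
      (ae_of_all _ fun x => ?_)
    · have : AEStronglyMeasurable (fun x => (u x : ℂ) * (inner ℂ (w x) (g (φ n))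
          - inner ℂ (w x) f)) volume := by
        refine (Lp.aestronglyMeasurable (d.mulU (freeRes ε lam (g (φ n)))
          - d.mulU (freeRes ε lam f))).congr ?_
        filter_upwards [Lp.coeFn_sub (d.mulU (freeRes ε lam (g (φ n)))) (d.mulU (freeRes ε lam f)),
          hcoe (g (φ n)), hcoe f] with x h1 h2 h3
        rw [h1, Pi.sub_apply, h2, h3, mul_sub]
      exact this.norm.pow 2
    · rw [Real.norm_of_nonneg (by positivity), norm_mul, Complex.norm_real, Real.norm_eq_abs]
      have h1 : ‖inner ℂ (w x) (g (φ n)) - inner ℂ (w x) f‖ ≤ 2 * C := by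
        rw [← inner_sub_right]
        refine (norm_inner_le_norm _ _).trans ?_
        have h2 : ‖g (φ n) - f‖ ≤ 2 := by
          have h3 := norm_sub_le (g (φ n)) f
          have h4 : ‖g (φ n)‖ ≤ 1 := by simpa using hg (φ n)
          linarith
        calc ‖w x‖ * ‖g (φ n) - f‖ ≤ C * 2 := mul_le_mul (hw x) h2 (norm_nonneg _) hC0
          _ = 2 * C := by ring
      calc (|u x| * ‖inner ℂ (w x) (g (φ n)) - inner ℂ (w x) f‖) ^ 2
          ≤ (K / (1 + |x|) * (2 * C)) ^ 2 := by
            refine pow_le_pow_left₀ (by positivity) ?_ 2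
            exact mul_le_mul (hK x) h1 (norm_nonneg _) (by positivity)
        _ = (K * (2 * C)) ^ 2 * (1 / (1 + |x|) ^ 2) := by
            field_simp
    · have h1 := ((hlim (w x)).sub_const (inner ℂ (w x) f)).const_mul (u x : ℂ)
      have h2 := (h1.norm).pow 2
      simpa using h2
  have h2 := (Real.continuous_sqrt.tendsto 0).comp hnorm
  rw [Real.sqrt_zero] at h2
  rw [tendsto_iff_norm_sub_tendsto_zero]
  refine h2.congr fun n => ?_
  simp only [Function.comp_apply]
  rw [Real.sqrt_sq (norm_nonneg _)]
  rfl

/-- The Birman-Schwinger type operator `𝒞⁺ u (-iε∂ - lam)⁻¹`. -/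
def bsOp (ε lam : ℝ) : L2 →L[ℂ] L2 := cauchyProj ∘L d.mulU ∘L freeRes ε lam

theorem cauchyProj_mem (f : L2) : cauchyProj f ∈ hardySpace :=
  Submodule.starProjection_apply_mem _ _

/-- Solving `(ℒ - lam) f = k` through the Birman-Schwinger operator. -/
theorem laxGraph_freeRes {ε lam : ℝ} (h : 0 < ε ∧ lam < 0) {f k : L2} (hk : k ∈ hardySpace)
    (hf : f - d.bsOp ε lam f = k) :
    LaxGraph ε u (freeRes ε lam f) ((lam : ℂ) • freeRes ε lam f + k) := by
  have hf' : f ∈ hardySpace := by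
    have : f = k + d.bsOp ε lam f := by rw [← hf]; abel
    rw [this]
    exact hardySpace.add_mem hk (cauchyProj_mem _)
  obtain ⟨g, hg, heq⟩ := exists_isL2Deriv_freeRes h hf'
  refine ⟨freeRes_mem h f, g, d.mulU (freeRes ε lam f), hg, d.mulU_coeFn _, ?_⟩
  have h1 : d.bsOp ε lam f = cauchyProj (d.mulU (freeRes ε lam f)) := rfl
  rw [← h1, ← hf]
  nth_rewrite 2 [← heq]
  abel

/-- Fredholm alternative: the operator is compact, and a fixed vector is carried by the free
resolvent to an eigenfunction of `ℒ`, which is nonzero because the fixed vector can be recovered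
from it. -/
theorem isUnit_one_sub_bsOp {ε lam : ℝ} (h : 0 < ε ∧ lam < 0) (hn : ¬ IsEigenvalue ε u lam) :
    IsUnit (1 - d.bsOp ε lam) := by
  have hc : IsCompactOperator (d.bsOp ε lam) :=
    (d.isCompactOperator_mulU_freeRes h).clm_comp cauchyProj
  rcases IsCompactOperator.hasEigenvalue_or_mem_resolventSet hc (one_ne_zero (α := ℂ)) with h1 | h1
  · exfalso
    obtain ⟨f, hf⟩ := h1.exists_hasEigenvector
    have h2 : d.bsOp ε lam f = f := by simpa using hf.apply_eq_smul
    apply hn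
    refine ⟨freeRes ε lam f, fun h3 => hf.2 ?_, ?_⟩
    · rw [← h2]
      change cauchyProj (d.mulU (freeRes ε lam f)) = 0
      rw [h3, map_zero, map_zero]
    · have := d.laxGraph_freeRes h (f := f) (k := 0) hardySpace.zero_mem (by rw [h2, sub_self])
      rwa [add_zero] at this
  · simpa [spectrum.mem_resolventSet_iff] using h1

theorem continuousOn_freeRes {ε : ℝ} (hε : 0 < ε) : ContinuousOn (freeRes ε) (Iio 0) := by
  intro lam hlam
  rw [ContinuousWithinAt, tendsto_iff_norm_sub_tendsto_zero]
  have h0 : lam ≠ 0 := (mem_Iio.1 hlam).ne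
  have h1 : ContinuousAt (fun mu : ℝ => |mu - lam| * (1 / (-mu) * (1 / (-lam)))) lam := by
    have : ContinuousAt (fun mu : ℝ => 1 / (-mu)) lam :=
      ContinuousAt.div continuousAt_const (by fun_prop) (neg_ne_zero.2 h0)
    fun_prop
  have h2 : Tendsto (fun mu : ℝ => |mu - lam| * (1 / (-mu) * (1 / (-lam)))) (𝓝[Iio 0] lam)
      (𝓝 0) := by
    have := h1.tendsto.mono_left (nhdsWithin_le_nhds (s := Iio 0))
    simpa using this
  refine squeeze_zero' (Eventually.of_forall fun _ => norm_nonneg _) ?_ h2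
  filter_upwards [self_mem_nhdsWithin] with mu hmu
  exact norm_freeRes_sub_le ⟨hε, hmu⟩ ⟨hε, hlam⟩

/-- On an interval without eigenvalues, the solutions with inhomogeneity form a family with
monotone Weyl function. -/
theorem exists_monotone_family (d : RatData u) {ε l₁ l₂ : ℝ} (hε : 0 < ε) (h2 : l₂ < 0)
    (hn : ∀ lam ∈ Icc l₁ l₂, ¬ IsEigenvalue ε u lam) :
    ∃ F : ℝ → ℝ → ℂ,
      (∀ lam ∈ Icc l₁ l₂, d.Sol ε lam (fun p => d.c p * cauchyT (F lam) (d.z p)) 1 (F lam)) ∧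
      MonotoneOn (fun lam => (∫ x, F lam x * cauchyKer Complex.I x).re) (Icc l₁ l₂) := by
  have hI : (-Complex.I).im < 0 := by simp
  set k : L2 := cauchyL2 hI.ne with hk
  have hkm : k ∈ hardySpace := cauchyL2_mem_hardySpace hI
  have hneg : ∀ lam ∈ Icc l₁ l₂, 0 < ε ∧ lam < 0 := fun lam hl => ⟨hε, hl.2.trans_lt h2⟩
  set f : ℝ → L2 := fun lam => freeRes ε lam (Ring.inverse (1 - d.bsOp ε lam) k) with hf
  have hcF : ContinuousOn (freeRes ε) (Icc l₁ l₂) :=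
    (continuousOn_freeRes hε).mono fun lam hl => (hneg lam hl).2
  have hfc : ContinuousOn f (Icc l₁ l₂) := by
    have hb : ContinuousOn (fun lam => 1 - d.bsOp ε lam) (Icc l₁ l₂) :=
      continuousOn_const.sub (continuousOn_const.clm_comp (continuousOn_const.clm_comp hcF))
    refine hcF.clm_apply (ContinuousOn.clm_apply (fun lam hl => ?_) continuousOn_const)
    obtain ⟨U, hU⟩ := d.isUnit_one_sub_bsOp (hneg lam hl) (hn lam hl)
    have h3 := NormedRing.inverse_continuousAt U
    rw [hU] at h3
    exact ContinuousAt.comp_continuousWithinAt (f := fun lam => 1 - d.bsOp ε lam) h3 (hb lam hl)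
  have hex : ∀ lam, ∃ F : ℝ → ℂ, lam ∈ Icc l₁ l₂ → f lam =ᵐ[volume] F ∧
      d.Sol ε lam (fun p => d.c p * cauchyT F (d.z p)) 1 F := by
    intro lam
    by_cases hl : lam ∈ Icc l₁ l₂
    · have h3 := Ring.mul_inverse_cancel _ (d.isUnit_one_sub_bsOp (hneg lam hl) (hn lam hl))
      have h4 := d.laxGraph_freeRes (hneg lam hl) hkm
        (f := Ring.inverse (1 - d.bsOp ε lam) k) (by
          have := DFunLike.congr_fun h3 k
          simpa using! this)
      rw [← one_smul ℂ k] at h4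
      obtain ⟨F, hF⟩ := d.exists_sol_of_laxGraph hε.ne' (coeFn_cauchyL2 hI.ne) h4
      refine ⟨F, fun _ => ⟨?_, hF.2⟩⟩
      have h5 := hF.1
      rwa [one_smul] at h5
    · exact ⟨0, fun h => absurd h hl⟩
  choose F hF using hex
  refine ⟨F, fun lam hl => (hF lam hl).2, ?_⟩
  have hM : ∀ lam ∈ Icc l₁ l₂, ∫ x, F lam x * cauchyKer Complex.I x = inner ℂ k (f lam) := by
    intro lam hl
    rw [hk, inner_cauchyL2]
    refine integral_congr_ae ?_
    filter_upwards [(hF lam hl).1] with x hx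
    rw [hx]
    simp
  have hin : ∀ lam ∈ Icc l₁ l₂, ∀ mu ∈ Icc l₁ l₂,
      ∫ x, (starRingEnd ℂ) (F lam x) * F mu x = inner ℂ (f lam) (f mu) := by
    intro lam hl mu hm
    rw [L2.inner_def]
    refine integral_congr_ae ?_
    filter_upwards [(hF lam hl).1, (hF mu hm).1] with x hx hy
    rw [hx, hy, RCLike.inner_apply (𝕜 := ℂ)]
    ring
  -- The Lagrange identity with both inhomogeneities equal to `1`. Dividing by `mu - lam` and
  -- letting `mu` tend to `lam` shows that the Weyl function has derivative `‖f lam‖² ≥ 0`.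
  have hdiff : ∀ lam ∈ Icc l₁ l₂, ∀ mu ∈ Icc l₁ l₂,
      (∫ x, F mu x * cauchyKer Complex.I x).re - (∫ x, F lam x * cauchyKer Complex.I x).re
        = (mu - lam) * (inner ℂ (f lam) (f mu) : ℂ).re := by
    intro lam hl mu hm
    have := (hF lam hl).2.lagrange d hε.ne' (hF mu hm).2
    rw [hin lam hl mu hm] at this
    have h3 := congrArg Complex.re this
    rw [← Complex.ofReal_sub, Complex.re_ofReal_mul] at h3
    rw [h3]
    simp
  refine monotoneOn_of_deriv_nonneg (convex_Icc _ _) ?_ ?_ ?_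
  · refine (Complex.continuous_re.comp_continuousOn (f := fun lam => inner ℂ k (f lam))
      (continuousOn_const.inner hfc)).congr fun lam hl => ?_
    simp only [Function.comp_apply, hM lam hl]
  all_goals
    intro lam hl
    rw [interior_Icc] at hl
    have hl' := Ioo_subset_Icc_self hl
    have hd : HasDerivAt (fun lam => (∫ x, F lam x * cauchyKer Complex.I x).re)
        (inner ℂ (f lam) (f lam) : ℂ).re lam := by
      rw [hasDerivAt_iff_tendsto_slope]
      have h3 : Tendsto (fun mu => (inner ℂ (f lam) (f mu) : ℂ).re) (𝓝[≠] lam)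
          (𝓝 (inner ℂ (f lam) (f lam) : ℂ).re) := by
        have h4 : ContinuousAt f lam := hfc.continuousAt (Icc_mem_nhds hl.1 hl.2)
        exact ((Complex.continuous_re.continuousAt (x := inner ℂ (f lam) (f lam))).comp
          (f := fun mu => inner ℂ (f lam) (f mu))
          (continuousAt_const.inner h4)).tendsto.mono_left nhdsWithin_le_nhds
      refine h3.congr' ?_
      filter_upwards [self_mem_nhdsWithin, nhdsWithin_le_nhds (Icc_mem_nhds hl.1 hl.2)]
        with mu h5 h6
      rw [slope_def_field, hdiff lam hl' mu h6, mul_div_cancel_left₀ _ (sub_ne_zero.2 h5)]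
  · exact hd.differentiableAt.differentiableWithinAt
  · rw [hd.deriv]
    exact inner_self_nonneg (𝕜 := ℂ)

/-- Eigenfunctions are solutions. -/
theorem exists_sol_of_isEigenvalue (d : RatData u) {ε lam : ℝ} (hε : ε ≠ 0)
    (h : IsEigenvalue ε u lam) :
    ∃ F : ℝ → ℂ, ¬ F =ᵐ[volume] 0 ∧ d.Sol ε lam (fun p => d.c p * cauchyT F (d.z p)) 0 F := by
  obtain ⟨f, hf, hl⟩ := h
  have hI : (-Complex.I).im < 0 := by simp
  have h1 : LaxGraph ε u f ((lam : ℂ) • f + (0 : ℂ) • cauchyL2 hI.ne) := by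
    rwa [zero_smul, add_zero]
  obtain ⟨F, hF, hs⟩ := d.exists_sol_of_laxGraph hε (coeFn_cauchyL2 hI.ne) h1
  exact ⟨F, fun h0 => hf ((Lp.eq_zero_iff_ae_eq_zero).2 (hF.trans h0)), hs⟩

end RatData

/-! ### Derivatives and decay of the potential and of the sources -/

namespace RatData
variable {u : ℝ → ℝ} (d : RatData u)

/-- The derivative of `u` on the real line. -/
def du (x : ℝ) : ℂ :=
  ∑ p, d.c p * -(cauchyKer (d.z p) x * cauchyKer (d.z p) x)
    + ∑ p, (starRingEnd ℂ) (d.c p) * -(cauchyKer ((starRingEnd ℂ) (d.z p)) x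
      * cauchyKer ((starRingEnd ℂ) (d.z p)) x)

/-- The derivative of `src a κ` on the real line. -/
def dsrc (a : Fin d.P → ℂ) (κ : ℂ) (x : ℝ) : ℂ :=
  ∑ p, a p * -(cauchyKer (d.z p) x * cauchyKer (d.z p) x)
    - κ * -(cauchyKer (-Complex.I) x * cauchyKer (-Complex.I) x)

theorem hasDerivAt_ofReal_u (x : ℝ) : HasDerivAt (fun x => (u x : ℂ)) (d.du x) x := by
  simp_rw [d.ofReal_eq_sum_cauchyKer]
  exact (HasDerivAt.fun_sum fun p _ =>
      (hasDerivAt_cauchyKer (d.z_im p).ne' x).const_mul (d.c p)).add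
    (HasDerivAt.fun_sum fun p _ =>
      (hasDerivAt_cauchyKer (d.conj_z_im p).ne x).const_mul ((starRingEnd ℂ) (d.c p)))

theorem hasDerivAt_src (a : Fin d.P → ℂ) (κ : ℂ) (x : ℝ) :
    HasDerivAt (fun x : ℝ => d.src a κ x) (d.dsrc a κ x) x := by
  simp_rw [d.src_eq_sum_cauchyKer]
  exact (HasDerivAt.fun_sum fun p _ =>
      (hasDerivAt_cauchyKer (d.z_im p).ne' x).const_mul (a p)).sub
    ((hasDerivAt_cauchyKer (by simp) x).const_mul κ)

theorem continuous_du : Continuous d.du := by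
  unfold du
  exact (continuous_finsetSum _ fun p _ => continuous_const.mul
      ((continuous_cauchyKer (d.z_im p).ne').mul (continuous_cauchyKer (d.z_im p).ne')).neg).add
    (continuous_finsetSum _ fun p _ => continuous_const.mul
      ((continuous_cauchyKer (d.conj_z_im p).ne).mul (continuous_cauchyKer (d.conj_z_im p).ne)).neg)

theorem hasDerivAt_u (x : ℝ) : HasDerivAt u (d.du x).re x := by
  have := Complex.reCLM.hasFDerivAt.comp_hasDerivAt x (d.hasDerivAt_ofReal_u x)
  exact this

theorem ofReal_deriv_u (x : ℝ) : ((deriv u x : ℝ) : ℂ) = d.du x := by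
  rw [(d.hasDerivAt_u x).deriv]
  exact ((d.hasDerivAt_u x).ofReal_comp).unique (d.hasDerivAt_ofReal_u x)

theorem continuous_deriv_u (d : RatData u) : Continuous (deriv u) := by
  have : deriv u = fun x => (d.du x).re := funext fun x => (d.hasDerivAt_u x).deriv
  rw [this]
  exact Complex.continuous_re.comp d.continuous_du

theorem norm_cauchyKer_sq_le {a : ℂ} {C : ℝ} (h : ∀ x, ‖cauchyKer a x‖ ≤ C / (1 + |x|)) (x : ℝ) :
    ‖-(cauchyKer a x * cauchyKer a x)‖ ≤ C ^ 2 / (1 + |x|) ^ 2 := by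
  rw [norm_neg, norm_mul, ← div_pow, pow_two]
  exact mul_le_mul (h x) (h x) (norm_nonneg _) ((norm_nonneg _).trans (h x))

theorem exists_abs_deriv_le (d : RatData u) : ∃ C, 0 < C ∧ ∀ x, |deriv u x| ≤ C / (1 + |x|) ^ 2 := by
  choose C hC0 hC using fun p => exists_norm_cauchyKer_le (d.z_im p).ne'
  choose C' hC0' hC' using fun p => exists_norm_cauchyKer_le (d.conj_z_im p).ne
  refine ⟨∑ p, ‖d.c p‖ * C p ^ 2 + ∑ p, ‖d.c p‖ * C' p ^ 2 + 1, by positivity, fun x => ?_⟩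
  rw [← Real.norm_eq_abs, ← Complex.norm_real, d.ofReal_deriv_u, add_div, add_div,
    Finset.sum_div, Finset.sum_div, du]
  have h3 : 0 ≤ 1 / (1 + |x|) ^ 2 := by positivity
  refine (norm_add_le _ _).trans ((add_le_add (norm_sum_le _ _) (norm_sum_le _ _)).trans ?_)
  refine le_add_of_le_of_nonneg (add_le_add (Finset.sum_le_sum fun p _ => ?_)
    (Finset.sum_le_sum fun p _ => ?_)) h3
  · rw [norm_mul, mul_div_assoc]
    exact mul_le_mul_of_nonneg_left (norm_cauchyKer_sq_le (hC p) x) (norm_nonneg _)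
  · rw [norm_mul, mul_div_assoc, RCLike.norm_conj]
    exact mul_le_mul_of_nonneg_left (norm_cauchyKer_sq_le (hC' p) x) (norm_nonneg _)

/-- Uniform bounds for the right-hand sides. -/
theorem exists_src_bound : ∃ K, 0 < K ∧ ∀ (M : ℝ) (a : Fin d.P → ℂ) (κ : ℂ), ‖a‖ ≤ M → ‖κ‖ ≤ M →
    ∀ x : ℝ, ‖d.src a κ x‖ ≤ K * M / (1 + |x|) ∧ ‖d.dsrc a κ x‖ ≤ K * M / (1 + |x|) ^ 2 := by
  choose C hC0 hC using fun p => exists_norm_cauchyKer_le (d.z_im p).ne'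
  obtain ⟨B, hB0, hB⟩ := exists_norm_cauchyKer_le (a := -Complex.I) (by simp)
  refine ⟨∑ p, (C p + C p ^ 2) + (B + B ^ 2), ?_, fun M a κ ha hκ x => ?_⟩
  · have : 0 ≤ ∑ p, (C p + C p ^ 2) :=
      Finset.sum_nonneg fun p _ => by have := hC0 p; positivity
    positivity
  have hM : 0 ≤ M := (norm_nonneg _).trans hκ
  have hx : 0 < 1 + |x| := by positivity
  have ha' : ∀ p, ‖a p‖ ≤ M := fun p => (norm_le_pi_norm a p).trans ha
  constructor
  · rw [d.src_eq_sum_cauchyKer]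
    refine (norm_sub_le _ _).trans ?_
    rw [add_mul, add_div, Finset.sum_mul, Finset.sum_div]
    refine add_le_add ((norm_sum_le _ _).trans (Finset.sum_le_sum fun p _ => ?_)) ?_
    · rw [norm_mul]
      calc ‖a p‖ * ‖cauchyKer (d.z p) x‖ ≤ M * (C p / (1 + |x|)) :=
            mul_le_mul (ha' p) (hC p x) (norm_nonneg _) hM
        _ ≤ (C p + C p ^ 2) * M / (1 + |x|) := by
            rw [mul_div_assoc', div_le_div_iff_of_pos_right hx]
            nlinarith [mul_nonneg (sq_nonneg (C p)) hM]
    · rw [norm_mul]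
      calc ‖κ‖ * ‖cauchyKer (-Complex.I) x‖ ≤ M * (B / (1 + |x|)) :=
            mul_le_mul hκ (hB x) (norm_nonneg _) hM
        _ ≤ (B + B ^ 2) * M / (1 + |x|) := by
            rw [mul_div_assoc', div_le_div_iff_of_pos_right hx]
            nlinarith [mul_nonneg (sq_nonneg B) hM]
  · unfold dsrc
    refine (norm_sub_le _ _).trans ?_
    rw [add_mul, add_div, Finset.sum_mul, Finset.sum_div]
    refine add_le_add ((norm_sum_le _ _).trans (Finset.sum_le_sum fun p _ => ?_)) ?_
    · rw [norm_mul]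
      calc ‖a p‖ * ‖-(cauchyKer (d.z p) x * cauchyKer (d.z p) x)‖
            ≤ M * (C p ^ 2 / (1 + |x|) ^ 2) :=
            mul_le_mul (ha' p) (norm_cauchyKer_sq_le (hC p) x) (norm_nonneg _) hM
        _ ≤ (C p + C p ^ 2) * M / (1 + |x|) ^ 2 := by
            rw [mul_div_assoc', div_le_div_iff_of_pos_right (by positivity)]
            nlinarith [mul_nonneg (hC0 p).le hM]
    · rw [norm_mul]
      calc ‖κ‖ * ‖-(cauchyKer (-Complex.I) x * cauchyKer (-Complex.I) x)‖
            ≤ M * (B ^ 2 / (1 + |x|) ^ 2) :=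
            mul_le_mul hκ (norm_cauchyKer_sq_le hB x) (norm_nonneg _) hM
        _ ≤ (B + B ^ 2) * M / (1 + |x|) ^ 2 := by
            rw [mul_div_assoc', div_le_div_iff_of_pos_right (by positivity)]
            nlinarith [mul_nonneg hB0.le hM]

theorem continuous_src_uncurry :
    Continuous fun q : (Fin d.P → ℂ) × ℂ × ℝ => d.src q.1 q.2.1 q.2.2 := by
  simp_rw [d.src_eq_sum_cauchyKer]
  have h1 : ∀ p, Continuous (cauchyKer (d.z p)) := fun p => continuous_cauchyKer (d.z_im p).ne'
  have h2 : Continuous (cauchyKer (-Complex.I)) := continuous_cauchyKer (by simp)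
  refine (continuous_finsetSum _ fun p _ => ?_).sub ?_
  · exact ((continuous_apply p).comp continuous_fst).mul
      ((h1 p).comp (continuous_snd.comp continuous_snd))
  · exact (continuous_fst.comp continuous_snd).mul (h2.comp (continuous_snd.comp continuous_snd))

theorem tendsto_u_cocompact (d : RatData u) : Tendsto u (cocompact ℝ) (𝓝 0) := by
  obtain ⟨C, hC0, hC⟩ := d.exists_abs_le
  have h1 : Tendsto (fun x : ℝ => C / (1 + |x|)) (cocompact ℝ) (𝓝 0) :=
    Tendsto.const_div_atTop (tendsto_atTop_add_const_left _ _ (tendsto_norm_cocompact_atTop)) _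
  exact squeeze_zero_norm (fun x => by simpa using hC x) h1

end RatData

/-- Positive rational Klaus-Shaw potentials, with the data used in the proofs. -/
structure KS (u : ℝ → ℝ) extends RatData u where
  /-- the critical point -/
  xc : ℝ
  pos : ∀ x, 0 < u x
  mono : StrictMonoOn u (Iic xc)
  anti : StrictAntiOn u (Ici xc)
  deriv_ne : ∀ x, x ≠ xc → deriv u x ≠ 0

/-! ### Klaus-Shaw potentials and their turning points -/

theorem strictMonoOn_Iic_of_Iio {u : ℝ → ℝ} (hu : Continuous u) {c : ℝ}
    (h : StrictMonoOn u (Iio c)) : StrictMonoOn u (Iic c) := by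
  intro x hx y hy hxy
  rcases lt_or_eq_of_le (mem_Iic.1 hy) with h1 | rfl
  · exact h (hxy.trans h1) h1 hxy
  obtain ⟨w, hw1, hw2⟩ := exists_between hxy
  refine (h hxy hw2 hw1).trans_le ?_
  refine ge_of_tendsto (hu.continuousAt.tendsto.mono_left (nhdsWithin_le_nhds (s := Iio y))) ?_
  filter_upwards [Ioo_mem_nhdsLT hw2] with t ht
  exact (h hw2 ht.2 ht.1).le

theorem strictAntiOn_Ici_of_Ioi {u : ℝ → ℝ} (hu : Continuous u) {c : ℝ}
    (h : StrictAntiOn u (Ioi c)) : StrictAntiOn u (Ici c) := by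
  have h1 : StrictMonoOn (fun x => u (-x)) (Iio (-c)) := fun x hx y hy hxy =>
    h (by simp at hy ⊢; linarith) (by simp at hx ⊢; linarith) (by simpa using hxy)
  have h2 := strictMonoOn_Iic_of_Iio (hu.comp continuous_neg) h1
  intro x hx y hy hxy
  have := @h2 (-y) (by simpa using hy) (-x) (by simpa using hx) (by simpa using hxy)
  simpa using this

/-- Positivity and decay at infinity select the direction of monotonicity: a positive function
tending to zero cannot decrease away from `-∞` nor increase towards `+∞`. -/
theorem IsRKS.exists_ks {u : ℝ → ℝ} (hu : IsRKS u) (hpos : ∀ x, 0 < u x) : Nonempty (KS u) := by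
  obtain ⟨⟨⟨P, c, z, hc, hz, hmono, heq⟩, -⟩, xc, hl, hr, hd⟩ := hu
  let d : RatData u := ⟨P, c, z, hc, hz, fun p q h => hmono.injective (by simp [h]), heq⟩
  have hcont := d.continuous_u
  have hlim := d.tendsto_u_cocompact
  rw [cocompact_eq_atBot_atTop, tendsto_sup] at hlim
  refine ⟨⟨d, xc, hpos, strictMonoOn_Iic_of_Iio hcont (hl.resolve_right fun h => ?_),
    strictAntiOn_Ici_of_Ioi hcont (hr.resolve_left fun h => ?_), fun x hx h => hx ((hd x).1 h)⟩⟩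
  · have : u (xc - 1) ≤ 0 := by
      refine ge_of_tendsto hlim.1 ?_
      filter_upwards [Iio_mem_atBot (xc - 1)] with y hy
      exact (h (show y < xc by linarith [mem_Iio.1 hy]) (show xc - 1 < xc by linarith) hy).le
    linarith [hpos (xc - 1)]
  · have : u (xc + 1) ≤ 0 := by
      refine ge_of_tendsto hlim.2 ?_
      filter_upwards [Ioi_mem_atTop (xc + 1)] with y hy
      exact (h (show xc < xc + 1 by linarith) (show xc < y by linarith [mem_Ioi.1 hy]) hy).le
    linarith [hpos (xc + 1)]

namespace KS
variable {u : ℝ → ℝ} (S : KS u)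

theorem continuous_u (S : KS u) : Continuous u := S.toRatData.continuous_u

theorem le_max (x : ℝ) : u x ≤ u S.xc := by
  rcases le_total x S.xc with h | h
  · exact S.mono.monotoneOn h self_mem_Iic h
  · exact S.anti.antitoneOn self_mem_Ici h h

theorem tendsto_atBot (S : KS u) : Tendsto u atBot (𝓝 0) :=
  S.toRatData.tendsto_u_cocompact.mono_left (by rw [cocompact_eq_atBot_atTop]; exact le_sup_left)

theorem tendsto_atTop (S : KS u) : Tendsto u atTop (𝓝 0) :=
  S.toRatData.tendsto_u_cocompact.mono_left (by rw [cocompact_eq_atBot_atTop]; exact le_sup_right)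

theorem bulk_eq : bulk u = Ioo (-u S.xc) 0 := by
  have h1 : (⨆ x, u x) = u S.xc :=
    le_antisymm (ciSup_le S.le_max) (le_ciSup (f := u) ⟨u S.xc, by rintro _ ⟨x, rfl⟩; exact S.le_max x⟩ S.xc)
  have h2 : (⨅ x, u x) = 0 := by
    refine le_antisymm ?_ (le_ciInf fun x => (S.pos x).le)
    exact ge_of_tendsto' S.tendsto_atTop fun x =>
      ciInf_le (f := u) ⟨0, by rintro _ ⟨x, rfl⟩; exact (S.pos x).le⟩ x
  rw [bulk, h1, h2, neg_zero]

theorem exists_roots {ev : ℝ} (h : ev ∈ bulk u) :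
    ∃ p q, p < S.xc ∧ S.xc < q ∧ u p = -ev ∧ u q = -ev := by
  rw [S.bulk_eq] at h
  have h0 : 0 < -ev := by linarith [h.2]
  obtain ⟨y, hy1, hy2⟩ := ((S.tendsto_atBot.eventually (gt_mem_nhds h0)).and
    (Iio_mem_atBot S.xc)).exists
  obtain ⟨y', hy1', hy2'⟩ := ((S.tendsto_atTop.eventually (gt_mem_nhds h0)).and
    (Ioi_mem_atTop S.xc)).exists
  have h3 : -ev < u S.xc := by linarith [h.1]
  obtain ⟨p, hp, hpe⟩ := intermediate_value_Icc (mem_Iio.1 hy2).le S.continuous_u.continuousOn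
    ⟨hy1.le, h3.le⟩
  obtain ⟨q, hq, hqe⟩ := intermediate_value_Icc' (mem_Ioi.1 hy2').le S.continuous_u.continuousOn
    ⟨hy1'.le, h3.le⟩
  refine ⟨p, q, lt_of_le_of_ne hp.2 ?_, lt_of_le_of_ne hq.1 ?_, hpe, hqe⟩
  · rintro rfl; linarith
  · intro h4; rw [← h4] at hqe; linarith

theorem roots_eq {p q : ℝ} (hp : p < S.xc) (hq : S.xc < q) {ev : ℝ} (hpe : u p = -ev)
    (hqe : u q = -ev) : {x | u x = -ev} = {p, q} := by
  ext x
  simp only [mem_ofPred_eq, mem_insert_iff, mem_singleton_iff]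
  constructor
  · intro h
    rcases le_total x S.xc with h1 | h1
    · exact Or.inl (S.mono.injOn h1 hp.le (h.trans hpe.symm))
    · exact Or.inr (S.anti.injOn h1 hq.le (h.trans hqe.symm))
  · rintro (rfl | rfl) <;> assumption

theorem xMinus_xPlus_spec (S : KS u) {ev : ℝ} (h : ev ∈ bulk u) :
    xMinus u ev < S.xc ∧ S.xc < xPlus u ev ∧ u (xMinus u ev) = -ev ∧ u (xPlus u ev) = -ev := by
  obtain ⟨p, q, hp, hq, hpe, hqe⟩ := S.exists_roots h
  have hpq : p ≤ q := (hp.trans hq).le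
  have h1 : xMinus u ev = p := by
    rw [xMinus, S.roots_eq hp hq hpe hqe, csInf_pair]
    exact min_eq_left hpq
  have h2 : xPlus u ev = q := by
    rw [xPlus, S.roots_eq hp hq hpe hqe, csSup_pair]
    exact max_eq_right hpq
  rw [h1, h2]
  exact ⟨hp, hq, hpe, hqe⟩

theorem xMinus_lt {ev : ℝ} (h : ev ∈ bulk u) : xMinus u ev < S.xc := (S.xMinus_xPlus_spec h).1
theorem lt_xPlus {ev : ℝ} (h : ev ∈ bulk u) : S.xc < xPlus u ev := (S.xMinus_xPlus_spec h).2.1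
theorem u_xMinus (S : KS u) {ev : ℝ} (h : ev ∈ bulk u) : u (xMinus u ev) = -ev := (S.xMinus_xPlus_spec h).2.2.1
theorem u_xPlus (S : KS u) {ev : ℝ} (h : ev ∈ bulk u) : u (xPlus u ev) = -ev := (S.xMinus_xPlus_spec h).2.2.2

theorem xMinus_lt_xPlus (S : KS u) {ev : ℝ} (h : ev ∈ bulk u) : xMinus u ev < xPlus u ev :=
  (S.xMinus_lt h).trans (S.lt_xPlus h)

theorem u_add_pos (S : KS u) {ev : ℝ} (h : ev ∈ bulk u) {x : ℝ} (h1 : xMinus u ev < x) (h2 : x < xPlus u ev) :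
    0 < u x + ev := by
  rcases le_total x S.xc with h3 | h3
  · have := S.mono (S.xMinus_lt h).le h3 h1
    rw [S.u_xMinus h] at this; linarith
  · have := S.anti h3 (S.lt_xPlus h).le h2
    rw [S.u_xPlus h] at this; linarith

theorem u_add_neg_left (S : KS u) {ev : ℝ} (h : ev ∈ bulk u) {x : ℝ} (h1 : x < xMinus u ev) :
    u x + ev < 0 := by
  have := S.mono (h1.trans (S.xMinus_lt h)).le (S.xMinus_lt h).le h1
  rw [S.u_xMinus h] at this; linarith

theorem u_add_neg_right (S : KS u) {ev : ℝ} (h : ev ∈ bulk u) {x : ℝ} (h1 : xPlus u ev < x) :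
    u x + ev < 0 := by
  have := S.anti (S.lt_xPlus h).le ((S.lt_xPlus h).trans h1).le h1
  rw [S.u_xPlus h] at this; linarith

theorem isOpen_bulk : IsOpen (bulk u) := isOpen_Ioo

theorem lt_xMinus_iff {ev x : ℝ} (h : ev ∈ bulk u) (hx : x ≤ S.xc) :
    x < xMinus u ev ↔ u x < -ev := by
  rw [← S.u_xMinus h]
  exact (S.mono.lt_iff_lt hx (S.xMinus_lt h).le).symm

theorem xMinus_lt_iff {ev x : ℝ} (h : ev ∈ bulk u) (hx : x ≤ S.xc) :
    xMinus u ev < x ↔ -ev < u x := by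
  rw [← S.u_xMinus h]
  exact (S.mono.lt_iff_lt (S.xMinus_lt h).le hx).symm

theorem lt_xPlus_iff {ev x : ℝ} (h : ev ∈ bulk u) (hx : S.xc ≤ x) :
    x < xPlus u ev ↔ -ev < u x := by
  rw [← S.u_xPlus h]
  exact (S.anti.lt_iff_gt (S.lt_xPlus h).le hx).symm

theorem xPlus_lt_iff {ev x : ℝ} (h : ev ∈ bulk u) (hx : S.xc ≤ x) :
    xPlus u ev < x ↔ u x < -ev := by
  rw [← S.u_xPlus h]
  exact (S.anti.lt_iff_gt hx (S.lt_xPlus h).le).symm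

theorem continuousAt_xMinus (S : KS u) {ev : ℝ} (h : ev ∈ bulk u) : ContinuousAt (xMinus u) ev := by
  have hb := isOpen_bulk.mem_nhds h
  refine tendsto_order.2 ⟨fun y hy => ?_, fun y hy => ?_⟩
  · have h1 : y ≤ S.xc := (hy.trans (S.xMinus_lt h)).le
    have h2 := (S.lt_xMinus_iff h h1).1 hy
    filter_upwards [hb, gt_mem_nhds (show ev < -u y by linarith)] with t ht ht2
    exact (S.lt_xMinus_iff ht h1).2 (by linarith)
  · have h1 : min y S.xc ≤ S.xc := min_le_right _ _
    have h2 := (S.xMinus_lt_iff h h1).1 (lt_min hy (S.xMinus_lt h))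
    filter_upwards [hb, lt_mem_nhds (show -u (min y S.xc) < ev by linarith)] with t ht ht2
    exact ((S.xMinus_lt_iff ht h1).2 (by linarith)).trans_le (min_le_left _ _)

theorem continuousAt_xPlus (S : KS u) {ev : ℝ} (h : ev ∈ bulk u) : ContinuousAt (xPlus u) ev := by
  have hb := isOpen_bulk.mem_nhds h
  refine tendsto_order.2 ⟨fun y hy => ?_, fun y hy => ?_⟩
  · have h1 : S.xc ≤ max y S.xc := le_max_right _ _
    have h2 := (S.lt_xPlus_iff h h1).1 (max_lt hy (S.lt_xPlus h))
    filter_upwards [hb, lt_mem_nhds (show -u (max y S.xc) < ev by linarith)] with t ht ht2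
    exact (le_max_left _ _).trans_lt ((S.lt_xPlus_iff ht h1).2 (by linarith))
  · have h1 : S.xc ≤ y := ((S.lt_xPlus h).trans hy).le
    have h2 := (S.xPlus_lt_iff h h1).1 hy
    filter_upwards [hb, gt_mem_nhds (show ev < -u y by linarith)] with t ht ht2
    exact (S.xPlus_lt_iff ht h1).2 (by linarith)

/-- The derivative of the potential does not vanish at the turning points. -/
theorem deriv_xMinus_ne (S : KS u) {ev : ℝ} (h : ev ∈ bulk u) : deriv u (xMinus u ev) ≠ 0 :=
  S.deriv_ne _ (S.xMinus_lt h).ne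

theorem deriv_xPlus_ne (S : KS u) {ev : ℝ} (h : ev ∈ bulk u) : deriv u (xPlus u ev) ≠ 0 :=
  S.deriv_ne _ (S.lt_xPlus h).ne'

end KS

/-- The action integral over the well. -/
def action (u : ℝ → ℝ) (ev : ℝ) : ℝ := ∫ x in xMinus u ev..xPlus u ev, (u x + ev)

/-! ### The action and its derivative -/

namespace KS
variable {u : ℝ → ℝ} (S : KS u)

/-- The well is the set where `u + ev` is nonnegative, so among intervals containing the critical
point it maximises the integral. -/
theorem integral_le_action {ev : ℝ} (h : ev ∈ bulk u) {p q : ℝ} (hp : p ≤ S.xc) (hq : S.xc ≤ q) :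
    ∫ x in p..q, (u x + ev) ≤ action u ev := by
  have hi : ∀ a b : ℝ, IntervalIntegrable (fun x => u x + ev) volume a b := fun a b =>
    (S.continuous_u.add continuous_const).intervalIntegrable a b
  have h1 : 0 ≤ ∫ x in xMinus u ev..p, (u x + ev) := by
    rcases le_total (xMinus u ev) p with h2 | h2
    · refine intervalIntegral.integral_nonneg h2 fun x hx => ?_
      rcases eq_or_lt_of_le hx.1 with h3 | h3
      · rw [← h3, S.u_xMinus h]; linarith
      · exact (S.u_add_pos h h3 ((hx.2.trans hp).trans_lt (S.lt_xPlus h))).le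
    · rw [intervalIntegral.integral_symm, ← intervalIntegral.integral_neg]
      refine intervalIntegral.integral_nonneg h2 fun x hx => neg_nonneg.2 ?_
      rcases eq_or_lt_of_le hx.2 with h3 | h3
      · rw [h3, S.u_xMinus h]; linarith
      · exact (S.u_add_neg_left h h3).le
  have h2 : 0 ≤ ∫ x in q..xPlus u ev, (u x + ev) := by
    rcases le_total q (xPlus u ev) with h2 | h2
    · refine intervalIntegral.integral_nonneg h2 fun x hx => ?_
      rcases eq_or_lt_of_le hx.2 with h3 | h3
      · rw [h3, S.u_xPlus h]; linarith
      · exact (S.u_add_pos h ((S.xMinus_lt h).trans_le (hq.trans hx.1)) h3).le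
    · rw [intervalIntegral.integral_symm, ← intervalIntegral.integral_neg]
      refine intervalIntegral.integral_nonneg h2 fun x hx => neg_nonneg.2 ?_
      rcases eq_or_lt_of_le hx.1 with h3 | h3
      · rw [← h3, S.u_xPlus h]; linarith
      · exact (S.u_add_neg_right h h3).le
  have h3 := intervalIntegral.integral_add_adjacent_intervals (hi (xMinus u ev) p) (hi p q)
  have h4 := intervalIntegral.integral_add_adjacent_intervals (hi (xMinus u ev) q)
    (hi q (xPlus u ev))
  rw [action]
  linarith

/-- The well at level `ev` is a competitor at level `ev'`, where the integral over it is affine in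
`ev'`. The action is thus a maximum of affine functions, hence convex, with the width as slope; this
gives its derivative without differentiating the turning points. -/
theorem action_sub_ge (S : KS u) {ev ev' : ℝ} (h : ev ∈ bulk u) (h' : ev' ∈ bulk u) :
    (ev' - ev) * (xPlus u ev - xMinus u ev) ≤ action u ev' - action u ev := by
  have h1 := S.integral_le_action h' (S.xMinus_lt h).le (S.lt_xPlus h).le
  have h2 : ∫ x in xMinus u ev..xPlus u ev, (u x + ev')
      = action u ev + (ev' - ev) * (xPlus u ev - xMinus u ev) := by
    have h3 : ∀ x, u x + ev' = (u x + ev) + (ev' - ev) := fun x => by ring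
    simp_rw [h3]
    have h4 : Continuous fun x => u x + ev := S.continuous_u.add continuous_const
    rw [intervalIntegral.integral_add (h4.intervalIntegrable _ _)
      (continuous_const.intervalIntegrable _ _), intervalIntegral.integral_const, smul_eq_mul, action]
    ring
  linarith

theorem action_sub_le (S : KS u) {ev ev' : ℝ} (h : ev ∈ bulk u) (h' : ev' ∈ bulk u) :
    action u ev' - action u ev ≤ (ev' - ev) * (xPlus u ev' - xMinus u ev') := by
  have := S.action_sub_ge h' h
  linarith

theorem continuousAt_width (S : KS u) {ev : ℝ} (h : ev ∈ bulk u) :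
    ContinuousAt (fun t => xPlus u t - xMinus u t) ev :=
  (S.continuousAt_xPlus h).sub (S.continuousAt_xMinus h)

theorem hasDerivAt_action (S : KS u) {ev : ℝ} (h : ev ∈ bulk u) :
    HasDerivAt (action u) (xPlus u ev - xMinus u ev) ev := by
  rw [hasDerivAt_iff_isLittleO, isLittleO_iff]
  intro c hc
  have h1 := (S.continuousAt_width h).eventually (Metric.ball_mem_nhds _ hc)
  filter_upwards [h1, isOpen_bulk.mem_nhds h] with t ht htb
  have h2 := S.action_sub_ge h htb
  have h3 := S.action_sub_le h htb
  rw [Real.dist_eq] at ht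
  rw [smul_eq_mul, Real.norm_eq_abs, Real.norm_eq_abs, abs_of_nonneg (by linarith)]
  calc _ ≤ (t - ev) * (xPlus u t - xMinus u t - (xPlus u ev - xMinus u ev)) := by linarith
    _ ≤ |t - ev| * |xPlus u t - xMinus u t - (xPlus u ev - xMinus u ev)| := by
      rw [← abs_mul]; exact le_abs_self _
    _ ≤ c * |t - ev| := by rw [mul_comm]; exact mul_le_mul_of_nonneg_right ht.le (abs_nonneg _)

theorem continuousOn_matsunoDensity (S : KS u) : ContinuousOn (matsunoDensity u) (bulk u) := fun _ h =>
  ((S.continuousAt_width h).div_const _).continuousWithinAt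

theorem integral_matsunoDensity (S : KS u) {a b : ℝ} (hab : a ≤ b) (hb : Icc a b ⊆ bulk u) :
    ∫ ev in a..b, matsunoDensity u ev = (action u b - action u a) / (2 * Real.pi) := by
  have hI : uIcc a b ⊆ bulk u := by rwa [uIcc_of_le hab]
  rw [intervalIntegral.integral_eq_sub_of_hasDerivAt
    (f := fun ev => action u ev / (2 * Real.pi))
    (f' := matsunoDensity u)
    (fun ev hev => (S.hasDerivAt_action (hI hev)).div_const _)
    (S.continuousOn_matsunoDensity.mono hI).intervalIntegrable]
  ring

end KS

/-- The oscillating factor `exp (-i t / ε)`. -/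
def osc (ε t : ℝ) : ℂ := Complex.exp (((-(t / ε) : ℝ) : ℂ) * Complex.I)

/-! ### Oscillatory integrals: nonstationary phase and Fresnel limits -/

theorem norm_osc (ε t : ℝ) : ‖osc ε t‖ = 1 := Complex.norm_exp_ofReal_mul_I _

theorem osc_add (ε s t : ℝ) : osc ε (s + t) = osc ε s * osc ε t := by
  rw [osc, osc, osc, ← Complex.exp_add]
  congr 1
  push_cast
  ring

theorem osc_zero (ε : ℝ) : osc ε 0 = 1 := by simp [osc]

theorem conj_osc (ε t : ℝ) : (starRingEnd ℂ) (osc ε t) = osc ε (-t) := by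
  rw [osc, osc, ← Complex.exp_conj]
  congr 1
  simp
  ring

theorem continuous_osc (ε : ℝ) : Continuous (osc ε) := by
  unfold osc; fun_prop

theorem HasDerivAt.osc {ε : ℝ} {φ : ℝ → ℝ} {w x : ℝ} (h : HasDerivAt φ w x) :
    HasDerivAt (fun x => osc ε (φ x)) (-(Complex.I / ε * w) * osc ε (φ x)) x := by
  have h1 : HasDerivAt (fun x => ((-(φ x / ε) : ℝ) : ℂ) * Complex.I)
      (((-(w / ε) : ℝ) : ℂ) * Complex.I) x := ((h.div_const ε).neg.ofReal_comp).mul_const _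
  refine h1.cexp.congr_deriv ?_
  unfold BenjaminOno.osc
  push_cast
  ring

/-- Integration by parts against a nonvanishing phase derivative, at distance at least `δ` from the
point `x₀`; stated for a primitive `g`. -/
theorem norm_sub_le_of_nonstationary {ε C δ p q x₀ : ℝ} (hε : 0 < ε) (hC : 0 ≤ C) (hδ : 0 < δ)
    (hpq : p ≤ q)
    (hx₀ : x₀ + δ ≤ p ∨ q ≤ x₀ - δ) {φ ω ω' : ℝ → ℝ} {v v' g : ℝ → ℂ}
    (hφ : ∀ x, HasDerivAt φ (ω x) x) (hω : ∀ x, HasDerivAt ω (ω' x) x)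
    (hv : ∀ x, HasDerivAt v (v' x) x) (hg : ∀ x, HasDerivAt g (osc ε (φ x) * v x) x)
    (h0 : ∀ x ∈ Icc p q, ω x ≠ 0)
    (h1 : ∀ x ∈ Icc p q, ‖v x‖ * |x - x₀| ≤ C * |ω x|)
    (h2 : ∀ x ∈ Icc p q, (‖v' x‖ * |ω x| + ‖v x‖ * |ω' x|) * (x - x₀) ^ 2 ≤ C * ω x ^ 2) :
    ‖g q - g p‖ ≤ 3 * C * ε / δ := by
  have hd : ∀ x ∈ Icc p q, δ ≤ |x - x₀| := fun x hx => by
    rcases hx₀ with h | h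
    · exact (by linarith [hx.1] : δ ≤ x - x₀).trans (le_abs_self _)
    · exact (by linarith [hx.2] : δ ≤ -(x - x₀)).trans (neg_le_abs _)
  have hne : ∀ x ∈ Icc p q, x - x₀ ≠ 0 := fun x hx => abs_pos.1 (hδ.trans_le (hd x hx))
  -- `Q` is the boundary term of the integration by parts: `Q'` equals `g'` up to a remainder of
  -- size `C ε / (x - x₀) ^ 2`.
  set Q : ℝ → ℂ := fun x => Complex.I * ε * (osc ε (φ x) * (v x / ω x)) with hQ
  have hQn : ∀ x ∈ Icc p q, ‖Q x‖ ≤ C * ε / δ := fun x hx => by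
    have hω0 : 0 < |ω x| := abs_pos.2 (h0 x hx)
    have h3 : ‖Q x‖ = ε * (‖v x‖ / |ω x|) := by
      simp [hQ, norm_osc, abs_of_pos hε]
    rw [h3, mul_comm, mul_div_right_comm]
    refine mul_le_mul_of_nonneg_right ?_ hε.le
    rw [div_le_div_iff₀ hω0 hδ]
    exact (mul_le_mul_of_nonneg_left (hd x hx) (norm_nonneg _)).trans (h1 x hx)
  have hQd : ∀ x ∈ Icc p q, HasDerivAt Q (osc ε (φ x) * v x
      + Complex.I * ε * (osc ε (φ x) * ((v' x * ω x - v x * ω' x) / ω x ^ 2))) x := fun x hx => by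
    have hω0 : (ω x : ℂ) ≠ 0 := by exact_mod_cast h0 x hx
    have hε0 : (ε : ℂ) ≠ 0 := by exact_mod_cast hε.ne'
    refine (((HasDerivAt.osc (ε := ε) (hφ x)).fun_mul
      ((hv x).fun_div (hω x).ofReal_comp hω0)).const_mul (Complex.I * ε)).congr_deriv ?_
    field_simp
    linear_combination (-(osc ε (φ x) * ω x ^ 2 * v x : ℂ)) * Complex.I_sq
  have hH : ∀ x ∈ Icc p q, HasDerivAt (fun x => (g x - Q x) - (g p - Q p))
      (-(Complex.I * ε * (osc ε (φ x) * ((v' x * ω x - v x * ω' x) / ω x ^ 2)))) x :=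
    fun x hx => by
      refine (((hg x).fun_sub (hQd x hx)).sub_const (g p - Q p)).congr_deriv ?_
      ring
  have hHn : ∀ x ∈ Icc p q,
      ‖-(Complex.I * ε * (osc ε (φ x) * ((v' x * ω x - v x * ω' x) / ω x ^ 2)))‖
        ≤ C * ε / (x - x₀) ^ 2 := fun x hx => by
    have hω0 : 0 < ω x ^ 2 := by have := h0 x hx; positivity
    have hx0 : 0 < (x - x₀) ^ 2 := by have := hne x hx; positivity
    have h3 : ‖-(Complex.I * ε * (osc ε (φ x) * ((v' x * ω x - v x * ω' x) / ω x ^ 2)))‖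
        = ‖v' x * ω x - v x * ω' x‖ / ω x ^ 2 * ε := by
      simp [norm_osc, abs_of_pos hε, mul_comm]
    rw [h3, mul_div_right_comm]
    refine mul_le_mul_of_nonneg_right ?_ hε.le
    rw [div_le_div_iff₀ hω0 hx0]
    refine (mul_le_mul_of_nonneg_right ?_ hx0.le).trans (h2 x hx)
    refine (norm_sub_le _ _).trans_eq ?_
    simp
  -- A primitive of the remainder bound, whose total increase is at most `C ε / δ`. With the two
  -- boundary values of `Q`, each of that size, this accounts for the constant `3`.
  have hB : ∀ x ∈ Icc p q, HasDerivAt (fun x => C * ε * (1 / (p - x₀) - 1 / (x - x₀)))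
      (C * ε / (x - x₀) ^ 2) x := fun x hx => by
    simp_rw [one_div]
    refine (((((hasDerivAt_id' x).sub_const x₀).fun_inv (hne x hx)).const_sub
      (p - x₀)⁻¹).const_mul (C * ε)).congr_deriv ?_
    ring
  have hfin := image_norm_le_of_norm_deriv_right_le_deriv_boundary'
    (f := fun x => (g x - Q x) - (g p - Q p)) (a := p) (b := q)
    (fun x hx => (hH x hx).continuousAt.continuousWithinAt)
    (fun x hx => (hH x (Ico_subset_Icc_self hx)).hasDerivWithinAt)
    (B := fun x => C * ε * (1 / (p - x₀) - 1 / (x - x₀)))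
    (by simp) (fun x hx => (hB x hx).continuousAt.continuousWithinAt)
    (fun x hx => (hB x (Ico_subset_Icc_self hx)).hasDerivWithinAt)
    (fun x hx => hHn x (Ico_subset_Icc_self hx)) (right_mem_Icc.2 hpq)
  have h4 : 1 / (p - x₀) - 1 / (q - x₀) ≤ 1 / δ := by
    rcases hx₀ with h | h
    · have h5 : 1 / (p - x₀) ≤ 1 / δ := one_div_le_one_div_of_le hδ (by linarith)
      have h6 : 0 ≤ 1 / (q - x₀) := one_div_nonneg.2 (by linarith)
      linarith
    · have h5 : 1 / (x₀ - q) ≤ 1 / δ := one_div_le_one_div_of_le hδ (by linarith)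
      have h6 : 0 ≤ 1 / (x₀ - p) := one_div_nonneg.2 (by linarith)
      have h7 : 1 / (x₀ - q) = -(1 / (q - x₀)) := by rw [← one_div_neg_eq_neg_one_div, neg_sub]
      have h8 : 1 / (x₀ - p) = -(1 / (p - x₀)) := by rw [← one_div_neg_eq_neg_one_div, neg_sub]
      linarith
  have h9 : C * ε * (1 / (p - x₀) - 1 / (q - x₀)) ≤ C * ε / δ := by
    rw [div_eq_mul_one_div (C * ε) δ]
    exact mul_le_mul_of_nonneg_left h4 (by positivity)
  have h10 := hQn p (left_mem_Icc.2 hpq)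
  have h11 := hQn q (right_mem_Icc.2 hpq)
  calc ‖g q - g p‖ = ‖((g q - Q q) - (g p - Q p)) + Q q - Q p‖ := by congr 1; ring
    _ ≤ ‖(g q - Q q) - (g p - Q p)‖ + ‖Q q‖ + ‖Q p‖ :=
      (norm_sub_le _ _).trans (add_le_add_left (norm_add_le _ _) _)
    _ ≤ C * ε / δ + C * ε / δ + C * ε / δ := add_le_add (add_le_add (hfin.trans h9) h11) h10
    _ = 3 * C * ε / δ := by ring

/-- Integration by parts against `1 / (2bs)`. The bound depends on `b` only through `‖b‖`, so it is
uniform as `b` approaches the imaginary axis, which is the Fresnel case. -/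
theorem norm_integral_gaussian_tail_le {b : ℂ} (hb : 0 ≤ b.re) (hb0 : b ≠ 0) {S T : ℝ} (hS : 0 < S)
    (hST : S ≤ T) : ‖∫ s in S..T, Complex.exp (-b * s ^ 2)‖ ≤ 2 / (‖b‖ * S) := by
  have hbn : 0 < ‖b‖ := norm_pos_iff.2 hb0
  have hpos : ∀ x ∈ Icc S T, 0 < x := fun x hx => hS.trans_le hx.1
  have hexp : ∀ x : ℝ, ‖Complex.exp (-b * x ^ 2)‖ ≤ 1 := fun x => by
    rw [Complex.norm_exp, Real.exp_le_one_iff]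
    have : (-b * (x : ℂ) ^ 2).re = -(b.re * x ^ 2) := by
      rw [← Complex.ofReal_pow, ← Complex.ofReal_re (x ^ 2), ← Complex.re_mul_ofReal]; simp
    rw [this]
    have := sq_nonneg x
    nlinarith [mul_nonneg hb this]
  set Q : ℝ → ℂ := fun x => Complex.exp (-b * x ^ 2) * (-(2 * b))⁻¹ * (x : ℂ)⁻¹ with hQ
  have hQn : ∀ x ∈ Icc S T, ‖Q x‖ ≤ 1 / (2 * ‖b‖ * x) := fun x hx => by
    have hx := hpos x hx
    have : ‖Q x‖ = ‖Complex.exp (-b * x ^ 2)‖ * (1 / (2 * ‖b‖ * x)) := by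
      rw [hQ]; simp only [norm_mul, norm_inv, norm_neg, Complex.norm_real, Real.norm_of_nonneg hx.le,
        Complex.norm_ofNat]
      field_simp
    rw [this]
    exact mul_le_of_le_one_left (by positivity) (hexp x)
  have hQd : ∀ x ∈ Icc S T, HasDerivAt Q (Complex.exp (-b * x ^ 2)
      + Complex.exp (-b * x ^ 2) * (2 * b)⁻¹ * ((x : ℂ) ^ 2)⁻¹) x := fun x hx => by
    have hx := hpos x hx
    have hx0 : (x : ℂ) ≠ 0 := by exact_mod_cast hx.ne'
    have h1 : HasDerivAt (fun x : ℝ => (x : ℂ)) 1 x := Complex.ofRealCLM.hasDerivAt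
    refine ((((h1.fun_pow 2).const_mul (-b)).cexp.mul_const (-(2 * b))⁻¹).fun_mul
      (h1.fun_inv hx0)).congr_deriv ?_
    field_simp
    ring
  set g : ℝ → ℂ := fun x => ∫ s in S..x, Complex.exp (-b * s ^ 2) with hgdef
  have hcont : Continuous fun s : ℝ => Complex.exp (-b * s ^ 2) := by fun_prop
  have hg : ∀ x : ℝ, HasDerivAt g (Complex.exp (-b * x ^ 2)) x := fun x =>
    intervalIntegral.integral_hasDerivAt_right (hcont.intervalIntegrable _ _)
      (hcont.stronglyMeasurableAtFilter _ _) hcont.continuousAt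
  have hH : ∀ x ∈ Icc S T, HasDerivAt (fun x => (g x - Q x) - (g S - Q S))
      (-(Complex.exp (-b * x ^ 2) * (2 * b)⁻¹ * ((x : ℂ) ^ 2)⁻¹)) x := fun x hx => by
    refine (((hg x).fun_sub (hQd x hx)).sub_const (g S - Q S)).congr_deriv ?_
    ring
  have hB : ∀ x ∈ Icc S T, HasDerivAt (fun x => 1 / (2 * ‖b‖) * (1 / S - 1 / x))
      (1 / (2 * ‖b‖) * (1 / x ^ 2)) x := fun x hx => by
    have hx := hpos x hx
    simp_rw [one_div]
    refine ((((hasDerivAt_id' x).fun_inv hx.ne').const_sub S⁻¹).const_mul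
      (2 * ‖b‖)⁻¹).congr_deriv ?_
    ring
  have hfin := image_norm_le_of_norm_deriv_right_le_deriv_boundary'
    (f := fun x => (g x - Q x) - (g S - Q S)) (a := S) (b := T)
    (fun x hx => (hH x hx).continuousAt.continuousWithinAt)
    (fun x hx => (hH x (Ico_subset_Icc_self hx)).hasDerivWithinAt)
    (B := fun x => 1 / (2 * ‖b‖) * (1 / S - 1 / x))
    (by simp) (fun x hx => (hB x hx).continuousAt.continuousWithinAt)
    (fun x hx => (hB x (Ico_subset_Icc_self hx)).hasDerivWithinAt)
    (fun x hx => by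
      have hx := hpos x (Ico_subset_Icc_self hx)
      have : ‖-(Complex.exp (-b * x ^ 2) * (2 * b)⁻¹ * ((x : ℂ) ^ 2)⁻¹)‖
          = ‖Complex.exp (-b * x ^ 2)‖ * (1 / (2 * ‖b‖) * (1 / x ^ 2)) := by
        simp only [norm_mul, norm_inv, norm_neg, norm_pow, Complex.norm_real,
          Real.norm_of_nonneg hx.le, Complex.norm_ofNat]
        field_simp
      rw [this]
      exact mul_le_of_le_one_left (by positivity) (hexp x)) (right_mem_Icc.2 hST)
  have hgS : g S = 0 := by simp [hgdef]
  have h10 := hQn S (left_mem_Icc.2 hST)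
  have h11 := hQn T (right_mem_Icc.2 hST)
  have hT : 0 < T := hS.trans_le hST
  have h12 : 1 / (2 * ‖b‖) * (1 / S - 1 / T) + 1 / (2 * ‖b‖ * T) = 1 / (2 * ‖b‖ * S) := by
    field_simp
    ring
  change ‖g T‖ ≤ _
  calc ‖g T‖ = ‖((g T - Q T) - (g S - Q S)) + Q T - Q S‖ := by congr 1; rw [hgS]; ring
    _ ≤ ‖(g T - Q T) - (g S - Q S)‖ + ‖Q T‖ + ‖Q S‖ :=
      (norm_sub_le _ _).trans (add_le_add_left (norm_add_le _ _) _)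
    _ ≤ 1 / (2 * ‖b‖) * (1 / S - 1 / T) + 1 / (2 * ‖b‖ * T) + 1 / (2 * ‖b‖ * S) :=
      add_le_add (add_le_add hfin h11) h10
    _ = 1 / (‖b‖ * S) := by rw [h12]; field_simp; norm_num
    _ ≤ 2 / (‖b‖ * S) := by gcongr; norm_num

theorem norm_integral_gaussian_sub_le {b : ℂ} (hb : 0 < b.re) {S : ℝ} (hS : 0 < S) :
    ‖(Real.pi / b) ^ (1 / 2 : ℂ) - ∫ s in -S..S, Complex.exp (-b * s ^ 2)‖ ≤ 4 / (‖b‖ * S) := by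
  have hb0 : b ≠ 0 := by rintro rfl; simp at hb
  have hcont : Continuous fun s : ℝ => Complex.exp (-b * s ^ 2) := by fun_prop
  have hlim : Tendsto (fun T : ℝ => ∫ s in -T..T, Complex.exp (-b * s ^ 2)) atTop
      (𝓝 ((Real.pi / b) ^ (1 / 2 : ℂ))) := by
    rw [← integral_gaussian_complex hb]
    exact intervalIntegral_tendsto_integral (integrable_cexp_neg_mul_sq hb) tendsto_neg_atTop_atBot
      tendsto_id
  refine le_of_tendsto ((hlim.sub_const _).norm) ?_
  filter_upwards [eventually_ge_atTop S] with T hT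
  have h1 := norm_integral_gaussian_tail_le hb.le hb0 hS hT
  have h2 : ∫ s in -T..-S, Complex.exp (-b * s ^ 2) = ∫ s in S..T, Complex.exp (-b * s ^ 2) := by
    rw [← intervalIntegral.integral_comp_neg]
    simp
  have h3 := intervalIntegral.integral_add_adjacent_intervals
    (hcont.intervalIntegrable (μ := volume) (-T) (-S)) (hcont.intervalIntegrable (-S) S)
  have h4 := intervalIntegral.integral_add_adjacent_intervals
    (hcont.intervalIntegrable (μ := volume) (-T) S) (hcont.intervalIntegrable S T)
  rw [← h4, ← h3, h2]
  calc _ = ‖(∫ s in S..T, Complex.exp (-b * s ^ 2)) + ∫ s in S..T, Complex.exp (-b * s ^ 2)‖ := by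
        congr 1; ring
    _ ≤ 2 / (‖b‖ * S) + 2 / (‖b‖ * S) := (norm_add_le _ _).trans (add_le_add h1 h1)
    _ = _ := by ring

/-- The Fresnel integrals converge to a nonzero limit. -/
theorem exists_fresnel {k : ℝ} (hk : k ≠ 0) : ∃ c : ℂ, c ≠ 0 ∧
    Tendsto (fun S : ℝ => ∫ s in -S..S, Complex.exp (-(Complex.I * k / 2) * s ^ 2)) atTop (𝓝 c) := by
  set b₀ : ℂ := Complex.I * k / 2 with hb₀
  have hb0 : b₀ ≠ 0 := by simp [hb₀, hk]
  have hpi : (Real.pi / b₀ : ℂ) ≠ 0 := div_ne_zero (by simp [Real.pi_ne_zero]) hb0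
  refine ⟨(Real.pi / b₀) ^ (1 / 2 : ℂ), by simp [Complex.cpow_eq_zero_iff, hpi], ?_⟩
  have key : ∀ S : ℝ, 0 < S →
      ‖(∫ s in -S..S, Complex.exp (-b₀ * s ^ 2)) - (Real.pi / b₀) ^ (1 / 2 : ℂ)‖
        ≤ 4 / (‖b₀‖ * S) := by
    intro S hS
    rw [norm_sub_rev]
    -- The imaginary parameter is approached from the right half-plane, where the full Gaussian
    -- integral converges absolutely; the error bound is stable in the limit.
    have hc : Tendsto (fun t : ℝ => b₀ + t) (𝓝[>] 0) (𝓝 b₀) := by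
      have : Tendsto (fun t : ℝ => b₀ + t) (𝓝 0) (𝓝 (b₀ + (0 : ℝ))) := by
        apply Continuous.tendsto; fun_prop
      simpa using this.mono_left nhdsWithin_le_nhds
    -- This number is purely imaginary and nonzero, so the principal square root is continuous
    -- there.
    have hslit : (Real.pi / b₀ : ℂ) ∈ Complex.slitPlane := by
      refine Complex.mem_slitPlane_iff.2 (Or.inr ?_)
      have : (Real.pi / b₀ : ℂ) = ((-(2 * Real.pi / k) : ℝ) : ℂ) * Complex.I := by
        have hk' : (k : ℂ) ≠ 0 := by exact_mod_cast hk
        rw [hb₀]; push_cast; field_simp; simp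
      rw [this]
      simp [Real.pi_ne_zero, hk]
    have h1 : Tendsto (fun t : ℝ => (Real.pi / (b₀ + t) : ℂ) ^ (1 / 2 : ℂ)) (𝓝[>] 0)
        (𝓝 ((Real.pi / b₀) ^ (1 / 2 : ℂ))) :=
      (tendsto_const_nhds.div hc hb0).cpow tendsto_const_nhds hslit
    have h2c : Continuous fun b : ℂ => ∫ s in -S..S, Complex.exp (-b * s ^ 2) :=
      intervalIntegral.continuous_parametric_intervalIntegral_of_continuous' (by fun_prop) _ _
    have h2 := (h2c.tendsto b₀).comp hc
    refine le_of_tendsto_of_tendsto (h1.sub h2).norm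
      (tendsto_const_nhds.div (hc.norm.mul_const S) (by positivity)) ?_
    filter_upwards [self_mem_nhdsWithin] with t ht
    exact norm_integral_gaussian_sub_le (by simpa [hb₀] using ht) hS
  refine tendsto_iff_norm_sub_tendsto_zero.2 (squeeze_zero' (Eventually.of_forall fun _ =>
    norm_nonneg _) ((eventually_gt_atTop 0).mono key) ?_)
  exact Tendsto.const_div_atTop (tendsto_id.const_mul_atTop (norm_pos_iff.2 hb0)) _

/-- The stationary phase limit on the scale of the stationary zone. -/
theorem tendsto_stationary {u : ℝ → ℝ} {x₀ k M S : ℝ}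
    (hd : HasStrictDerivAt u k x₀) {ε x : ℕ → ℝ} {φ : ℕ → ℝ → ℝ} {v : ℕ → ℝ → ℂ} {w : ℂ}
    (hε : ∀ n, 0 < ε n) (hε0 : Tendsto ε atTop (𝓝 0)) (hx : Tendsto x atTop (𝓝 x₀))
    (hφ : ∀ n t, HasDerivAt (φ n) (u t - u (x n)) t) (hM : ∀ n t, ‖v n t‖ ≤ M)
    (hvc : ∀ n, Continuous (v n))
    (hv : ∀ y : ℕ → ℝ, Tendsto y atTop (𝓝 x₀) → Tendsto (fun n => v n (y n)) atTop (𝓝 w)) :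
    Tendsto (fun n => osc (ε n) (-φ n (x n)) * ((√(ε n) : ℂ)⁻¹ *
        ∫ t in x n - S * √(ε n)..x n + S * √(ε n), osc (ε n) (φ n t) * v n t)) atTop
      (𝓝 (w * ∫ s in -S..S, Complex.exp (-(Complex.I * k / 2) * s ^ 2))) := by
  have hr : ∀ n, 0 < √(ε n) := fun n => Real.sqrt_pos.2 (hε n)
  have hr0 : Tendsto (fun n => √(ε n)) atTop (𝓝 0) := by
    simpa [Function.comp_def] using (Real.continuous_sqrt.tendsto 0).comp hε0
  have hy : ∀ s : ℝ, Tendsto (fun n => x n + √(ε n) * s) atTop (𝓝 x₀) := fun s => by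
    simpa using hx.add (hr0.mul_const s)
  -- Rescaling `t = x n + √(ε n) s` brings the window to a fixed interval.
  have e1 : ∀ n, osc (ε n) (-φ n (x n)) * ((√(ε n) : ℂ)⁻¹ *
        ∫ t in x n - S * √(ε n)..x n + S * √(ε n), osc (ε n) (φ n t) * v n t)
      = ∫ s in -S..S, osc (ε n) (φ n (x n + √(ε n) * s) - φ n (x n))
          * v n (x n + √(ε n) * s) := fun n => by
    have h1 := intervalIntegral.smul_integral_comp_add_mul
      (fun t => osc (ε n) (φ n t) * v n t) (√(ε n)) (x n) (a := -S) (b := S)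
    have h2 : x n + √(ε n) * -S = x n - S * √(ε n) := by ring
    have h3 : x n + √(ε n) * S = x n + S * √(ε n) := by ring
    have h4 : (√(ε n) : ℂ) ≠ 0 := by exact_mod_cast (hr n).ne'
    rw [h2, h3] at h1
    rw [← h1, Complex.real_smul, inv_mul_cancel_left₀ h4, ← intervalIntegral.integral_const_mul]
    refine intervalIntegral.integral_congr fun s _ => ?_
    rw [← mul_assoc, ← osc_add, neg_add_eq_sub]
  simp_rw [e1]
  rw [← intervalIntegral.integral_const_mul]
  -- On this scale the phase is `k s² / 2` to leading order. Strict differentiability at `x₀` is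
  -- needed because the base point `x n` moves; the estimate on the derivative is integrated by the
  -- mean value inequality.
  have hphase : ∀ s ∈ Icc (-|S|) |S|,
      Tendsto (fun n => (φ n (x n + √(ε n) * s) - φ n (x n)) / ε n) atTop (𝓝 (k * s ^ 2 / 2)) := by
    intro s hs
    rw [Metric.tendsto_nhds]
    intro η hη
    set η' := η / (2 * (|S| ^ 2 + 1)) with hη'
    have hη'0 : 0 < η' := by positivity
    have h1 := hd.hasStrictFDerivAt.isLittleO.def hη'0
    obtain ⟨δ, hδ, h2⟩ := Metric.eventually_nhds_iff.1 h1
    have hr1 : Tendsto (fun n => √(ε n) * |S|) atTop (𝓝 0) := by simpa using hr0.mul_const |S|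
    filter_upwards [Metric.tendsto_nhds.1 hx (δ / 2) (by positivity),
      hr1.eventually (gt_mem_nhds (show 0 < δ / 2 by positivity))] with n hn1 hn2
    have hd1 : ∀ t : ℝ, HasDerivAt (fun t => φ n (x n + √(ε n) * t) / ε n - k * t ^ 2 / 2)
        ((u (x n + √(ε n) * t) - u (x n)) / √(ε n) - k * t) t := fun t => by
      have h3 : HasDerivAt (fun t => x n + √(ε n) * t) (√(ε n)) t := by
        simpa using ((hasDerivAt_id' t).const_mul (√(ε n))).const_add (x n)
      refine (((HasDerivAt.comp t (hφ n _) h3).div_const (ε n)).fun_sub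
        ((((hasDerivAt_id' t).fun_pow 2).const_mul k).div_const 2)).congr_deriv ?_
      have h4 : ε n = √(ε n) * √(ε n) := (Real.mul_self_sqrt (hε n).le).symm
      have h5 := (hr n).ne'
      conv_lhs => rw [h4, Real.sqrt_mul_self (hr n).le]
      field_simp
      ring
    have hb1 : ∀ t ∈ Icc (-|S|) |S|,
        ‖(u (x n + √(ε n) * t) - u (x n)) / √(ε n) - k * t‖ ≤ η' * |S| := fun t ht => by
      have ht' : |t| ≤ |S| := abs_le.2 ht
      have h3 : dist (x n + √(ε n) * t) x₀ < δ := by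
        rw [Real.dist_eq] at hn1 ⊢
        calc |x n + √(ε n) * t - x₀| = |(x n - x₀) + √(ε n) * t| := by ring_nf
          _ ≤ |x n - x₀| + √(ε n) * |t| := by
            refine (abs_add_le _ _).trans_eq ?_
            rw [abs_mul, abs_of_pos (hr n)]
          _ < δ := by
            have := mul_le_mul_of_nonneg_left ht' (hr n).le
            linarith
      have h4 := @h2 (x n + √(ε n) * t, x n) (by
        rw [Prod.dist_eq]; exact max_lt h3 (by linarith))
      simp only [ContinuousLinearMap.toSpanSingleton_apply, smul_eq_mul, add_sub_cancel_left] at h4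
      have h5 : (u (x n + √(ε n) * t) - u (x n)) / √(ε n) - k * t
          = (u (x n + √(ε n) * t) - u (x n) - √(ε n) * t * k) / √(ε n) := by
        have := (hr n).ne'
        field_simp
      rw [h5, norm_div, Real.norm_of_nonneg (hr n).le, div_le_iff₀ (hr n)]
      refine h4.trans ?_
      rw [norm_mul, Real.norm_of_nonneg (hr n).le, Real.norm_eq_abs]
      nlinarith [mul_le_mul_of_nonneg_left ht' (mul_pos hη'0 (hr n)).le]
    have h0 : (0 : ℝ) ∈ Icc (-|S|) |S| := by simp
    have h3 := (convex_Icc (-|S|) |S|).norm_image_sub_le_of_norm_hasDerivWithin_le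
      (fun t ht => (hd1 t).hasDerivWithinAt) hb1 h0 hs
    have h4 : ‖s - 0‖ ≤ |S| := by simpa using abs_le.2 hs
    have h5 : (φ n (x n + √(ε n) * s) - φ n (x n)) / ε n - k * s ^ 2 / 2
        = φ n (x n + √(ε n) * s) / ε n - k * s ^ 2 / 2
          - (φ n (x n + √(ε n) * 0) / ε n - k * 0 ^ 2 / 2) := by
      simp only [mul_zero, add_zero]; ring
    rw [dist_eq_norm, h5]
    calc _ ≤ η' * |S| * |S| := h3.trans (mul_le_mul_of_nonneg_left h4 (by positivity))
      _ < η := by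
        rw [hη', div_mul_eq_mul_div, div_mul_eq_mul_div, div_lt_iff₀ (by positivity)]
        nlinarith [sq_nonneg |S|]
  refine intervalIntegral.tendsto_integral_filter_of_dominated_convergence (fun _ => M) ?_ ?_
    intervalIntegrable_const ?_
  · refine Eventually.of_forall fun n => Continuous.aestronglyMeasurable ?_
    have hφc : Continuous (φ n) := continuous_iff_continuousAt.2 fun t => (hφ n t).continuousAt
    have := hvc n
    exact ((continuous_osc _).comp (by fun_prop)).mul (by fun_prop)
  · refine Eventually.of_forall fun n => ae_of_all _ fun s _ => ?_
    rw [norm_mul, norm_osc, one_mul]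
    exact hM _ _
  · refine ae_of_all _ fun s hs => ?_
    have hs' : s ∈ Icc (-|S|) |S| := by
      have h1 := uIoc_subset_uIcc hs
      rw [mem_uIcc] at h1
      rw [mem_Icc, ← abs_le]
      rcases h1 with h1 | h1
      · exact (abs_le.2 h1).trans (le_abs_self _)
      · exact (abs_le.2 (by simpa using h1)).trans (neg_le_abs _)
    rw [mul_comm w]
    refine Tendsto.mul ?_ (hv _ (hy s))
    have h1 : -(Complex.I * k / 2) * (s : ℂ) ^ 2
        = ((-(k * s ^ 2 / 2) : ℝ) : ℂ) * Complex.I := by push_cast; ring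
    rw [h1]
    unfold osc
    exact (Complex.continuous_exp.tendsto _).comp
      (((Complex.continuous_ofReal.tendsto _).comp (hphase s hs').neg).mul_const _)

/-! ### Zeros of `u + ev` and counting of polynomial roots -/

open Polynomial in
theorem rootMultiplicity_le_of_isBigO {r q : ℂ[X]} (hr : r ≠ 0) {ζ : ℂ}
    (h : (fun t => r.eval t) =O[𝓝 ζ] fun t => q.eval t) :
    q.rootMultiplicity ζ ≤ r.rootMultiplicity ζ := by
  by_contra! hlt
  obtain ⟨r₁, hr₁, hr₁n⟩ := exists_eq_pow_rootMultiplicity_mul_and_not_dvd r hr ζ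
  obtain ⟨q₁, hq₁⟩ := pow_rootMultiplicity_dvd q ζ
  set k := r.rootMultiplicity ζ
  set m := q.rootMultiplicity ζ
  obtain ⟨j, hj⟩ : ∃ j, m = k + 1 + j := ⟨m - (k + 1), by omega⟩
  apply hr₁n
  rw [dvd_iff_isRoot, IsRoot]
  obtain ⟨M, hM⟩ := h.bound
  have h1 : ∀ᶠ t in 𝓝[≠] ζ, ‖r₁.eval t‖ ≤ M * ‖(t - ζ) ^ (j + 1) * q₁.eval t‖ := by
    filter_upwards [hM.filter_mono nhdsWithin_le_nhds, self_mem_nhdsWithin] with t ht htn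
    have h0 : 0 < ‖(t - ζ) ^ k‖ := norm_pos_iff.2 (pow_ne_zero _ (sub_ne_zero.2 htn))
    rw [hr₁, hq₁, hj] at ht
    simp only [eval_mul, eval_pow, eval_sub, eval_X, eval_C] at ht
    rw [add_assoc, pow_add, mul_assoc, norm_mul, norm_mul ((t - ζ) ^ k), add_comm 1 j] at ht
    exact le_of_mul_le_mul_left (by linarith) h0
  have h2 : Tendsto (fun t => M * ‖(t - ζ) ^ (j + 1) * q₁.eval t‖) (𝓝[≠] ζ) (𝓝 0) := by
    have : Tendsto (fun t => M * ‖(t - ζ) ^ (j + 1) * q₁.eval t‖) (𝓝 ζ)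
        (𝓝 (M * ‖(ζ - ζ) ^ (j + 1) * q₁.eval ζ‖)) := by
      apply Continuous.tendsto
      fun_prop
    simpa using this.mono_left nhdsWithin_le_nhds
  have h3 : Tendsto (fun t => r₁.eval t) (𝓝[≠] ζ) (𝓝 (r₁.eval ζ)) :=
    (r₁.continuous.tendsto ζ).mono_left nhdsWithin_le_nhds
  exact tendsto_nhds_unique h3 (squeeze_zero_norm' h1 h2)

open Polynomial in
theorem map_conj_map_conj (p : ℂ[X]) :
    (p.map (starRingEnd ℂ)).map (starRingEnd ℂ) = p := by
  rw [Polynomial.map_map]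
  convert Polynomial.map_id
  ext x
  simp

namespace RatData
open Polynomial
variable {u : ℝ → ℝ} (d : RatData u)

/-- The denominator with roots at the poles in the upper half-plane. -/
def den : ℂ[X] := ∏ p, (X - C (d.z p))

/-- The numerator of `∑ a_p / (x - z_p)` over `den`. -/
def num (a : Fin d.P → ℂ) : ℂ[X] := ∑ p, C (a p) * ∏ j ∈ Finset.univ.erase p, (X - C (d.z j))

theorem natDegree_den : d.den.natDegree = d.P := by
  rw [den, natDegree_finsetProd_X_sub_C_eq_card, Finset.card_univ, Fintype.card_fin]

theorem monic_den : d.den.Monic := monic_prod_of_monic _ _ fun _ _ => monic_X_sub_C _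

theorem degree_den : d.den.degree = d.P := by
  rw [degree_eq_natDegree d.monic_den.ne_zero, natDegree_den]

theorem degree_num_lt (a : Fin d.P → ℂ) : (d.num a).degree < d.P := by
  refine (mem_degreeLT (R := ℂ)).1 (Submodule.sum_mem _ fun p _ => mem_degreeLT.2 ?_)
  rw [← smul_eq_C_mul]
  refine (degree_smul_le _ _).trans_lt ?_
  rw [degree_prod]
  simp only [degree_X_sub_C, Finset.sum_const, Finset.card_erase_of_mem (Finset.mem_univ p),
    Finset.card_univ, Fintype.card_fin]
  have := p.pos
  rw [nsmul_one]
  exact_mod_cast Nat.sub_lt this one_pos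

theorem eval_den (ζ : ℂ) : d.den.eval ζ = ∏ p, (ζ - d.z p) := by
  simp [den, eval_prod]

theorem eval_den_ne {ζ : ℂ} (h : ∀ p, ζ ≠ d.z p) : d.den.eval ζ ≠ 0 := by
  rw [eval_den, Finset.prod_ne_zero_iff]
  exact fun p _ => sub_ne_zero.2 (h p)

theorem eval_num {a : Fin d.P → ℂ} {ζ : ℂ} (h : ∀ p, ζ ≠ d.z p) :
    (d.num a).eval ζ = d.den.eval ζ * ∑ p, a p / (ζ - d.z p) := by
  rw [eval_den, num, eval_finsetSum, Finset.mul_sum]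
  refine Finset.sum_congr rfl fun p _ => ?_
  rw [eval_mul, eval_C, eval_prod, ← Finset.mul_prod_erase _ _ (Finset.mem_univ p)]
  have := sub_ne_zero.2 (h p)
  simp only [eval_sub, eval_X, eval_C]
  field_simp

theorem eval_num_pole (a : Fin d.P → ℂ) (p : Fin d.P) :
    (d.num a).eval (d.z p) = a p * ∏ j ∈ Finset.univ.erase p, (d.z p - d.z j) := by
  rw [num, eval_finsetSum, Finset.sum_eq_single p]
  · simp [eval_prod]
  · intro j _ hj
    rw [eval_mul, eval_prod, Finset.prod_eq_zero (Finset.mem_erase.2 ⟨hj.symm, Finset.mem_univ p⟩),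
      mul_zero]
    simp
  · simp

theorem prod_erase_ne (p : Fin d.P) : ∏ j ∈ Finset.univ.erase p, (d.z p - d.z j) ≠ 0 := by
  rw [Finset.prod_ne_zero_iff]
  intro j hj
  exact sub_ne_zero.2 fun h => (Finset.mem_erase.1 hj).1 (d.z_inj h).symm

/-- The numerator of `u + ev`. -/
def char (ev : ℝ) : ℂ[X] :=
  C (ev : ℂ) * (d.den * d.den.map (starRingEnd ℂ)) + (d.num d.c * d.den.map (starRingEnd ℂ)
    + (d.num d.c).map (starRingEnd ℂ) * d.den)

theorem map_char (ev : ℝ) : (d.char ev).map (starRingEnd ℂ) = d.char ev := by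
  simp only [char, Polynomial.map_add, Polynomial.map_mul, map_conj_map_conj, map_C,
    Complex.conj_ofReal]
  ring

/-- Because `u` vanishes at infinity, only the constant `ev` contributes to the leading term. -/
theorem natDegree_char {ev : ℝ} (h : ev ≠ 0) : (d.char ev).natDegree = 2 * d.P := by
  have h0 : (d.den.map (starRingEnd ℂ)).degree = d.P := by
    rw [degree_map, degree_den]
  have h0' : ((d.num d.c).map (starRingEnd ℂ)).degree < d.P := by
    rw [degree_map]; exact d.degree_num_lt _
  have h1 : (C (ev : ℂ) * (d.den * d.den.map (starRingEnd ℂ))).degree = ((2 * d.P : ℕ) : WithBot ℕ) := by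
    rw [degree_C_mul (by exact_mod_cast h), degree_mul, h0, degree_den, two_mul]
    push_cast; rfl
  have h2 : (d.num d.c * d.den.map (starRingEnd ℂ)).degree < ((2 * d.P : ℕ) : WithBot ℕ) := by
    rw [degree_mul, h0, two_mul, Nat.cast_add]
    exact WithBot.add_lt_add_right (by simp) (d.degree_num_lt _)
  have h3 : ((d.num d.c).map (starRingEnd ℂ) * d.den).degree < ((2 * d.P : ℕ) : WithBot ℕ) := by
    rw [degree_mul, degree_den, two_mul, Nat.cast_add]
    exact WithBot.add_lt_add_right (by simp) h0'
  refine natDegree_eq_of_degree_eq_some ?_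
  rw [char, degree_add_eq_left_of_degree_lt, h1]
  rw [h1]
  exact (degree_add_le _ _).trans_lt (max_lt h2 h3)

theorem eval_char {ev : ℝ} {ζ : ℂ} (h : ∀ p, ζ ≠ d.z p) (h' : ∀ p, ζ ≠ (starRingEnd ℂ) (d.z p)) :
    (d.char ev).eval ζ = d.den.eval ζ * (d.den.map (starRingEnd ℂ)).eval ζ * (d.ext ζ + ev) := by
  have h1 : ∀ p : ℂ[X], (p.map (starRingEnd ℂ)).eval ζ
      = (starRingEnd ℂ) (p.eval ((starRingEnd ℂ) ζ)) := fun p => by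
    have := Polynomial.eval_map_apply (starRingEnd ℂ) (p := p) ((starRingEnd ℂ) ζ)
    simpa using this
  have h2 : ∀ p, (starRingEnd ℂ) ζ ≠ d.z p := fun p hp => h' p (by rw [← hp]; simp)
  rw [char]
  simp only [eval_add, eval_mul, eval_C, h1]
  rw [d.eval_num h, d.eval_num h2, ext]
  simp only [map_mul, map_sum, map_div₀, map_sub, Complex.conj_conj]
  ring

theorem ofReal_ne_z (x : ℝ) (p : Fin d.P) : (x : ℂ) ≠ d.z p := fun h => by
  have := d.z_im p; rw [← h] at this; simp at this

theorem ofReal_ne_conj_z (x : ℝ) (p : Fin d.P) : (x : ℂ) ≠ (starRingEnd ℂ) (d.z p) := fun h => by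
  have := d.conj_z_im p; rw [← h] at this; simp at this

theorem ne_conj_z {ζ : ℂ} (h : 0 < ζ.im) (p : Fin d.P) : ζ ≠ (starRingEnd ℂ) (d.z p) := fun h1 => by
  have := d.conj_z_im p; rw [← h1] at this; linarith

theorem eval_den_map_ne {ζ : ℂ} (h' : ∀ p, ζ ≠ (starRingEnd ℂ) (d.z p)) :
    (d.den.map (starRingEnd ℂ)).eval ζ ≠ 0 := by
  have h2 : ∀ p, (starRingEnd ℂ) ζ ≠ d.z p := fun p hp => h' p (by rw [← hp]; simp)
  have := Polynomial.eval_map_apply (starRingEnd ℂ) (p := d.den) ((starRingEnd ℂ) ζ)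
  rw [Complex.conj_conj] at this
  rw [this]
  simpa using d.eval_den_ne h2

/-- Only the residue term at this pole survives, so clearing denominators creates no spurious zero.
-/
theorem eval_char_pole_ne (ev : ℝ) (p : Fin d.P) : (d.char ev).eval (d.z p) ≠ 0 := by
  have h1 : d.den.eval (d.z p) = 0 := by
    rw [eval_den]; exact Finset.prod_eq_zero (Finset.mem_univ p) (sub_self _)
  rw [char]
  simp only [eval_add, eval_mul, h1, zero_mul, mul_zero, add_zero, zero_add]
  rw [eval_num_pole]
  exact mul_ne_zero (mul_ne_zero (d.c_ne p) (d.prod_erase_ne p))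
    (d.eval_den_map_ne (d.ne_conj_z (d.z_im p)))

theorem eval_char_ofReal (ev x : ℝ) : (d.char ev).eval (x : ℂ)
    = d.den.eval (x : ℂ) * (d.den.map (starRingEnd ℂ)).eval (x : ℂ) * (u x + ev : ℝ) := by
  rw [d.eval_char (d.ofReal_ne_z x) (d.ofReal_ne_conj_z x), ← d.ofReal_eq_ext]
  push_cast; rfl

/-- At a real zero of `u + ev` the derivative of the numerator is a nonzero factor times `u'`,
whereas it would vanish at a multiple root. -/
theorem rootMultiplicity_char_le_one {ev x : ℝ} (hev : ev ≠ 0) (hx : u x + ev = 0)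
    (hd : deriv u x ≠ 0) : (d.char ev).rootMultiplicity (x : ℂ) ≤ 1 := by
  have hne : d.char ev ≠ 0 := by
    intro h
    have h1 := d.natDegree_char hev
    rw [h, natDegree_zero] at h1
    have h2 : d.P = 0 := by omega
    have h3 : u x = 0 := by
      have : IsEmpty (Fin d.P) := by rw [h2]; infer_instance
      have := d.eq x
      simpa using this
    exact hev (by linarith)
  by_contra! hlt
  obtain ⟨-, h1⟩ := (one_lt_rootMultiplicity_iff_isRoot hne).1 hlt
  set m : ℝ → ℂ := fun x => d.den.eval (x : ℂ) * (d.den.map (starRingEnd ℂ)).eval (x : ℂ) with hm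
  have hmd : ∀ p : ℂ[X], HasDerivAt (fun t : ℝ => p.eval (t : ℂ)) (p.derivative.eval (x : ℂ)) x :=
    fun p => (p.hasDerivAt (x : ℂ)).comp_ofReal
  have h2 := hmd (d.char ev)
  have h3 : HasDerivAt (fun t : ℝ => (d.char ev).eval (t : ℂ)) (m x * (deriv u x : ℝ)) x := by
    simp_rw [d.eval_char_ofReal]
    have h4 := ((hmd d.den).fun_mul (hmd (d.den.map (starRingEnd ℂ)))).fun_mul
      (((d.hasDerivAt_u x).add_const ev).ofReal_comp)
    refine h4.congr_deriv ?_
    rw [hx, (d.hasDerivAt_u x).deriv]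
    simp [hm]
  rw [IsRoot, h2.unique h3, mul_eq_zero] at h1
  rcases h1 with h1 | h1
  · exact (mul_ne_zero (d.eval_den_ne (d.ofReal_ne_z x))
      (d.eval_den_map_ne (d.ofReal_ne_conj_z x))) h1
  · exact hd (by exact_mod_cast h1)

end RatData

namespace KS
open Polynomial
variable {u : ℝ → ℝ} (S : KS u)

theorem ne_zero_of_mem_bulk (S : KS u) {ev : ℝ} (h : ev ∈ bulk u) : ev ≠ 0 := by
  rw [S.bulk_eq] at h; exact h.2.ne

/-- A polynomial of degree at most `P` that vanishes at the turning points and at the zeros of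
`u + ev` in the upper half-plane is zero. -/
theorem eq_zero_of_vanish {ev : ℝ} (hev : ev ∈ bulk u) {r : ℂ[X]} (hdeg : r.natDegree ≤ S.P)
    (h1 : r.eval (xMinus u ev : ℂ) = 0) (h2 : r.eval (xPlus u ev : ℂ) = 0)
    (hO : ∀ ζ : ℂ, 0 < ζ.im → (∀ p, ζ ≠ S.z p) →
      (fun t => r.eval t) =O[𝓝 ζ] fun t => S.ext t + ev) : r = 0 := by
  by_contra hr
  have hev0 := S.ne_zero_of_mem_bulk hev
  set q := S.char ev with hq
  have hq0 : q ≠ 0 := by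
    intro h
    have h3 := S.natDegree_char hev0
    rw [← hq, h, natDegree_zero] at h3
    rw [show S.P = 0 by omega, Nat.le_zero, natDegree_eq_zero] at hdeg
    obtain ⟨x, rfl⟩ := hdeg
    rw [eval_C] at h1
    exact hr (by rw [h1, C_0])
  set r' := r.map (starRingEnd ℂ) with hr'
  have hr'0 : r' ≠ 0 := (Polynomial.map_ne_zero_iff (starRingEnd ℂ).injective).2 hr
  have hconj : ∀ (p : ℂ[X]) (ζ : ℂ), (p.map (starRingEnd ℂ)).rootMultiplicity ζ
      = p.rootMultiplicity ((starRingEnd ℂ) ζ) := fun p ζ => by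
    have := eq_rootMultiplicity_map (p := p) (starRingEnd ℂ).injective ((starRingEnd ℂ) ζ)
    rw [this, Complex.conj_conj]
  have hup : ∀ ζ : ℂ, 0 < ζ.im → q.rootMultiplicity ζ ≤ r.rootMultiplicity ζ := by
    intro ζ hζ
    by_cases hp : ∀ p, ζ ≠ S.z p
    · refine rootMultiplicity_le_of_isBigO hr ((hO ζ hζ hp).trans ?_)
      have hc : ContinuousAt (fun t => (S.den.eval t * (S.den.map (starRingEnd ℂ)).eval t)⁻¹) ζ :=
        ContinuousAt.inv₀ (by fun_prop)
          (mul_ne_zero (S.eval_den_ne hp) (S.eval_den_map_ne (S.ne_conj_z hζ)))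
      have h3 := (hc.isBigO).mul (isBigO_refl (fun t => q.eval t) (𝓝 ζ))
      have h4 : (fun t => (S.den.eval t * (S.den.map (starRingEnd ℂ)).eval t)⁻¹ * q.eval t)
          =ᶠ[𝓝 ζ] fun t => S.ext t + ev := by
        have h5 : ∀ᶠ t in 𝓝 ζ, ∀ p, t ≠ S.z p :=
          eventually_all.2 fun p => isOpen_ne.mem_nhds (hp p)
        filter_upwards [h5, (isOpen_lt continuous_const Complex.continuous_im).mem_nhds hζ]
          with t ht ht'
        rw [hq, S.eval_char ht (S.ne_conj_z ht'), inv_mul_cancel_left₀]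
        exact mul_ne_zero (S.eval_den_ne ht) (S.eval_den_map_ne (S.ne_conj_z ht'))
      refine (h3.congr' h4 EventuallyEq.rfl).trans ?_
      simpa using (isBigO_refl (fun t => q.eval t) (𝓝 ζ))
    · push Not at hp
      obtain ⟨p, rfl⟩ := hp
      rw [rootMultiplicity_eq_zero (S.eval_char_pole_ne ev p)]
      exact Nat.zero_le _
  set l : ℂ[X] := (X - C (xMinus u ev : ℂ)) * (X - C (xPlus u ev : ℂ)) with hl
  have hl0 : l ≠ 0 := mul_ne_zero (X_sub_C_ne_zero _) (X_sub_C_ne_zero _)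
  have hx : (xMinus u ev : ℂ) ≠ xPlus u ev := by
    exact_mod_cast (S.xMinus_lt_xPlus hev).ne
  -- Inclusion with multiplicity. Off the real axis the zeros of `q` are covered by `r` above and by
  -- its conjugate `r'` below. At a turning point `q` has at most a simple zero and `l` has one,
  -- matched by one zero each of `r` and `r'`. Comparing degrees gives `2P + 2 ≤ 2 deg r ≤ 2P`,
  -- which is absurd.
  have hle : (q * l).roots ≤ (r * r').roots := by
    rw [Multiset.le_iff_count]
    intro ζ
    rw [count_roots, count_roots, rootMultiplicity_mul (mul_ne_zero hq0 hl0),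
      rootMultiplicity_mul (mul_ne_zero hr hr'0), hl, rootMultiplicity_mul hl0,
      rootMultiplicity_X_sub_C, rootMultiplicity_X_sub_C]
    have hnr : ∀ x : ℝ, ζ.im ≠ 0 → ζ ≠ (x : ℂ) := fun x h3 h4 => h3 (by rw [h4]; simp)
    rcases lt_trichotomy ζ.im 0 with h3 | h3 | h3
    · rw [if_neg (hnr _ h3.ne), if_neg (hnr _ h3.ne), hr', hconj]
      have h4 : q.rootMultiplicity ζ = q.rootMultiplicity ((starRingEnd ℂ) ζ) := by
        rw [← hconj, hq, S.map_char]
      have := hup ((starRingEnd ℂ) ζ) (by simpa using h3)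
      omega
    · obtain ⟨x, rfl⟩ : ∃ x : ℝ, ζ = x := ⟨ζ.re, Complex.ext (by simp) (by simpa using h3)⟩
      have h6 : r'.rootMultiplicity (x : ℂ) = r.rootMultiplicity (x : ℂ) := by
        rw [hr', hconj, Complex.conj_ofReal]
      have hpos : ∀ y : ℝ, r.eval (y : ℂ) = 0 → 1 ≤ r.rootMultiplicity (y : ℂ) := fun y hy =>
        (rootMultiplicity_pos hr).2 hy
      rw [h6]
      by_cases h4 : (x : ℂ) = xMinus u ev
      · have h5 : x = xMinus u ev := by exact_mod_cast h4
        rw [if_pos h4, if_neg (h4 ▸ hx)]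
        have h7 := S.rootMultiplicity_char_le_one hev0 (x := x)
          (by rw [h5, S.u_xMinus hev]; ring) (by rw [h5]; exact S.deriv_xMinus_ne hev)
        rw [← hq] at h7
        have := hpos x (by rw [h4]; exact h1)
        omega
      by_cases h4' : (x : ℂ) = xPlus u ev
      · have h5 : x = xPlus u ev := by exact_mod_cast h4'
        rw [if_pos h4', if_neg h4]
        have h7 := S.rootMultiplicity_char_le_one hev0 (x := x)
          (by rw [h5, S.u_xPlus hev]; ring) (by rw [h5]; exact S.deriv_xPlus_ne hev)
        rw [← hq] at h7
        have := hpos x (by rw [h4']; exact h2)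
        omega
      rw [if_neg h4, if_neg h4', rootMultiplicity_eq_zero]
      · omega
      rw [IsRoot, hq, S.eval_char_ofReal]
      refine mul_ne_zero (mul_ne_zero (S.eval_den_ne (S.ofReal_ne_z x))
        (S.eval_den_map_ne (S.ofReal_ne_conj_z x))) ?_
      norm_cast at h4 h4' ⊢
      rcases lt_or_gt_of_ne h4 with h5 | h5
      · exact (S.u_add_neg_left hev h5).ne
      rcases lt_or_gt_of_ne h4' with h8 | h8
      · exact (S.u_add_pos hev h5 h8).ne'
      · exact (S.u_add_neg_right hev h8).ne
    · rw [if_neg (hnr _ h3.ne'), if_neg (hnr _ h3.ne')]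
      have := hup ζ h3
      omega
  have hcard := Multiset.card_le_card hle
  rw [← (IsAlgClosed.splits (q * l)).natDegree_eq_card_roots,
    ← (IsAlgClosed.splits (r * r')).natDegree_eq_card_roots, natDegree_mul hq0 hl0,
    natDegree_mul hr hr'0, hr', natDegree_map, hl,
    natDegree_mul (X_sub_C_ne_zero _) (X_sub_C_ne_zero _), natDegree_X_sub_C, natDegree_X_sub_C,
    hq, S.natDegree_char hev0] at hcard
  omega

theorem natDegree_num_le (a : Fin S.P → ℂ) : (S.num a).natDegree + 1 ≤ S.P ∨ S.num a = 0 := by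
  by_cases h : S.num a = 0
  · exact Or.inr h
  · have := S.degree_num_lt a
    rw [degree_eq_natDegree h] at this
    exact Or.inl (by exact_mod_cast this)

theorem eq_zero_of_num_eq_zero {a : Fin S.P → ℂ} (h : S.num a = 0) : a = 0 := by
  funext p
  have := S.eval_num_pole a p
  rw [h, eval_zero, eq_comm, mul_eq_zero] at this
  exact this.resolve_right (S.prod_erase_ne p)

/-- Multiplied by `den * (x + i)`, the source becomes a polynomial of degree at most `P`, which `P -
1` zeros above the axis and two turning points force to vanish. Evaluation at `-i` then isolates
`κ`, and evaluation at the poles the coefficients. -/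
theorem src_eq_zero {ev : ℝ} (hev : ev ∈ bulk u) {a : Fin S.P → ℂ} {κ : ℂ}
    (h1 : S.src a κ (xMinus u ev) = 0) (h2 : S.src a κ (xPlus u ev) = 0)
    (hO : ∀ ζ : ℂ, 0 < ζ.im → (∀ p, ζ ≠ S.z p) →
      (fun t => S.src a κ t) =O[𝓝 ζ] fun t => S.ext t + ev) : a = 0 ∧ κ = 0 := by
  set r : ℂ[X] := S.num a * (X + C Complex.I) - C κ * S.den with hr
  have hI : ∀ ζ : ℂ, 0 ≤ ζ.im → ζ + Complex.I ≠ 0 := fun ζ h h' => by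
    have := congrArg Complex.im h'; simp at this; linarith
  have heval : ∀ ζ : ℂ, 0 ≤ ζ.im → (∀ p, ζ ≠ S.z p) →
      r.eval ζ = S.den.eval ζ * (ζ + Complex.I) * S.src a κ ζ := fun ζ h h' => by
    rw [hr]
    simp only [eval_sub, eval_mul, eval_add, eval_X, eval_C]
    rw [S.eval_num h', RatData.src]
    have := hI ζ h
    field_simp
  have hr0 : r = 0 := by
    refine S.eq_zero_of_vanish hev ?_ ?_ ?_ ?_
    · refine (natDegree_sub_le _ _).trans (max_le ?_ ?_)
      · rcases S.natDegree_num_le a with h | h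
        · exact natDegree_mul_le.trans (by rw [natDegree_X_add_C]; exact h)
        · simp [h]
      · exact (natDegree_C_mul_le _ _).trans S.natDegree_den.le
    · rw [heval _ (by simp) (S.ofReal_ne_z _), h1, mul_zero]
    · rw [heval _ (by simp) (S.ofReal_ne_z _), h2, mul_zero]
    · intro ζ hζ hp
      have hc : ContinuousAt (fun t => S.den.eval t * (t + Complex.I)) ζ := by fun_prop
      have h3 := (hc.isBigO).mul (hO ζ hζ hp)
      have h4 : (fun t => S.den.eval t * (t + Complex.I) * S.src a κ t)
          =ᶠ[𝓝 ζ] fun t => r.eval t := by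
        have h5 : ∀ᶠ t in 𝓝 ζ, ∀ p, t ≠ S.z p :=
          eventually_all.2 fun p => isOpen_ne.mem_nhds (hp p)
        filter_upwards [h5, (isOpen_lt continuous_const Complex.continuous_im).mem_nhds hζ]
          with t ht ht'
        rw [heval t (le_of_lt ht') ht]
      simpa using h3.congr' h4 EventuallyEq.rfl
  have hκ : κ = 0 := by
    have h3 : r.eval (-Complex.I) = 0 := by rw [hr0, eval_zero]
    rw [hr] at h3
    simp only [eval_sub, eval_mul, eval_add, eval_X, eval_C, neg_add_cancel, mul_zero, zero_sub,
      neg_eq_zero, mul_eq_zero] at h3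
    refine h3.resolve_right (S.eval_den_ne fun p hp => ?_)
    have := S.z_im p
    rw [← hp] at this
    simp at this
    linarith
  refine ⟨S.eq_zero_of_num_eq_zero ?_, hκ⟩
  rw [hr, hκ, C_0, zero_mul, sub_zero, mul_eq_zero] at hr0
  exact hr0.resolve_right (X_add_C_ne_zero _)

/-- Without the `κ` term the numerator has degree at most `P - 1`. This leaves room for the factor
`x - x₊`, which supplies the missing zero. -/
theorem src_eq_zero_of_left {ev : ℝ} (hev : ev ∈ bulk u) {a : Fin S.P → ℂ}
    (h1 : S.src a 0 (xMinus u ev) = 0)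
    (hO : ∀ ζ : ℂ, 0 < ζ.im → (∀ p, ζ ≠ S.z p) →
      (fun t => S.src a 0 t) =O[𝓝 ζ] fun t => S.ext t + ev) : a = 0 := by
  set r : ℂ[X] := S.num a * (X - C (xPlus u ev : ℂ)) with hr
  have heval : ∀ ζ : ℂ, (∀ p, ζ ≠ S.z p) →
      r.eval ζ = S.den.eval ζ * (ζ - xPlus u ev) * S.src a 0 ζ := fun ζ h' => by
    rw [hr]
    simp only [eval_sub, eval_mul, eval_X, eval_C]
    rw [S.eval_num h', RatData.src]
    ring
  have hr0 : r = 0 := by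
    refine S.eq_zero_of_vanish hev ?_ ?_ ?_ ?_
    · rcases S.natDegree_num_le a with h | h
      · exact natDegree_mul_le.trans (by rw [natDegree_X_sub_C]; exact h)
      · simp [hr, h]
    · rw [heval _ (S.ofReal_ne_z _), h1, mul_zero]
    · rw [heval _ (S.ofReal_ne_z _), sub_self, mul_zero, zero_mul]
    · intro ζ hζ hp
      have hc : ContinuousAt (fun t => S.den.eval t * (t - xPlus u ev)) ζ := by fun_prop
      have h3 := (hc.isBigO).mul (hO ζ hζ hp)
      have h4 : (fun t => S.den.eval t * (t - xPlus u ev) * S.src a 0 t)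
          =ᶠ[𝓝 ζ] fun t => r.eval t := by
        have h5 : ∀ᶠ t in 𝓝 ζ, ∀ p, t ≠ S.z p :=
          eventually_all.2 fun p => isOpen_ne.mem_nhds (hp p)
        filter_upwards [h5] with t ht
        rw [heval t ht]
      simpa using h3.congr' h4 EventuallyEq.rfl
  refine S.eq_zero_of_num_eq_zero ?_
  rw [hr, mul_eq_zero] at hr0
  exact hr0.resolve_right (X_sub_C_ne_zero _)

end KS

/-- A primitive of `u + lam`. -/
def phase (u : ℝ → ℝ) (lam x : ℝ) : ℝ := ∫ t in (0 : ℝ)..x, (u t + lam)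

/-! ### Phase estimates uniform in the level -/

theorem hasDerivAt_phase {u : ℝ → ℝ} (hu : Continuous u) (lam x : ℝ) :
    HasDerivAt (phase u lam) (u x + lam) x := by
  have hc : Continuous fun t => u t + lam := hu.add continuous_const
  exact intervalIntegral.integral_hasDerivAt_right (hc.intervalIntegrable _ _)
    (hc.stronglyMeasurableAtFilter _ _) hc.continuousAt

theorem phase_sub_phase {u : ℝ → ℝ} (hu : Continuous u) (lam x y : ℝ) :
    phase u lam y - phase u lam x = ∫ t in x..y, (u t + lam) := by
  have hc : Continuous fun t => u t + lam := hu.add continuous_const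
  exact intervalIntegral.integral_interval_sub_left (hc.intervalIntegrable _ _)
    (hc.intervalIntegrable _ _)

/-- The first-order lower bound at a simple root, uniformly in the level. -/
theorem exists_root_bound {u ρ : ℝ → ℝ} {ev k : ℝ} {T : Set ℝ} (hk : k ≠ 0)
    (hρ : ContinuousAt ρ ev) (hroot : ∀ᶠ t in 𝓝 ev, u (ρ t) = -t)
    (hd : HasStrictDerivAt u k (ρ ev))
    (hT : ∀ δ, 0 < δ → ∃ c, 0 < c ∧ ∀ x ∈ T, δ ≤ |x - ρ ev| → c ≤ |u x + ev|) :
    ∃ C, 0 < C ∧ ∀ᶠ t in 𝓝 ev, ∀ x ∈ T, |x - ρ t| ≤ C * ((1 + |x|) * |u x + t|) := by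
  have hk2 : 0 < |k| / 2 := by positivity
  obtain ⟨δ, hδ, h2⟩ := Metric.eventually_nhds_iff.1 (hd.hasStrictFDerivAt.isLittleO.def hk2)
  obtain ⟨c, hc, hcT⟩ := hT δ hδ
  refine ⟨2 / |k| + (2 / c) * (|ρ ev| + δ + 1), by positivity, ?_⟩
  filter_upwards [hroot, hρ.eventually (Metric.ball_mem_nhds _ hδ),
    Metric.ball_mem_nhds ev (show 0 < c / 2 by positivity)] with t ht1 ht2 ht3 x hx
  have h0 : 0 ≤ |u x + t| := abs_nonneg _
  have h0' : 0 ≤ |x| := abs_nonneg _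
  rw [Real.dist_eq] at ht2
  rw [Metric.mem_ball, Real.dist_eq] at ht3
  -- Close to the root strict differentiability controls the quotient uniformly in the level. Away
  -- from it `|u + t|` is bounded below, and the weight `1 + |x|` absorbs the growth of the
  -- distance.
  rcases lt_or_ge |x - ρ ev| δ with hxδ | hxδ
  · have h3 := @h2 (x, ρ t) (by
      rw [Prod.dist_eq]; exact max_lt (by rwa [Real.dist_eq]) (by rwa [Real.dist_eq]))
    simp only [ContinuousLinearMap.toSpanSingleton_apply, smul_eq_mul, ht1, sub_neg_eq_add,
      Real.norm_eq_abs] at h3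
    have h4 : |k| * |x - ρ t| ≤ |u x + t| + |u x + t - (x - ρ t) * k| := by
      rw [← abs_mul]
      calc |k * (x - ρ t)| = |(u x + t) - (u x + t - (x - ρ t) * k)| := by congr 1; ring
        _ ≤ _ := abs_sub _ _
    have h5 : |x - ρ t| ≤ 2 / |k| * |u x + t| := by
      rw [div_mul_eq_mul_div, le_div_iff₀ (by positivity)]
      linarith
    refine h5.trans ?_
    have h6 : 0 ≤ 2 / |k| := by positivity
    have h7 : 0 ≤ (2 / c) * (|ρ ev| + δ + 1) := by positivity
    have h8 : |u x + t| ≤ (1 + |x|) * |u x + t| := le_mul_of_one_le_left h0 (by linarith)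
    nlinarith [mul_le_mul_of_nonneg_left h8 h6, mul_nonneg h7 (mul_nonneg (by linarith : 0 ≤ 1 + |x|) h0)]
  · have h3 := hcT x hx hxδ
    have h4 : c / 2 ≤ |u x + t| := by
      have : |u x + ev| ≤ |u x + t| + |t - ev| := by
        calc |u x + ev| = |(u x + t) - (t - ev)| := by congr 1; ring
          _ ≤ _ := abs_sub _ _
      linarith
    have h5 : |x - ρ t| ≤ (|ρ ev| + δ + 1) * (1 + |x|) := by
      have h6 : |x - ρ t| ≤ |x| + |ρ t - ρ ev| + |ρ ev| := by
        calc |x - ρ t| = |x - (ρ t - ρ ev) - ρ ev| := by congr 1; ring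
          _ ≤ |x - (ρ t - ρ ev)| + |ρ ev| := abs_sub _ _
          _ ≤ _ := by linarith [abs_sub x (ρ t - ρ ev)]
      nlinarith [abs_nonneg (ρ ev), mul_nonneg (abs_nonneg (ρ ev)) h0', mul_nonneg hδ.le h0']
    have h6 : (1 : ℝ) ≤ 2 / c * |u x + t| := by
      rw [div_mul_eq_mul_div, le_div_iff₀ hc]; linarith
    have h7 : 0 ≤ (|ρ ev| + δ + 1) * (1 + |x|) := by positivity
    have h8 := mul_le_mul_of_nonneg_left h6 h7
    have h9 : 0 ≤ 2 / |k| * ((1 + |x|) * |u x + t|) := by positivity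
    nlinarith

/-- The decay of the source, of its derivative and of `u'` pays for the weight `1 + |x|` in the root
bound, so nonstationary phase applies even on unbounded regions. The constant does not depend on
`ε`, on the level or on the source, only on the bounds assumed for them. -/
theorem norm_sub_le_of_root_bound {u : ℝ → ℝ} (d : RatData u) {C M : ℝ} (hC : 0 ≤ C)
    (hM : 0 ≤ M) {lo hi : ℝ} :
    ∃ B, 0 ≤ B ∧ ∀ lam ∈ Icc lo hi, ∀ x₀ : ℝ, ∀ T : Set ℝ, ∀ ε > 0,
      ∀ (a : Fin d.P → ℂ) (κ : ℂ), ‖a‖ ≤ M → ‖κ‖ ≤ M → ∀ g : ℝ → ℂ,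
      (∀ x, HasDerivAt g (osc ε (phase u lam x) * d.src a κ x) x) →
      (∀ x ∈ T, |x - x₀| ≤ C * ((1 + |x|) * |u x + lam|)) →
      ∀ δ > 0, ∀ p q, p ≤ q → Icc p q ⊆ T → (x₀ + δ ≤ p ∨ q ≤ x₀ - δ) →
        ‖g q - g p‖ ≤ B * ε / δ := by
  obtain ⟨K, hK0, hK⟩ := d.exists_src_bound
  obtain ⟨D, hD0, hD⟩ := d.exists_abs_deriv_le
  obtain ⟨D', hD0', hD'⟩ := d.exists_abs_le
  set W := D' + (|lo| + |hi|) with hW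
  have hW0 : 0 ≤ W := by positivity
  set B := K * M * C + K * M * C ^ 2 * (W + D) with hB
  have hB0 : 0 ≤ B := by positivity
  refine ⟨3 * B, by positivity, fun lam hlam x₀ T ε hε a κ ha hκ g hg hb δ hδ p q hpq hT hx₀ => ?_⟩
  have hKb := hK M a κ ha hκ
  have hne : ∀ x ∈ Icc p q, u x + lam ≠ 0 := fun x hx h => by
    have h1 := hb x (hT hx)
    rw [h, abs_zero, mul_zero, mul_zero] at h1
    have h2 : x = x₀ := sub_eq_zero.1 (abs_nonpos_iff.1 h1)
    rcases hx₀ with h3 | h3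
    · linarith [hx.1]
    · linarith [hx.2]
  have hW1 : ∀ x, |u x + lam| ≤ W := fun x => by
    have h1 : |u x| ≤ D' := (hD' x).trans (div_le_self hD0'.le (by linarith [abs_nonneg x]))
    have h2 : |lam| ≤ |lo| + |hi| := by
      refine abs_le.2 ⟨?_, ?_⟩
      · linarith [hlam.1, neg_abs_le lo, abs_nonneg hi]
      · linarith [hlam.2, le_abs_self hi, abs_nonneg lo]
    exact (abs_add_le _ _).trans (add_le_add h1 h2)
  refine norm_sub_le_of_nonstationary (x₀ := x₀) (φ := phase u lam) (ω := fun x => u x + lam)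
    (ω' := deriv u) (v := fun x => d.src a κ x) (v' := d.dsrc a κ) hε hB0 hδ hpq hx₀
    (hasDerivAt_phase d.continuous_u lam) (fun x => ?_) (d.hasDerivAt_src a κ) hg hne
    (fun x hx => ?_) (fun x hx => ?_)
  · have := (d.hasDerivAt_u x).add_const lam
    rwa [← (d.hasDerivAt_u x).deriv] at this
  · have hx1 : 0 < 1 + |x| := by positivity
    calc ‖d.src a κ x‖ * |x - x₀|
        ≤ (K * M / (1 + |x|)) * (C * ((1 + |x|) * |u x + lam|)) :=
          mul_le_mul (hKb x).1 (hb x (hT hx)) (abs_nonneg _) (by positivity)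
      _ = K * M * C * |u x + lam| := by field_simp
      _ ≤ B * |u x + lam| := by
        refine mul_le_mul_of_nonneg_right ?_ (abs_nonneg _)
        rw [hB]
        exact le_add_of_nonneg_right (by positivity)
  · have hx1 : 0 < 1 + |x| := by positivity
    have h1 : (x - x₀) ^ 2 ≤ (C * ((1 + |x|) * |u x + lam|)) ^ 2 := by
      rw [← sq_abs (x - x₀)]
      exact pow_le_pow_left₀ (abs_nonneg _) (hb x (hT hx)) 2
    have h2 : ‖d.dsrc a κ x‖ * |u x + lam| + ‖d.src a κ x‖ * |deriv u x|
        ≤ K * M * (W + D) / (1 + |x|) ^ 2 := by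
      have h3 : ‖d.dsrc a κ x‖ * |u x + lam| ≤ K * M / (1 + |x|) ^ 2 * W :=
        mul_le_mul (hKb x).2 (hW1 x) (abs_nonneg _) (by positivity)
      have h4 : ‖d.src a κ x‖ * |deriv u x| ≤ K * M * (D / (1 + |x|) ^ 2) :=
        mul_le_mul ((hKb x).1.trans (div_le_self (by positivity) (by linarith [abs_nonneg x])))
          (hD x) (abs_nonneg _) (by positivity)
      calc _ ≤ _ := add_le_add h3 h4
        _ = _ := by ring
    calc _ ≤ K * M * (W + D) / (1 + |x|) ^ 2 * (C * ((1 + |x|) * |u x + lam|)) ^ 2 :=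
          mul_le_mul h2 h1 (sq_nonneg _) (by positivity)
      _ = K * M * C ^ 2 * (W + D) * |u x + lam| ^ 2 := by field_simp
      _ = K * M * C ^ 2 * (W + D) * (u x + lam) ^ 2 := by rw [sq_abs]
      _ ≤ B * (u x + lam) ^ 2 := by
        refine mul_le_mul_of_nonneg_right ?_ (sq_nonneg _)
        rw [hB]
        exact le_add_of_nonneg_left (by positivity)

/-- This replaces a boundary condition at infinity: every half-line contains points where a square
integrable solution is as small as desired. -/
theorem exists_norm_lt_of_memLp {F : ℝ → ℂ} (hF : MemLp F 2 volume) {s : Set ℝ}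
    (hsm : MeasurableSet s) (hs : volume s = ⊤) {η : ℝ} (hη : 0 < η) : ∃ y ∈ s, ‖F y‖ < η := by
  by_contra! h
  have h1 : Integrable (fun x => ‖F x‖ ^ 2) := (memLp_two_iff_integrable_sq_norm hF.1).1 hF
  have h2 : Integrable (fun _ : ℝ => η ^ 2) (volume.restrict s) := by
    refine h1.restrict.mono' aestronglyMeasurable_const ?_
    refine (ae_restrict_iff' hsm).2 (ae_of_all _ fun x hx => ?_)
    rw [Real.norm_of_nonneg (by positivity)]
    exact pow_le_pow_left₀ hη.le (h x hx) 2
  rw [integrable_const_iff] at h2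
  rcases h2 with h2 | h2
  · exact (pow_ne_zero 2 hη.ne') h2
  · have := h2.measure_univ_lt_top
    rw [Measure.restrict_apply_univ, hs] at this
    exact lt_irrefl _ this

namespace KS
variable {u : ℝ → ℝ} (S : KS u)

theorem hasStrictDerivAt_u (S : KS u) (x : ℝ) : HasStrictDerivAt u (deriv u x) x := by
  refine hasStrictDerivAt_of_hasDerivAt_of_continuousAt (f' := deriv u) ?_
    S.toRatData.continuous_deriv_u.continuousAt
  refine Eventually.of_forall fun y => ?_
  rw [(S.hasDerivAt_u y).deriv]
  exact S.hasDerivAt_u y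

/-- On this side of the critical point there is one root and `u` is monotone, so away from the root
`|u + ev|` is bounded below by its values at distance `δ`. If the right-hand comparison point passes
the critical point, only the left one is needed. -/
theorem exists_bound_xMinus {ev : ℝ} (h : ev ∈ bulk u) : ∃ C, 0 < C ∧ ∀ᶠ t in 𝓝 ev,
    ∀ x ∈ Iic S.xc, |x - xMinus u t| ≤ C * ((1 + |x|) * |u x + t|) := by
  refine exists_root_bound (S.deriv_xMinus_ne h) (S.continuousAt_xMinus h) ?_
    (S.hasStrictDerivAt_u _) fun δ hδ => ?_
  · filter_upwards [isOpen_bulk.mem_nhds h] with t ht using S.u_xMinus ht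
  set x₀ := xMinus u ev
  have h1 : u (x₀ - δ) + ev < 0 := S.u_add_neg_left h (by linarith)
  have h3 : ∀ x ∈ Iic S.xc, x ≤ x₀ - δ → -(u (x₀ - δ) + ev) ≤ |u x + ev| := fun x hx hx1 => by
    have := S.mono.monotoneOn hx (by linarith [S.xMinus_lt h] : x₀ - δ ≤ S.xc) hx1
    exact (by linarith : _ ≤ -(u x + ev)).trans (neg_le_abs _)
  by_cases h4 : x₀ + δ ≤ S.xc
  · have h2 : 0 < u (x₀ + δ) + ev := S.u_add_pos h (by linarith) (h4.trans_lt (S.lt_xPlus h))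
    refine ⟨min (-(u (x₀ - δ) + ev)) (u (x₀ + δ) + ev), lt_min (by linarith) h2,
      fun x hx hxδ => ?_⟩
    rcases le_abs.1 hxδ with h5 | h5
    · have := S.mono.monotoneOn h4 hx (by linarith : x₀ + δ ≤ x)
      exact (min_le_right _ _).trans ((by linarith : _ ≤ u x + ev).trans (le_abs_self _))
    · exact (min_le_left _ _).trans (h3 x hx (by linarith))
  · refine ⟨-(u (x₀ - δ) + ev), by linarith, fun x hx hxδ => ?_⟩
    rcases le_abs.1 hxδ with h5 | h5
    · exact absurd (mem_Iic.1 hx) (by linarith)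
    · exact h3 x hx (by linarith)

theorem exists_bound_xPlus {ev : ℝ} (h : ev ∈ bulk u) : ∃ C, 0 < C ∧ ∀ᶠ t in 𝓝 ev,
    ∀ x ∈ Ici S.xc, |x - xPlus u t| ≤ C * ((1 + |x|) * |u x + t|) := by
  refine exists_root_bound (S.deriv_xPlus_ne h) (S.continuousAt_xPlus h) ?_
    (S.hasStrictDerivAt_u _) fun δ hδ => ?_
  · filter_upwards [isOpen_bulk.mem_nhds h] with t ht using S.u_xPlus ht
  set x₀ := xPlus u ev
  have h1 : u (x₀ + δ) + ev < 0 := S.u_add_neg_right h (by linarith)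
  have h3 : ∀ x ∈ Ici S.xc, x₀ + δ ≤ x → -(u (x₀ + δ) + ev) ≤ |u x + ev| := fun x hx hx1 => by
    have := S.anti.antitoneOn (by linarith [S.lt_xPlus h] : S.xc ≤ x₀ + δ) hx hx1
    exact (by linarith : _ ≤ -(u x + ev)).trans (neg_le_abs _)
  by_cases h4 : S.xc ≤ x₀ - δ
  · have h2 : 0 < u (x₀ - δ) + ev := S.u_add_pos h ((S.xMinus_lt h).trans_le h4) (by linarith)
    refine ⟨min (-(u (x₀ + δ) + ev)) (u (x₀ - δ) + ev), lt_min (by linarith) h2,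
      fun x hx hxδ => ?_⟩
    rcases le_abs.1 hxδ with h5 | h5
    · exact (min_le_left _ _).trans (h3 x hx (by linarith))
    · have := S.anti.antitoneOn hx h4 (by linarith : x ≤ x₀ - δ)
      exact (min_le_right _ _).trans ((by linarith : _ ≤ u x + ev).trans (le_abs_self _))
  · refine ⟨-(u (x₀ + δ) + ev), by linarith, fun x hx hxδ => ?_⟩
    rcases le_abs.1 hxδ with h5 | h5
    · exact h3 x hx (by linarith)
    · exact absurd (mem_Ici.1 hx) (by linarith)

/-- The estimates away from the turning points, uniformly for levels near `ev` and for bounded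
sources. -/
structure PhaseBound (lam M B : ℝ) : Prop where
  left : ∀ ε > 0, ∀ (a : Fin S.P → ℂ) (κ : ℂ), ‖a‖ ≤ M → ‖κ‖ ≤ M → ∀ g : ℝ → ℂ,
    (∀ x, HasDerivAt g (osc ε (phase u lam x) * S.src a κ x) x) →
    ∀ δ > 0, ∀ p q, p ≤ q → q ≤ S.xc → (xMinus u lam + δ ≤ p ∨ q ≤ xMinus u lam - δ) →
      ‖g q - g p‖ ≤ B * ε / δ
  right : ∀ ε > 0, ∀ (a : Fin S.P → ℂ) (κ : ℂ), ‖a‖ ≤ M → ‖κ‖ ≤ M → ∀ g : ℝ → ℂ,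
    (∀ x, HasDerivAt g (osc ε (phase u lam x) * S.src a κ x) x) →
    ∀ δ > 0, ∀ p q, p ≤ q → S.xc ≤ p → (xPlus u lam + δ ≤ p ∨ q ≤ xPlus u lam - δ) →
      ‖g q - g p‖ ≤ B * ε / δ
  trivial : ∀ ε > 0, ∀ (a : Fin S.P → ℂ) (κ : ℂ), ‖a‖ ≤ M → ‖κ‖ ≤ M → ∀ g : ℝ → ℂ,
    (∀ x, HasDerivAt g (osc ε (phase u lam x) * S.src a κ x) x) →
    ∀ p q, p ≤ q → ‖g q - g p‖ ≤ B * (q - p)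

theorem exists_phaseBound {ev : ℝ} (h : ev ∈ bulk u) {M : ℝ} (hM : 0 ≤ M) :
    ∃ B, 0 < B ∧ ∀ᶠ t in 𝓝 ev, S.PhaseBound t M B := by
  obtain ⟨C, hC0, hC⟩ := S.exists_bound_xMinus h
  obtain ⟨C', hC0', hC'⟩ := S.exists_bound_xPlus h
  obtain ⟨B, hB0, hB⟩ := norm_sub_le_of_root_bound S.toRatData hC0.le hM (lo := ev - 1)
    (hi := ev + 1)
  obtain ⟨B', hB0', hB'⟩ := norm_sub_le_of_root_bound S.toRatData hC0'.le hM (lo := ev - 1)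
    (hi := ev + 1)
  obtain ⟨K, hK0, hK⟩ := S.exists_src_bound
  refine ⟨B + B' + K * M + 1, by positivity, ?_⟩
  filter_upwards [hC, hC', Icc_mem_nhds (show ev - 1 < ev by linarith)
    (show ev < ev + 1 by linarith)] with t h1 h2 h3
  refine ⟨fun ε hε a κ ha hκ g hg δ hδ p q hpq hq hx => ?_,
    fun ε hε a κ ha hκ g hg δ hδ p q hpq hq hx => ?_, fun ε hε a κ ha hκ g hg p q hpq => ?_⟩
  · refine (hB t h3 _ _ ε hε a κ ha hκ g hg h1 δ hδ p q hpq
      (fun x hx => hx.2.trans hq) hx).trans ?_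
    gcongr
    nlinarith [mul_nonneg hK0.le hM]
  · refine (hB' t h3 _ _ ε hε a κ ha hκ g hg h2 δ hδ p q hpq
      (fun x hx => hq.trans hx.1) hx).trans ?_
    gcongr
    nlinarith [mul_nonneg hK0.le hM]
  · have h4 := (convex_Icc p q).norm_image_sub_le_of_norm_hasDerivWithin_le
      (C := B + B' + K * M + 1)
      (fun x _ => (hg x).hasDerivWithinAt) (fun x _ => ?_) (left_mem_Icc.2 hpq) (right_mem_Icc.2 hpq)
    · rwa [Real.norm_of_nonneg (by linarith)] at h4
    · rw [norm_mul, norm_osc, one_mul]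
      refine ((hK M a κ ha hκ x).1.trans (div_le_self (by positivity)
        (by linarith [abs_nonneg x]))).trans ?_
      linarith

end KS

/-- The solution in the rotating frame. -/
def frame (u : ℝ → ℝ) (ε lam : ℝ) (F : ℝ → ℂ) (x : ℝ) : ℂ :=
  Complex.I * ε * (osc ε (phase u lam x) * F x)

/-! ### Bounds for solutions in the rotating frame -/

theorem norm_frame (u : ℝ → ℝ) {ε : ℝ} (hε : 0 < ε) (lam : ℝ) (F : ℝ → ℂ) (x : ℝ) :
    ‖frame u ε lam F x‖ = ε * ‖F x‖ := by
  simp [frame, norm_osc, abs_of_pos hε]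

theorem RatData.Sol.hasDerivAt_frame {u : ℝ → ℝ} (d : RatData u) {ε lam : ℝ} (hε : 0 < ε)
    {a : Fin d.P → ℂ} {κ : ℂ} {F : ℝ → ℂ} (h : d.Sol ε lam a κ F) (x : ℝ) :
    HasDerivAt (frame u ε lam F) (osc ε (phase u lam x) * d.src a κ x) x := by
  have hε0 : (ε : ℂ) ≠ 0 := by exact_mod_cast hε.ne'
  refine (((HasDerivAt.osc (hasDerivAt_phase d.continuous_u lam x)).fun_mul
    (h.deriv x)).const_mul (Complex.I * ε)).congr_deriv ?_
  push_cast
  field_simp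
  linear_combination (-(osc ε (phase u lam x) * d.src a κ x)) * Complex.I_sq

namespace KS
variable {u : ℝ → ℝ} (S : KS u)

section bounds
variable {ε lam M B : ℝ} {a : Fin S.P → ℂ} {κ : ℂ} {F : ℝ → ℂ}

/-- The increment of the frame from a far point to the left is bounded by nonstationary phase, and
the far point is chosen so that `F` is negligible there. -/
theorem norm_frame_left (hb : S.PhaseBound lam M B) (hl : lam ∈ bulk u) (hε : 0 < ε)
    (ha : ‖a‖ ≤ M) (hκ : ‖κ‖ ≤ M) (h : S.Sol ε lam a κ F) {x δ : ℝ} (hδ : 0 < δ)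
    (hx : x ≤ xMinus u lam - δ) : ‖frame u ε lam F x‖ ≤ B * ε / δ := by
  refine le_of_forall_pos_le_add fun η hη => ?_
  obtain ⟨y, hy, hyF⟩ := exists_norm_lt_of_memLp h.memLp (s := Iic x) measurableSet_Iic
    (by simp) (show 0 < η / ε by positivity)
  have h1 := hb.left ε hε a κ ha hκ _ (RatData.Sol.hasDerivAt_frame _ hε h) δ hδ y x hy
    (by linarith [S.xMinus_lt hl]) (Or.inr hx)
  have h2 : ‖frame u ε lam F y‖ ≤ η := by
    rw [norm_frame u hε, mul_comm, ← le_div_iff₀ hε]; exact hyF.le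
  calc _ = ‖(frame u ε lam F x - frame u ε lam F y) + frame u ε lam F y‖ := by congr 1; ring
    _ ≤ _ := (norm_add_le _ _).trans (add_le_add h1 h2)

theorem norm_frame_right (hb : S.PhaseBound lam M B) (hl : lam ∈ bulk u) (hε : 0 < ε)
    (ha : ‖a‖ ≤ M) (hκ : ‖κ‖ ≤ M) (h : S.Sol ε lam a κ F) {x δ : ℝ} (hδ : 0 < δ)
    (hx : xPlus u lam + δ ≤ x) : ‖frame u ε lam F x‖ ≤ B * ε / δ := by
  refine le_of_forall_pos_le_add fun η hη => ?_
  obtain ⟨y, hy, hyF⟩ := exists_norm_lt_of_memLp h.memLp (s := Ici x) measurableSet_Ici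
    (by simp) (show 0 < η / ε by positivity)
  have h1 := hb.right ε hε a κ ha hκ _ (RatData.Sol.hasDerivAt_frame _ hε h) δ hδ x y hy
    (by linarith [S.lt_xPlus hl]) (Or.inl hx)
  have h2 : ‖frame u ε lam F y‖ ≤ η := by
    rw [norm_frame u hε, mul_comm, ← le_div_iff₀ hε]; exact hyF.le
  calc _ = ‖frame u ε lam F y - (frame u ε lam F y - frame u ε lam F x)‖ := by congr 1; ring
    _ ≤ _ := (norm_sub_le _ _).trans (by linarith)

/-- The cut is made at distance `√ε` from the turning point. Outside, nonstationary phase gives `B ε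
/ √ε = B √ε`; the window of length `2√ε` costs `2 B √ε` by the trivial bound. Crossing it from
infinity and continuing to `xc` gives the constant `1 + 2 + 1`. -/
theorem norm_frame_le (hb : S.PhaseBound lam M B) (hl : lam ∈ bulk u) (hε : 0 < ε)
    (ha : ‖a‖ ≤ M) (hκ : ‖κ‖ ≤ M) (h : S.Sol ε lam a κ F) (x : ℝ) :
    ‖frame u ε lam F x‖ ≤ 4 * B * √ε := by
  have hr : 0 < √ε := Real.sqrt_pos.2 hε
  have he : B * ε / √ε = B * √ε := by
    rw [div_eq_iff hr.ne', mul_assoc, Real.mul_self_sqrt hε.le]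
  have hd := RatData.Sol.hasDerivAt_frame S.toRatData hε h
  have hB : 0 ≤ B * √ε := (norm_nonneg _).trans (hb.trivial ε hε a κ ha hκ _ hd 0 (√ε) hr.le)
    |>.trans_eq (by ring)
  rcases le_total x S.xc with hx | hx
  · have h1 := S.norm_frame_left hb hl hε ha hκ h hr (le_refl (xMinus u lam - √ε))
    rw [he] at h1
    have h2 : ∀ y, xMinus u lam - √ε ≤ y → y ≤ xMinus u lam + √ε →
        ‖frame u ε lam F y‖ ≤ 3 * (B * √ε) := fun y hy hy' => by
      have h3 := hb.trivial ε hε a κ ha hκ _ hd _ y hy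
      have h4 : B * (y - (xMinus u lam - √ε)) ≤ 2 * (B * √ε) := by
        have : 0 ≤ B := nonneg_of_mul_nonneg_left hB hr
        nlinarith
      calc _ = ‖(frame u ε lam F y - frame u ε lam F (xMinus u lam - √ε))
            + frame u ε lam F (xMinus u lam - √ε)‖ := by congr 1; ring
        _ ≤ 3 * (B * √ε) := (norm_add_le _ _).trans (by linarith)
    rcases le_total x (xMinus u lam - √ε) with h3 | h3
    · have := S.norm_frame_left hb hl hε ha hκ h hr h3
      rw [he] at this
      linarith
    rcases le_total x (xMinus u lam + √ε) with h4 | h4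
    · have := h2 x h3 h4
      linarith
    · have h5 := hb.left ε hε a κ ha hκ _ hd (√ε) hr _ x h4 hx (Or.inl le_rfl)
      rw [he] at h5
      have h6 := h2 (xMinus u lam + √ε) (by linarith) le_rfl
      calc _ = ‖(frame u ε lam F x - frame u ε lam F (xMinus u lam + √ε))
            + frame u ε lam F (xMinus u lam + √ε)‖ := by congr 1; ring
        _ ≤ 4 * B * √ε := (norm_add_le _ _).trans (by linarith)
  · have h1 := S.norm_frame_right hb hl hε ha hκ h hr (le_refl (xPlus u lam + √ε))
    rw [he] at h1
    have h2 : ∀ y, xPlus u lam - √ε ≤ y → y ≤ xPlus u lam + √ε →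
        ‖frame u ε lam F y‖ ≤ 3 * (B * √ε) := fun y hy hy' => by
      have h3 := hb.trivial ε hε a κ ha hκ _ hd y _ hy'
      have h4 : B * ((xPlus u lam + √ε) - y) ≤ 2 * (B * √ε) := by
        have : 0 ≤ B := nonneg_of_mul_nonneg_left hB hr
        nlinarith
      calc _ = ‖frame u ε lam F (xPlus u lam + √ε) -
            (frame u ε lam F (xPlus u lam + √ε) - frame u ε lam F y)‖ := by congr 1; ring
        _ ≤ 3 * (B * √ε) := (norm_sub_le _ _).trans (by linarith)
    rcases le_total (xPlus u lam + √ε) x with h3 | h3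
    · have := S.norm_frame_right hb hl hε ha hκ h hr h3
      rw [he] at this
      linarith
    rcases le_total (xPlus u lam - √ε) x with h4 | h4
    · have := h2 x h4 h3
      linarith
    · have h5 := hb.right ε hε a κ ha hκ _ hd (√ε) hr x _ h4 hx (Or.inr le_rfl)
      rw [he] at h5
      have h6 := h2 (xPlus u lam - √ε) le_rfl (by linarith)
      calc _ = ‖frame u ε lam F (xPlus u lam - √ε) -
            (frame u ε lam F (xPlus u lam - √ε) - frame u ε lam F x)‖ := by congr 1; ring
        _ ≤ 4 * B * √ε := (norm_sub_le _ _).trans (by linarith)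

/-- The uniform bound with decay. -/
theorem norm_sol_le (hb : S.PhaseBound lam M B) (hl : lam ∈ bulk u) (hε : 0 < ε) (hε1 : ε ≤ 1)
    (ha : ‖a‖ ≤ M) (hκ : ‖κ‖ ≤ M) (h : S.Sol ε lam a κ F) {R : ℝ} (hR : 0 ≤ R)
    (h1 : |xMinus u lam| ≤ R) (h2 : |xPlus u lam| ≤ R) (x : ℝ) :
    √ε * ‖F x‖ ≤ 8 * B * (R + 1) / (1 + |x|) := by
  have hr : 0 < √ε := Real.sqrt_pos.2 hε
  have hd := RatData.Sol.hasDerivAt_frame S.toRatData hε h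
  have hB0 : 0 ≤ B := by
    have := (norm_nonneg _).trans (hb.trivial ε hε a κ ha hκ _ hd 0 1 zero_le_one)
    linarith
  have hr1 : √ε ≤ 1 := by simpa using Real.sqrt_le_sqrt hε1
  have hconv : ∀ t, ‖frame u ε lam F x‖ ≤ t * √ε → √ε * ‖F x‖ ≤ t := fun t ht => by
    have h3 : √ε * √ε = ε := Real.mul_self_sqrt hε.le
    rw [norm_frame u hε] at ht
    refine le_of_mul_le_mul_left ?_ hr
    rw [← mul_assoc, h3, mul_comm (√ε) t]
    exact ht
  have hx1 : 0 < 1 + |x| := by positivity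
  rw [le_div_iff₀ hx1]
  -- Beyond `2R + 1` the turning points are at distance at least `(1 + |x|) / 2`, so nonstationary
  -- phase supplies the decay; below, the uniform bound suffices.
  rcases le_total |x| (2 * R + 1) with h3 | h3
  · have h4 := hconv (4 * B) (S.norm_frame_le hb hl hε ha hκ h x)
    calc _ ≤ 4 * B * (1 + (2 * R + 1)) := by gcongr
      _ = _ := by ring
  · have key : ‖frame u ε lam F x‖ ≤ B * ε / ((1 + |x|) / 2) := by
      rcases le_abs.1 (le_refl |x|) with h4 | h4
      · exact S.norm_frame_right hb hl hε ha hκ h (by positivity)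
          (by linarith [(abs_le.1 h2).2])
      · exact S.norm_frame_left hb hl hε ha hκ h (by positivity)
          (by linarith [(abs_le.1 h1).1])
    have h5 : B * ε / ((1 + |x|) / 2) ≤ 2 * B / (1 + |x|) * √ε := by
      rw [div_div_eq_mul_div, div_mul_eq_mul_div]
      gcongr ?_ / _
      have : ε ≤ √ε := by
        calc ε = √ε * √ε := (Real.mul_self_sqrt hε.le).symm
          _ ≤ 1 * √ε := by gcongr
          _ = √ε := one_mul _
      nlinarith
    have h6 := hconv _ (key.trans h5)
    rw [le_div_iff₀ hx1] at h6
    nlinarith [mul_nonneg hB0 hR]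

end bounds
end KS

/-- The limit of the Fresnel integrals. -/
def fresnel (k : ℝ) : ℂ :=
  limUnder atTop fun S : ℝ => ∫ s in -S..S, Complex.exp (-(Complex.I * k / 2) * s ^ 2)

theorem tendsto_fresnel {k : ℝ} (hk : k ≠ 0) :
    Tendsto (fun S : ℝ => ∫ s in -S..S, Complex.exp (-(Complex.I * k / 2) * s ^ 2)) atTop
      (𝓝 (fresnel k)) := by
  obtain ⟨c, -, h⟩ := exists_fresnel hk
  exact tendsto_nhds_limUnder ⟨c, h⟩

theorem fresnel_ne_zero {k : ℝ} (hk : k ≠ 0) : fresnel k ≠ 0 := by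
  obtain ⟨c, hc, h⟩ := exists_fresnel hk
  rwa [← tendsto_nhds_unique h (tendsto_fresnel hk)]

/-- Exchange of limits: the window parameter `t` is fixed while `n` tends to infinity and is
enlarged afterwards. -/
theorem tendsto_of_approx {A : ℕ → ℂ} {J : ℝ → ℕ → ℂ} {j : ℝ → ℂ} {c : ℂ} {C : ℝ}
    (hJ : ∀ t, 0 < t → Tendsto (J t) atTop (𝓝 (j t))) (hj : Tendsto j atTop (𝓝 c))
    (hA : ∀ t, 0 < t → ∀ᶠ n in atTop, ‖A n - J t n‖ ≤ C / t) : Tendsto A atTop (𝓝 c) := by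
  rw [Metric.tendsto_nhds]
  intro η hη
  have h1 : Tendsto (fun t : ℝ => C / t) atTop (𝓝 0) := tendsto_id.const_div_atTop C
  obtain ⟨t, ⟨ht1, ht2⟩, ht3⟩ := (((h1.eventually (gt_mem_nhds (show 0 < η / 3 by positivity))).and
    (Metric.tendsto_nhds.1 hj (η / 3) (by positivity))).and (eventually_gt_atTop 0)).exists
  filter_upwards [hA t ht3, Metric.tendsto_nhds.1 (hJ t ht3) (η / 3) (by positivity)] with n h2 h3
  calc dist (A n) c ≤ dist (A n) (J t n) + dist (J t n) (j t) + dist (j t) c := dist_triangle4 _ _ _ _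
    _ < η := by rw [dist_eq_norm (A n)]; linarith

/-! ### Semiclassical limits along sequences of solutions -/

namespace KS
variable {u : ℝ → ℝ} (S : KS u)

/-- A sequence of solutions in the semiclassical limit, with convergent data. -/
structure SolSeq (lam₀ : ℝ) (a₀ : Fin S.P → ℂ) (κ₀ : ℂ) (ε lam : ℕ → ℝ) (a : ℕ → Fin S.P → ℂ)
    (κ : ℕ → ℂ) (F : ℕ → ℝ → ℂ) : Prop where
  bulk₀ : lam₀ ∈ bulk u
  bulk : ∀ n, lam n ∈ bulk u
  pos : ∀ n, 0 < ε n
  eps : Tendsto ε atTop (𝓝 0)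
  lim : Tendsto lam atTop (𝓝 lam₀)
  a_lim : Tendsto a atTop (𝓝 a₀)
  κ_lim : Tendsto κ atTop (𝓝 κ₀)
  sol : ∀ n, S.Sol (ε n) (lam n) (a n) (κ n) (F n)

/-- The source at the left turning point with its Fresnel factor. -/
def ampL (lam : ℝ) (a : Fin S.P → ℂ) (κ : ℂ) : ℂ :=
  S.src a κ (xMinus u lam) * fresnel (deriv u (xMinus u lam))

/-- The source at the right turning point with its Fresnel factor. -/
def ampR (lam : ℝ) (a : Fin S.P → ℂ) (κ : ℂ) : ℂ :=
  S.src a κ (xPlus u lam) * fresnel (deriv u (xPlus u lam))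

theorem ampL_eq_zero_iff {lam : ℝ} (h : lam ∈ bulk u) {a : Fin S.P → ℂ} {κ : ℂ} :
    S.ampL lam a κ = 0 ↔ S.src a κ (xMinus u lam) = 0 := by
  simp [ampL, fresnel_ne_zero (S.deriv_xMinus_ne h)]

theorem ampR_eq_zero_iff {lam : ℝ} (h : lam ∈ bulk u) {a : Fin S.P → ℂ} {κ : ℂ} :
    S.ampR lam a κ = 0 ↔ S.src a κ (xPlus u lam) = 0 := by
  simp [ampR, fresnel_ne_zero (S.deriv_xPlus_ne h)]

/-- The scaled solution in the rotating frame, based at the left turning point. -/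
def prof (u : ℝ → ℝ) (ε lam : ℝ) (F : ℝ → ℂ) (x : ℝ) : ℂ :=
  osc ε (-phase u lam (xMinus u lam)) * ((√ε : ℂ)⁻¹ * frame u ε lam F x)

theorem action_eq_phase (S : KS u) (lam : ℝ) :
    action u lam = phase u lam (xPlus u lam) - phase u lam (xMinus u lam) :=
  (phase_sub_phase S.continuous_u _ _ _).symm

namespace SolSeq
variable {S} {lam₀ : ℝ} {a₀ : Fin S.P → ℂ} {κ₀ : ℂ} {ε lam : ℕ → ℝ} {a : ℕ → Fin S.P → ℂ}
    {κ : ℕ → ℂ} {F : ℕ → ℝ → ℂ}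

theorem comp (h : S.SolSeq lam₀ a₀ κ₀ ε lam a κ F) {φ : ℕ → ℕ} (hφ : StrictMono φ) :
    S.SolSeq lam₀ a₀ κ₀ (ε ∘ φ) (lam ∘ φ) (a ∘ φ) (κ ∘ φ) (F ∘ φ) where
  bulk₀ := h.bulk₀
  bulk _ := h.bulk _
  pos _ := h.pos _
  eps := h.eps.comp hφ.tendsto_atTop
  lim := h.lim.comp hφ.tendsto_atTop
  a_lim := h.a_lim.comp hφ.tendsto_atTop
  κ_lim := h.κ_lim.comp hφ.tendsto_atTop
  sol _ := h.sol _

theorem exists_bound (h : S.SolSeq lam₀ a₀ κ₀ ε lam a κ F) : ∃ M B : ℝ, 0 < B ∧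
    (∀ n, ‖a n‖ ≤ M ∧ ‖κ n‖ ≤ M) ∧ ∀ᶠ n in atTop, S.PhaseBound (lam n) M B := by
  obtain ⟨M₁, h1⟩ := (Metric.isBounded_range_of_tendsto a h.a_lim).exists_norm_le
  obtain ⟨M₂, h2⟩ := (Metric.isBounded_range_of_tendsto κ h.κ_lim).exists_norm_le
  have hM₁ : 0 ≤ M₁ := (norm_nonneg _).trans (h1 _ (mem_range_self 0))
  obtain ⟨B, hB, hB'⟩ := S.exists_phaseBound h.bulk₀ (M := max M₁ M₂) (le_max_of_le_left hM₁)
  exact ⟨max M₁ M₂, B, hB, fun n => ⟨(h1 _ (mem_range_self n)).trans (le_max_left _ _),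
    (h2 _ (mem_range_self n)).trans (le_max_right _ _)⟩, h.lim.eventually hB'⟩

theorem tendsto_sqrt (h : S.SolSeq lam₀ a₀ κ₀ ε lam a κ F) :
    Tendsto (fun n => √(ε n)) atTop (𝓝 0) := by
  simpa [Function.comp_def] using (Real.continuous_sqrt.tendsto 0).comp h.eps

theorem sqrt_pos (h : S.SolSeq lam₀ a₀ κ₀ ε lam a κ F) (n : ℕ) : 0 < √(ε n) :=
  Real.sqrt_pos.2 (h.pos n)

theorem tendsto_src (h : S.SolSeq lam₀ a₀ κ₀ ε lam a κ F) {y : ℕ → ℝ} {x : ℝ}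
    (hy : Tendsto y atTop (𝓝 x)) :
    Tendsto (fun n => S.src (a n) (κ n) (y n)) atTop (𝓝 (S.src a₀ κ₀ x)) := by
  have h1 : Tendsto (fun n => (a n, κ n, y n)) atTop (𝓝 (a₀, κ₀, x)) :=
    h.a_lim.prodMk_nhds (h.κ_lim.prodMk_nhds hy)
  have h2 := (S.toRatData.continuous_src_uncurry.tendsto (a₀, κ₀, x)).comp h1
  exact h2

theorem integral_osc (h : S.SolSeq lam₀ a₀ κ₀ ε lam a κ F) (n : ℕ) (p q : ℝ) :
    ∫ t in p..q, osc (ε n) (phase u (lam n) t) * S.src (a n) (κ n) t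
      = frame u (ε n) (lam n) (F n) q - frame u (ε n) (lam n) (F n) p := by
  refine intervalIntegral.integral_eq_sub_of_hasDerivAt
    (fun x _ => RatData.Sol.hasDerivAt_frame _ (h.pos n) (h.sol n) x) ?_
  have hc : Continuous (phase u (lam n)) := continuous_iff_continuousAt.2 fun x =>
    (hasDerivAt_phase S.continuous_u _ x).continuousAt
  exact (((continuous_osc _).comp hc).mul (S.continuous_src _ _)).intervalIntegrable _ _

theorem tendsto_stationary_frame (h : S.SolSeq lam₀ a₀ κ₀ ε lam a κ F) {x : ℕ → ℝ} {x₀ : ℝ}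
    (hx : Tendsto x atTop (𝓝 x₀)) (hu : ∀ n, u (x n) = -lam n) (t : ℝ) :
    Tendsto (fun n => osc (ε n) (-phase u (lam n) (x n)) * ((√(ε n) : ℂ)⁻¹ *
      (frame u (ε n) (lam n) (F n) (x n + t * √(ε n))
        - frame u (ε n) (lam n) (F n) (x n - t * √(ε n))))) atTop
      (𝓝 (S.src a₀ κ₀ x₀ *
        ∫ s in -t..t, Complex.exp (-(Complex.I * deriv u x₀ / 2) * s ^ 2))) := by
  obtain ⟨M, B, -, hM, -⟩ := h.exists_bound
  obtain ⟨K, hK0, hK⟩ := S.exists_src_bound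
  simp_rw [← h.integral_osc]
  refine tendsto_stationary (M := K * M) (S.hasStrictDerivAt_u x₀) h.pos h.eps hx
    (fun n y => ?_) (fun n y => ?_) (fun n => S.continuous_src _ _) fun y hy => h.tendsto_src hy
  · rw [hu, sub_neg_eq_add]
    exact hasDerivAt_phase S.continuous_u _ _
  · have hM0 : 0 ≤ M := (norm_nonneg _).trans (hM n).1
    exact ((hK M _ _ (hM n).1 (hM n).2 y).1).trans (div_le_self (by positivity)
      (by linarith [abs_nonneg y]))

theorem norm_scaled (h : S.SolSeq lam₀ a₀ κ₀ ε lam a κ F) (n : ℕ) (c : ℝ) (w : ℂ) :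
    ‖osc (ε n) c * ((√(ε n) : ℂ)⁻¹ * w)‖ = ‖w‖ / √(ε n) := by
  rw [norm_mul, norm_osc, one_mul, norm_mul, norm_inv, Complex.norm_real,
    Real.norm_of_nonneg (h.sqrt_pos n).le, inv_mul_eq_div]

theorem div_sqrt (h : S.SolSeq lam₀ a₀ κ₀ ε lam a κ F) (n : ℕ) (B t : ℝ) :
    B * ε n / (t * √(ε n)) / √(ε n) = B / t := by
  have h1 := (h.sqrt_pos n).ne'
  have h2 : √(ε n) * √(ε n) = ε n := Real.mul_self_sqrt (h.pos n).le
  rw [div_div, mul_assoc, h2, mul_div_mul_right _ _ (h.pos n).ne']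

theorem tendsto_xMinus (h : S.SolSeq lam₀ a₀ κ₀ ε lam a κ F) :
    Tendsto (fun n => xMinus u (lam n)) atTop (𝓝 (xMinus u lam₀)) :=
  (S.continuousAt_xMinus h.bulk₀).tendsto.comp h.lim

theorem tendsto_xPlus (h : S.SolSeq lam₀ a₀ κ₀ ε lam a κ F) :
    Tendsto (fun n => xPlus u (lam n)) atTop (𝓝 (xPlus u lam₀)) :=
  (S.continuousAt_xPlus h.bulk₀).tendsto.comp h.lim

/-- Between `-∞` and `xc` only the left turning point is crossed. The window of half-width `t√ε`
gives a truncated Fresnel integral, and the two sides outside it contribute at most `B / t` each. -/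
theorem tendsto_prof_center (h : S.SolSeq lam₀ a₀ κ₀ ε lam a κ F) :
    Tendsto (fun n => prof u (ε n) (lam n) (F n) S.xc) atTop (𝓝 (S.ampL lam₀ a₀ κ₀)) := by
  obtain ⟨M, B, hB, hM, hb⟩ := h.exists_bound
  refine tendsto_of_approx (C := 2 * B)
    (fun t _ => h.tendsto_stationary_frame h.tendsto_xMinus (fun n => S.u_xMinus (h.bulk n)) t)
    ((tendsto_fresnel (S.deriv_xMinus_ne h.bulk₀)).const_mul _) fun t ht => ?_
  have h1 : Tendsto (fun n => xMinus u (lam n) + t * √(ε n)) atTop (𝓝 (xMinus u lam₀)) := by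
    simpa using h.tendsto_xMinus.add (h.tendsto_sqrt.const_mul t)
  filter_upwards [hb, h1.eventually (gt_mem_nhds (S.xMinus_lt h.bulk₀))] with n hn hn1
  have hs := h.sqrt_pos n
  have hd := RatData.Sol.hasDerivAt_frame S.toRatData (h.pos n) (h.sol n)
  have h2 := hn.left _ (h.pos n) _ _ (hM n).1 (hM n).2 _ hd (t * √(ε n)) (by positivity)
    (xMinus u (lam n) + t * √(ε n)) S.xc hn1.le le_rfl (Or.inl le_rfl)
  have h3 := S.norm_frame_left hn (h.bulk n) (h.pos n) (hM n).1 (hM n).2 (h.sol n)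
    (show 0 < t * √(ε n) by positivity) le_rfl
  rw [prof, ← mul_sub, ← mul_sub, h.norm_scaled, div_le_iff₀ hs]
  have h4 := h.div_sqrt n B t
  rw [div_eq_iff hs.ne'] at h4
  rw [h4] at h2 h3
  calc _ = ‖(frame u (ε n) (lam n) (F n) S.xc
          - frame u (ε n) (lam n) (F n) (xMinus u (lam n) + t * √(ε n)))
        + frame u (ε n) (lam n) (F n) (xMinus u (lam n) - t * √(ε n))‖ := by congr 1; ring
    _ ≤ B / t * √(ε n) + B / t * √(ε n) := (norm_add_le _ _).trans (add_le_add h2 h3)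
    _ = _ := by ring

/-- The same argument from `xc` to `+∞`. The frame is negligible at `+∞`, so the jump across the
right turning point is minus its value at `xc`. -/
theorem tendsto_right (h : S.SolSeq lam₀ a₀ κ₀ ε lam a κ F) :
    Tendsto (fun n => osc (ε n) (-phase u (lam n) (xPlus u (lam n))) *
      ((√(ε n) : ℂ)⁻¹ * -frame u (ε n) (lam n) (F n) S.xc)) atTop (𝓝 (S.ampR lam₀ a₀ κ₀)) := by
  obtain ⟨M, B, hB, hM, hb⟩ := h.exists_bound
  refine tendsto_of_approx (C := 2 * B)
    (fun t _ => h.tendsto_stationary_frame h.tendsto_xPlus (fun n => S.u_xPlus (h.bulk n)) t)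
    ((tendsto_fresnel (S.deriv_xPlus_ne h.bulk₀)).const_mul _) fun t ht => ?_
  have h1 : Tendsto (fun n => xPlus u (lam n) - t * √(ε n)) atTop (𝓝 (xPlus u lam₀)) := by
    simpa using h.tendsto_xPlus.sub (h.tendsto_sqrt.const_mul t)
  filter_upwards [hb, h1.eventually (lt_mem_nhds (S.lt_xPlus h.bulk₀))] with n hn hn1
  have hs := h.sqrt_pos n
  have hd := RatData.Sol.hasDerivAt_frame S.toRatData (h.pos n) (h.sol n)
  have h2 := hn.right _ (h.pos n) _ _ (hM n).1 (hM n).2 _ hd (t * √(ε n)) (by positivity)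
    S.xc (xPlus u (lam n) - t * √(ε n)) hn1.le le_rfl (Or.inr le_rfl)
  have h3 := S.norm_frame_right hn (h.bulk n) (h.pos n) (hM n).1 (hM n).2 (h.sol n)
    (show 0 < t * √(ε n) by positivity) le_rfl
  rw [← mul_sub, ← mul_sub, h.norm_scaled, div_le_iff₀ hs]
  have h4 := h.div_sqrt n B t
  rw [div_eq_iff hs.ne'] at h4
  rw [h4] at h2 h3
  calc _ = ‖(frame u (ε n) (lam n) (F n) (xPlus u (lam n) - t * √(ε n))
          - frame u (ε n) (lam n) (F n) S.xc)
        - frame u (ε n) (lam n) (F n) (xPlus u (lam n) + t * √(ε n))‖ := by congr 1; ring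
    _ ≤ B / t * √(ε n) + B / t * √(ε n) := (norm_sub_le _ _).trans (add_le_add h2 h3)
    _ = _ := by ring

/-- The connection of the two turning points. -/
theorem tendsto_connection (h : S.SolSeq lam₀ a₀ κ₀ ε lam a κ F) :
    Tendsto (fun n => S.ampL lam₀ a₀ κ₀ + osc (ε n) (action u (lam n)) * S.ampR lam₀ a₀ κ₀) atTop
      (𝓝 0) := by
  have h1 := tendsto_iff_norm_sub_tendsto_zero.1 h.tendsto_prof_center
  have h2 := tendsto_iff_norm_sub_tendsto_zero.1 h.tendsto_right
  refine squeeze_zero_norm (fun n => ?_) (by simpa only [add_zero] using h1.add h2)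
  have h3 : osc (ε n) (action u (lam n)) * osc (ε n) (-phase u (lam n) (xPlus u (lam n)))
      = osc (ε n) (-phase u (lam n) (xMinus u (lam n))) := by
    rw [← osc_add, S.action_eq_phase]; congr 1; ring
  set A := osc (ε n) (-phase u (lam n) (xPlus u (lam n))) *
      ((√(ε n) : ℂ)⁻¹ * -frame u (ε n) (lam n) (F n) S.xc) with hA
  have h4 : prof u (ε n) (lam n) (F n) S.xc = -(osc (ε n) (action u (lam n)) * A) := by
    rw [prof, ← h3, hA]; ring
  calc _ = ‖-(prof u (ε n) (lam n) (F n) S.xc - S.ampL lam₀ a₀ κ₀)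
        - osc (ε n) (action u (lam n)) * (A - S.ampR lam₀ a₀ κ₀)‖ := by rw [h4]; congr 1; ring
    _ ≤ _ := (norm_sub_le _ _).trans_eq (by rw [norm_neg, norm_mul, norm_osc, one_mul])

theorem tendsto_of_norm_frame_le (h : S.SolSeq lam₀ a₀ κ₀ ε lam a κ F) {C : ℝ} {w : ℕ → ℂ}
    {c : ℕ → ℝ} (hw : ∀ᶠ n in atTop, ‖w n‖ ≤ C * ε n) :
    Tendsto (fun n => osc (ε n) (c n) * ((√(ε n) : ℂ)⁻¹ * w n)) atTop (𝓝 0) := by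
  refine squeeze_zero_norm' (a := fun n => C * √(ε n)) ?_ (by simpa using h.tendsto_sqrt.const_mul C)
  filter_upwards [hw] with n hn
  rw [h.norm_scaled, div_le_iff₀ (h.sqrt_pos n), mul_assoc, Real.mul_self_sqrt (h.pos n).le]
  exact hn

/-- No turning point lies between `x` and `xc`, so the frame changes by `O(ε)`, which is negligible
against the scale `√ε`. -/
theorem tendsto_prof_of_mem (h : S.SolSeq lam₀ a₀ κ₀ ε lam a κ F) {x : ℝ}
    (hx : x ∈ Ioo (xMinus u lam₀) (xPlus u lam₀)) :
    Tendsto (fun n => prof u (ε n) (lam n) (F n) x) atTop (𝓝 (S.ampL lam₀ a₀ κ₀)) := by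
  obtain ⟨M, B, hB, hM, hb⟩ := h.exists_bound
  have key : Tendsto (fun n => osc (ε n) (-phase u (lam n) (xMinus u (lam n))) *
      ((√(ε n) : ℂ)⁻¹ * (frame u (ε n) (lam n) (F n) x - frame u (ε n) (lam n) (F n) S.xc)))
      atTop (𝓝 0) := by
    rcases le_total x S.xc with hc | hc
    · refine h.tendsto_of_norm_frame_le (C := B / ((x - xMinus u lam₀) / 2)) ?_
      have h0 : 0 < (x - xMinus u lam₀) / 2 := by linarith [hx.1]
      filter_upwards [hb, h.tendsto_xMinus.eventually (gt_mem_nhds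
        (show xMinus u lam₀ < xMinus u lam₀ + (x - xMinus u lam₀) / 2 by linarith))] with n hn hn1
      have hd := RatData.Sol.hasDerivAt_frame S.toRatData (h.pos n) (h.sol n)
      have h2 := hn.left _ (h.pos n) _ _ (hM n).1 (hM n).2 _ hd _ h0 x S.xc hc le_rfl
        (Or.inl (by linarith))
      rw [norm_sub_rev, div_mul_eq_mul_div]
      exact h2
    · refine h.tendsto_of_norm_frame_le (C := B / ((xPlus u lam₀ - x) / 2)) ?_
      have h0 : 0 < (xPlus u lam₀ - x) / 2 := by linarith [hx.2]
      filter_upwards [hb, h.tendsto_xPlus.eventually (lt_mem_nhds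
        (show xPlus u lam₀ - (xPlus u lam₀ - x) / 2 < xPlus u lam₀ by linarith))] with n hn hn1
      have hd := RatData.Sol.hasDerivAt_frame S.toRatData (h.pos n) (h.sol n)
      have h2 := hn.right _ (h.pos n) _ _ (hM n).1 (hM n).2 _ hd _ h0 S.xc x hc le_rfl
        (Or.inr (by linarith))
      rw [div_mul_eq_mul_div]
      exact h2
  have := key.add h.tendsto_prof_center
  rw [zero_add] at this
  refine this.congr fun n => ?_
  unfold prof
  ring

theorem tendsto_prof_of_not_mem (h : S.SolSeq lam₀ a₀ κ₀ ε lam a κ F) {x : ℝ}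
    (hx : x < xMinus u lam₀ ∨ xPlus u lam₀ < x) :
    Tendsto (fun n => prof u (ε n) (lam n) (F n) x) atTop (𝓝 0) := by
  obtain ⟨M, B, hB, hM, hb⟩ := h.exists_bound
  rcases hx with hx | hx
  · refine h.tendsto_of_norm_frame_le (C := B / ((xMinus u lam₀ - x) / 2)) ?_
    have h0 : 0 < (xMinus u lam₀ - x) / 2 := by linarith
    filter_upwards [hb, h.tendsto_xMinus.eventually (lt_mem_nhds
      (show xMinus u lam₀ - (xMinus u lam₀ - x) / 2 < xMinus u lam₀ by linarith))] with n hn hn1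
    rw [div_mul_eq_mul_div]
    exact S.norm_frame_left hn (h.bulk n) (h.pos n) (hM n).1 (hM n).2 (h.sol n) h0 (by linarith)
  · refine h.tendsto_of_norm_frame_le (C := B / ((x - xPlus u lam₀) / 2)) ?_
    have h0 : 0 < (x - xPlus u lam₀) / 2 := by linarith
    filter_upwards [hb, h.tendsto_xPlus.eventually (gt_mem_nhds
      (show xPlus u lam₀ < xPlus u lam₀ + (x - xPlus u lam₀) / 2 by linarith))] with n hn hn1
    rw [div_mul_eq_mul_div]
    exact S.norm_frame_right hn (h.bulk n) (h.pos n) (hM n).1 (hM n).2 (h.sol n) h0 (by linarith)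

theorem exists_decay (h : S.SolSeq lam₀ a₀ κ₀ ε lam a κ F) :
    ∃ C, 0 < C ∧ ∀ᶠ n in atTop, ∀ x, √(ε n) * ‖F n x‖ ≤ C / (1 + |x|) := by
  obtain ⟨M, B, hB, hM, hb⟩ := h.exists_bound
  obtain ⟨R₁, h1⟩ := (Metric.isBounded_range_of_tendsto _ h.tendsto_xMinus).exists_norm_le
  obtain ⟨R₂, h2⟩ := (Metric.isBounded_range_of_tendsto _ h.tendsto_xPlus).exists_norm_le
  have hR₁ : 0 ≤ R₁ := (norm_nonneg _).trans (h1 _ (mem_range_self 0))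
  have hR : 0 ≤ max R₁ R₂ := le_max_of_le_left hR₁
  refine ⟨8 * B * (max R₁ R₂ + 1), by positivity, ?_⟩
  filter_upwards [hb, h.eps.eventually (gt_mem_nhds one_pos)] with n hn hn1 x
  exact S.norm_sol_le hn (h.bulk n) (h.pos n) hn1.le (hM n).1 (hM n).2 (h.sol n) hR
    ((h1 _ (mem_range_self n)).trans (le_max_left _ _))
    ((h2 _ (mem_range_self n)).trans (le_max_right _ _)) x

end SolSeq

theorem prof_eq {ε : ℝ} (hε : 0 < ε) (lam : ℝ) (F : ℝ → ℂ) (x : ℝ) :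
    prof u ε lam F x = osc ε (-phase u lam (xMinus u lam)) *
      (Complex.I * (osc ε (phase u lam x) * (√ε * F x))) := by
  have h1 : (√ε : ℂ) * √ε = ε := by exact_mod_cast Real.mul_self_sqrt hε.le
  have h2 : (√ε : ℂ) ≠ 0 := by exact_mod_cast (Real.sqrt_pos.2 hε).ne'
  rw [prof, frame, ← h1]
  field_simp

theorem norm_prof {ε : ℝ} (hε : 0 < ε) (lam : ℝ) (F : ℝ → ℂ) (x : ℝ) :
    ‖prof u ε lam F x‖ = √ε * ‖F x‖ := by
  rw [prof_eq hε]
  simp [norm_osc, abs_of_nonneg (Real.sqrt_nonneg ε)]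

theorem phase_sub (S : KS u) (lam mu x : ℝ) :
    phase u lam x - phase u mu x = (lam - mu) * x := by
  have hc : ∀ l, Continuous fun t => u t + l := fun l => S.continuous_u.add continuous_const
  rw [phase, phase, ← intervalIntegral.integral_sub ((hc lam).intervalIntegrable _ _)
    ((hc mu).intervalIntegrable _ _)]
  simp
  ring

/-- Profiles differ from the scaled solutions by unimodular factors. Phases at two levels differ by
a linear function of `x`, so in the product only that linear phase and a constant remain. -/
theorem norm_conj_mul (S : KS u) {ε : ℝ} (hε : 0 < ε) (lam mu : ℝ) (F G : ℝ → ℂ) :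
    ε * ‖∫ x, (starRingEnd ℂ) (F x) * G x‖
      = ‖∫ x, osc ε ((mu - lam) * -x) * ((starRingEnd ℂ) (prof u ε lam F x) * prof u ε mu G x)‖ := by
  set c := osc ε (phase u lam (xMinus u lam) - phase u mu (xMinus u mu)) with hc
  have h1 : (√ε : ℂ) * √ε = ε := by exact_mod_cast Real.mul_self_sqrt hε.le
  have h2 : ∀ x, osc ε ((mu - lam) * -x) * ((starRingEnd ℂ) (prof u ε lam F x) * prof u ε mu G x)
      = c * (ε * ((starRingEnd ℂ) (F x) * G x)) := fun x => by
    rw [prof_eq hε, prof_eq hε]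
    simp only [map_mul, conj_osc, Complex.conj_I, Complex.conj_ofReal, neg_neg]
    have h3 : osc ε ((mu - lam) * -x) * osc ε (-phase u lam x) * osc ε (phase u mu x) = 1 := by
      rw [← osc_add, ← osc_add, ← osc_zero ε]
      congr 1
      linear_combination -(S.phase_sub lam mu x)
    have h4 : osc ε (phase u lam (xMinus u lam)) * osc ε (-phase u mu (xMinus u mu)) = c := by
      rw [hc, ← osc_add, sub_eq_add_neg]
    rw [← h4, ← h1]
    set X := osc ε (phase u lam (xMinus u lam)) * osc ε (-phase u mu (xMinus u mu))
      * (√ε * √ε * ((starRingEnd ℂ) (F x) * G x))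
    linear_combination (X * -Complex.I ^ 2) * h3 - X * Complex.I_sq
  simp_rw [h2]
  rw [integral_const_mul, integral_const_mul, norm_mul, norm_mul, hc, norm_osc, one_mul,
    Complex.norm_real, Real.norm_of_nonneg hε.le]

/-- The semiclassical limit of inner products of solutions at levels that differ by `O(ε)`. -/
theorem tendsto_inner {lam₀ : ℝ} {a₀ a₀' : Fin S.P → ℂ} {κ₀ κ₀' : ℂ} {ε lam mu : ℕ → ℝ}
    {a a' : ℕ → Fin S.P → ℂ} {κ κ' : ℕ → ℂ} {F G : ℕ → ℝ → ℂ}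
    (h : S.SolSeq lam₀ a₀ κ₀ ε lam a κ F) (h' : S.SolSeq lam₀ a₀' κ₀' ε mu a' κ' G) {σ : ℝ}
    (hσ : Tendsto (fun n => (mu n - lam n) / ε n) atTop (𝓝 σ)) :
    Tendsto (fun n => ε n * ‖∫ x, (starRingEnd ℂ) (F n x) * G n x‖) atTop
      (𝓝 (‖S.ampL lam₀ a₀ κ₀‖ * ‖S.ampL lam₀ a₀' κ₀'‖
        * ‖∫ x in xMinus u lam₀..xPlus u lam₀, Complex.exp (σ * x * Complex.I)‖)) := by
  obtain ⟨C, hC0, hC⟩ := h.exists_decay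
  obtain ⟨C', hC0', hC'⟩ := h'.exists_decay
  simp_rw [fun n => S.norm_conj_mul (h.pos n) (lam n) (mu n) (F n) (G n)]
  have hlt := (S.xMinus_lt_xPlus h.bulk₀)
  set α := S.ampL lam₀ a₀ κ₀
  set α' := S.ampL lam₀ a₀' κ₀'
  have hfin : ‖α‖ * ‖α'‖ * ‖∫ x in xMinus u lam₀..xPlus u lam₀, Complex.exp (σ * x * Complex.I)‖
      = ‖∫ x, (Ioc (xMinus u lam₀) (xPlus u lam₀)).indicator
        (fun x : ℝ => Complex.exp (σ * x * Complex.I) * ((starRingEnd ℂ) α * α')) x‖ := by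
    rw [integral_indicator measurableSet_Ioc, integral_mul_const,
      ← intervalIntegral.integral_of_le hlt.le, norm_mul, norm_mul, RCLike.norm_conj]
    ring
  rw [hfin]
  refine Tendsto.norm ?_
  -- The decay of the scaled solutions dominates. Pointwise, profiles tend to their amplitude inside
  -- the well and to zero outside it; the turning points form a null set.
  refine tendsto_integral_filter_of_dominated_convergence (fun x => C * C' * (1 / (1 + |x|) ^ 2))
    ?_ ?_ (integrable_inv_one_add_abs_sq.const_mul _) ?_
  · refine Eventually.of_forall fun n => Continuous.aestronglyMeasurable ?_
    have hc : ∀ l, Continuous (phase u l) := fun l => continuous_iff_continuousAt.2 fun x =>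
      (hasDerivAt_phase S.continuous_u _ x).continuousAt
    have hF : Continuous (F n) := continuous_iff_continuousAt.2 fun x =>
      ((h.sol n).deriv x).continuousAt
    have hG : Continuous (G n) := continuous_iff_continuousAt.2 fun x =>
      ((h'.sol n).deriv x).continuousAt
    have ho := continuous_osc (ε n)
    have hp : ∀ l (F : ℝ → ℂ), Continuous F → Continuous (prof u (ε n) l F) := fun l F hF => by
      unfold prof frame
      exact continuous_const.mul (continuous_const.mul (continuous_const.mul
        ((ho.comp (hc l)).mul hF)))
    exact (ho.comp (continuous_const.mul continuous_neg)).mul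
      ((Complex.continuous_conj.comp (hp _ _ hF)).mul (hp _ _ hG))
  · filter_upwards [hC, hC'] with n h1 h2
    refine ae_of_all _ fun x => ?_
    rw [norm_mul, norm_osc, one_mul, norm_mul, RCLike.norm_conj, norm_prof (h.pos n),
      norm_prof (h.pos n)]
    calc _ ≤ (C / (1 + |x|)) * (C' / (1 + |x|)) :=
          mul_le_mul (h1 x) (h2 x) (by positivity) (by positivity)
      _ = _ := by rw [div_mul_div_comm, ← sq, mul_one_div]
  · have hne : ∀ᵐ x : ℝ, x ∉ ({xMinus u lam₀, xPlus u lam₀} : Set ℝ) :=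
      measure_eq_zero_iff_ae_notMem.1 ((Set.toFinite _).measure_zero _)
    filter_upwards [hne] with x hx
    simp only [mem_insert_iff, mem_singleton_iff, not_or] at hx
    have hosc : Tendsto (fun n => osc (ε n) ((mu n - lam n) * -x)) atTop
        (𝓝 (Complex.exp (σ * x * Complex.I))) := by
      have h1 : Tendsto (fun n => (mu n - lam n) / ε n * x) atTop (𝓝 (σ * x)) := hσ.mul_const x
      have h2 := (Complex.continuous_exp.tendsto _).comp
        (((Complex.continuous_ofReal.tendsto _).comp h1).mul_const Complex.I)
      refine (h2.congr fun n => ?_).trans_eq ?_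
      · simp only [Function.comp, osc]
        congr 3
        ring
      · push_cast; rfl
    by_cases hin : x ∈ Ioc (xMinus u lam₀) (xPlus u lam₀)
    · rw [indicator_of_mem hin]
      have hin' : x ∈ Ioo (xMinus u lam₀) (xPlus u lam₀) := ⟨hin.1, lt_of_le_of_ne hin.2 hx.2⟩
      exact hosc.mul (((Complex.continuous_conj.tendsto _).comp (h.tendsto_prof_of_mem hin')).mul
        (h'.tendsto_prof_of_mem hin'))
    · rw [indicator_of_notMem hin]
      have hout : x < xMinus u lam₀ ∨ xPlus u lam₀ < x := by
        rcases lt_or_gt_of_ne hx.1 with h3 | h3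
        · exact Or.inl h3
        · exact Or.inr (lt_of_not_ge fun h4 => hin ⟨h3, h4⟩)
      have := hosc.mul (((Complex.continuous_conj.tendsto _).comp
        (h.tendsto_prof_of_not_mem hout)).mul (h'.tendsto_prof_of_not_mem hout))
      simpa using this

end KS

/-! ### Limits of the equation in the upper half-plane -/

theorem norm_cauchyKer_le_div {a : ℂ} {y M : ℝ} (hy : 0 < y) (ha : y ≤ |a.im|) (hM : ‖a‖ ≤ M)
    (x : ℝ) : ‖cauchyKer a x‖ ≤ (1 + (1 + M) / y) / (1 + |x|) := by
  have h := one_add_abs_le_norm_sub hy ha hM x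
  have hne : a.im ≠ 0 := abs_pos.1 (hy.trans_le ha)
  have h0 : 0 < ‖(x : ℂ) - a‖ := norm_pos_iff.2 (ofReal_sub_ne_zero hne x)
  unfold cauchyKer
  rw [norm_div, norm_one, div_le_div_iff₀ h0 (by positivity)]
  linarith

theorem hasDerivAt_cauchyT {F : ℝ → ℂ} (hF : MemLp F 2 volume) {ζ : ℂ} (hζ : 0 < ζ.im) :
    HasDerivAt (cauchyT F) (cauchyT' F ζ) ζ := by
  set y := ζ.im / 2 with hy
  have hy0 : 0 < y := by positivity
  have him : ∀ t ∈ Metric.ball ζ y, y ≤ |t.im| := fun t ht => by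
    have h1 := (Complex.abs_im_le_norm (t - ζ)).trans_lt (by simpa [dist_eq_norm] using ht)
    rw [Complex.sub_im, abs_lt] at h1
    exact (by linarith [h1.1] : y ≤ t.im).trans (le_abs_self _)
  have hne : ∀ t ∈ Metric.ball ζ y, t.im ≠ 0 := fun t ht => abs_pos.1 (hy0.trans_le (him t ht))
  have hn : ∀ t ∈ Metric.ball ζ y, ‖t‖ ≤ ‖ζ‖ + y := fun t ht => by
    have h1 : ‖t - ζ‖ < y := by simpa [dist_eq_norm] using ht
    calc ‖t‖ = ‖(t - ζ) + ζ‖ := by congr 1; ring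
      _ ≤ _ := (norm_add_le _ _).trans (by linarith)
  set C := 1 + (1 + (‖ζ‖ + y)) / y with hC
  have hC0 : 0 ≤ C := by positivity
  have hG : MemLp (fun x : ℝ => ((C / (1 + |x|) : ℝ) : ℂ)) 2 volume := by
    refine memLp_two_of_le (C := C) (Continuous.aestronglyMeasurable ?_) fun x => ?_
    · exact Complex.continuous_ofReal.comp (continuous_const.div (by fun_prop)
        fun x => by positivity)
    · rw [Complex.norm_real, Real.norm_of_nonneg (by positivity)]
  have hint := ((hF.integrable_mul hG).norm.mul_const C)
  have key := hasDerivAt_integral_of_dominated_loc_of_deriv_le (μ := volume) (𝕜 := ℂ)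
    (F := fun t x => F x * cauchyKer t x) (F' := fun t x => F x * cauchyKer t x * cauchyKer t x)
    (x₀ := ζ) (Metric.ball_mem_nhds ζ hy0)
    (bound := fun x => ‖F x * ((C / (1 + |x|) : ℝ) : ℂ)‖ * C)
    (Eventually.mono (Metric.ball_mem_nhds ζ hy0) fun t ht =>
      (integrable_mul_cauchyKer hF (hne t ht)).aestronglyMeasurable)
    (integrable_mul_cauchyKer hF hζ.ne')
    (integrable_mul_cauchyKer (MemLp.mul_cauchyKer hF hζ.ne') hζ.ne').aestronglyMeasurable
    (ae_of_all _ fun x t ht => ?_) hint (ae_of_all _ fun x t ht => ?_)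
  · exact (key.2.const_mul _)
  · have h1 := norm_cauchyKer_le_div hy0 (him t ht) (hn t ht) x
    rw [norm_mul, norm_mul, norm_mul, Complex.norm_real, Real.norm_of_nonneg (by positivity)]
    refine mul_le_mul (mul_le_mul_of_nonneg_left h1 (norm_nonneg _))
      (h1.trans (div_le_self hC0 (by linarith [abs_nonneg x]))) (norm_nonneg _) (by positivity)
  · have h0 := ofReal_sub_ne_zero (hne t ht) x
    have h1 : HasDerivAt (fun t : ℂ => (x : ℂ) - t) (-1) t := by
      simpa using (hasDerivAt_id' t).const_sub (x : ℂ)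
    refine ((h1.fun_inv h0).const_mul (F x)).congr_deriv ?_ |>.congr_of_eventuallyEq ?_
    · unfold cauchyKer
      field_simp
    · exact Eventually.of_forall fun t => by simp [cauchyKer]

theorem norm_cauchyT'_le {F : ℝ → ℂ} {C y M : ℝ} (hF : ∀ x, ‖F x‖ ≤ C / (1 + |x|))
    {t : ℂ} (hy : 0 < y) (ht : y ≤ |t.im|) (hM : ‖t‖ ≤ M) :
    ‖cauchyT' F t‖ ≤ C * ((1 + (1 + M) / y) ^ 2 * ∫ x : ℝ, 1 / (1 + |x|) ^ 2) := by
  have hM0 : 0 ≤ M := (norm_nonneg _).trans hM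
  have hC0 : 0 ≤ C := by
    have := (norm_nonneg _).trans (hF 0); simpa using this
  set D := 1 + (1 + M) / y with hD
  have hD0 : 0 ≤ D := by positivity
  have h1 : ‖∫ x, F x * cauchyKer t x * cauchyKer t x‖
      ≤ ∫ x : ℝ, C * D ^ 2 * (1 / (1 + |x|) ^ 2) := by
    refine norm_integral_le_of_norm_le (integrable_inv_one_add_abs_sq.const_mul _)
      (ae_of_all _ fun x => ?_)
    have h2 := norm_cauchyKer_le_div hy ht hM x
    have hx : 1 ≤ 1 + |x| := by linarith [abs_nonneg x]
    rw [norm_mul, norm_mul]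
    calc _ ≤ C / (1 + |x|) * (D / (1 + |x|)) * D :=
          mul_le_mul (mul_le_mul (hF x) h2 (norm_nonneg _) (by positivity))
            (h2.trans (div_le_self hD0 hx)) (norm_nonneg _) (by positivity)
      _ = _ := by field_simp
  rw [integral_const_mul] at h1
  have h2 : ‖(2 * Real.pi * Complex.I : ℂ)⁻¹‖ ≤ 1 := by
    rw [norm_inv]
    refine inv_le_one_of_one_le₀ ?_
    simp only [norm_mul, Complex.norm_ofNat, Complex.norm_real, Complex.norm_I, mul_one,
      Real.norm_of_nonneg Real.pi_pos.le]
    linarith [Real.pi_gt_three]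
  rw [cauchyT', norm_mul]
  calc _ ≤ 1 * (C * D ^ 2 * ∫ x : ℝ, 1 / (1 + |x|) ^ 2) :=
        mul_le_mul h2 h1 (norm_nonneg _) zero_le_one
    _ = _ := by ring

namespace RatData
variable {u : ℝ → ℝ} (d : RatData u)

theorem continuousAt_ext {ζ : ℂ} (hζ : 0 < ζ.im) (hp : ∀ p, ζ ≠ d.z p) : ContinuousAt d.ext ζ := by
  unfold ext
  refine ContinuousAt.add ?_ ?_
  · exact tendsto_finsetSum _ fun p _ => ContinuousAt.div (by fun_prop) (by fun_prop)
      (sub_ne_zero.2 (hp p))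
  · exact tendsto_finsetSum _ fun p _ => ContinuousAt.div (by fun_prop) (by fun_prop)
      (sub_ne_zero.2 (d.ne_conj_z hζ p))

theorem add_I_ne_zero {ζ : ℂ} (hζ : 0 < ζ.im) : ζ + Complex.I ≠ 0 := fun h => by
  have := congrArg Complex.im h; simp at this; linarith

theorem exists_norm_src_le {K : Set ℂ} (hK : IsCompact K) (him : ∀ t ∈ K, 0 < t.im)
    (hp : ∀ t ∈ K, ∀ p, t ≠ d.z p) : ∃ V, ∀ M, ∀ (a : Fin d.P → ℂ) (κ : ℂ), ‖a‖ ≤ M → ‖κ‖ ≤ M →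
      ∀ t ∈ K, ‖d.src a κ t‖ ≤ M * V := by
  have hc : ContinuousOn (fun t => ∑ p, 1 / ‖t - d.z p‖ + 1 / ‖t + Complex.I‖) K := by
    refine (continuousOn_finsetSum _ fun p _ => ?_).add ?_
    · exact continuousOn_const.div (by fun_prop) fun t ht => norm_ne_zero_iff.2
        (sub_ne_zero.2 (hp t ht p))
    · exact continuousOn_const.div (by fun_prop) fun t ht => norm_ne_zero_iff.2
        (add_I_ne_zero (him t ht))
  obtain ⟨V, hV⟩ := hK.exists_bound_of_continuousOn hc
  refine ⟨V, fun M a κ ha hκ t ht => ?_⟩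
  have hM : 0 ≤ M := (norm_nonneg _).trans hκ
  have h1 := (le_abs_self _).trans (hV t ht)
  refine (norm_sub_le _ _).trans (le_trans ?_ (mul_le_mul_of_nonneg_left h1 hM))
  rw [mul_add, Finset.mul_sum]
  refine add_le_add ((norm_sum_le _ _).trans (Finset.sum_le_sum fun p _ => ?_)) ?_
  · rw [norm_div, div_eq_mul_one_div]
    exact mul_le_mul_of_nonneg_right ((norm_le_pi_norm a p).trans ha) (by positivity)
  · rw [norm_div, div_eq_mul_one_div]
    exact mul_le_mul_of_nonneg_right hκ (by positivity)

theorem tendsto_src_of_tendsto {a : ℕ → Fin d.P → ℂ} {κ : ℕ → ℂ} {a₀ : Fin d.P → ℂ} {κ₀ : ℂ}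
    (ha : Tendsto a atTop (𝓝 a₀)) (hκ : Tendsto κ atTop (𝓝 κ₀)) (ζ : ℂ) :
    Tendsto (fun n => d.src (a n) (κ n) ζ) atTop (𝓝 (d.src a₀ κ₀ ζ)) :=
  (tendsto_finsetSum _ fun p _ => (tendsto_pi_nhds.1 ha p).div_const _).sub (hκ.div_const _)

end RatData

namespace KS
variable {u : ℝ → ℝ} {S : KS u}

/-- Zeros of `u + ev` are roots of a nonzero polynomial, hence isolated. -/
theorem eventually_ext_add_ne_zero (S : KS u) {ev : ℝ} (h : ev ∈ bulk u) {ζ : ℂ} (hζ : 0 < ζ.im)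
    (hp : ∀ p, ζ ≠ S.z p) : ∀ᶠ t in 𝓝 ζ, 0 < t.im ∧ (∀ p, t ≠ S.z p) ∧
      (t ≠ ζ → S.ext t + ev ≠ 0) := by
  have hne : S.char ev ≠ 0 := fun h0 => by
    have h1 := S.eval_char_ofReal ev S.xc
    rw [h0, Polynomial.eval_zero] at h1
    refine (mul_ne_zero (mul_ne_zero (S.eval_den_ne (S.ofReal_ne_z _))
      (S.eval_den_map_ne (S.ofReal_ne_conj_z _))) ?_) h1.symm
    exact_mod_cast (S.u_add_pos h (S.xMinus_lt h) (S.lt_xPlus h)).ne'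
  have hfin : ({t | (S.char ev).IsRoot t} \ {ζ}).Finite :=
    (Polynomial.finite_setOfPred_isRoot hne).subset sdiff_subset
  have h5 : ∀ᶠ t in 𝓝 ζ, ∀ p, t ≠ S.z p := eventually_all.2 fun p => isOpen_ne.mem_nhds (hp p)
  filter_upwards [hfin.isClosed.isOpen_compl.mem_nhds (by simp), h5,
    (isOpen_lt continuous_const Complex.continuous_im).mem_nhds hζ] with t h1 h2 h3
  refine ⟨h3, h2, fun h4 h6 => h1 ⟨?_, h4⟩⟩
  change (S.char ev).eval t = 0
  rw [S.eval_char h2 (S.ne_conj_z h3), h6, mul_zero]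

/-- In the semiclassical limit the source vanishes where `u + lam₀` does, to the same order. -/
theorem SolSeq.isBigO {lam₀ : ℝ} {a₀ : Fin S.P → ℂ} {κ₀ : ℂ} {ε lam : ℕ → ℝ}
    {a : ℕ → Fin S.P → ℂ} {κ : ℕ → ℂ} {F : ℕ → ℝ → ℂ} (h : S.SolSeq lam₀ a₀ κ₀ ε lam a κ F)
    (ζ : ℂ) (hζ : 0 < ζ.im) (hp : ∀ p, ζ ≠ S.z p) :
    (fun t => S.src a₀ κ₀ t) =O[𝓝 ζ] fun t => S.ext t + lam₀ := by
  obtain ⟨r, hr, hball⟩ := Metric.nhds_basis_closedBall.eventually_iff.1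
    (S.eventually_ext_add_ne_zero h.bulk₀ hζ hp)
  have hK : IsCompact (Metric.closedBall ζ r) := isCompact_closedBall _ _
  have hext : ContinuousOn S.ext (Metric.closedBall ζ r) := fun t ht =>
    (S.continuousAt_ext (hball ht).1 (hball ht).2.1).continuousWithinAt
  -- On the circle `u + λ₀` is bounded away from zero, although it may vanish at the centre.
  obtain ⟨m, hm, hmb⟩ := (isCompact_sphere ζ r).exists_forall_le' (a := 0)
    (f := fun t => ‖S.ext t + lam₀‖)
    ((hext.mono Metric.sphere_subset_closedBall).add continuousOn_const).norm
    fun t ht => norm_pos_iff.2 ((hball (Metric.sphere_subset_closedBall ht)).2.2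
      (Metric.ne_of_mem_sphere ht hr.ne'))
  obtain ⟨y, hy, hyb⟩ := hK.exists_forall_le' (a := 0) (f := Complex.im)
    Complex.continuous_im.continuousOn fun t ht => (hball ht).1
  obtain ⟨C, hC, hdec⟩ := h.exists_decay
  obtain ⟨M, B, -, hM, -⟩ := h.exists_bound
  obtain ⟨V, hV⟩ := S.exists_norm_src_le hK (fun t ht => (hball ht).1) fun t ht => (hball ht).2.1
  set D := C * ((1 + (1 + (‖ζ‖ + r)) / y) ^ 2 * ∫ x : ℝ, 1 / (1 + |x|) ^ 2) with hD
  -- The solutions are `O(1/√ε)` on the line, so `ε` times the derivative of the Cauchy transform is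
  -- `O(√ε)`.
  have hder : ∀ᶠ n in atTop, ∀ t ∈ Metric.closedBall ζ r,
      ‖(Complex.I * ε n) * cauchyT' (F n) t‖ ≤ D * √(ε n) := by
    filter_upwards [hdec] with n hn t ht
    have hs := h.sqrt_pos n
    have h1 : ∀ x, ‖F n x‖ ≤ C / √(ε n) / (1 + |x|) := fun x => by
      rw [div_right_comm, le_div_iff₀ hs, mul_comm]
      exact hn x
    have h2 : ‖t‖ ≤ ‖ζ‖ + r := by
      have h3 : ‖t - ζ‖ ≤ r := by simpa [dist_eq_norm] using ht
      calc ‖t‖ = ‖(t - ζ) + ζ‖ := by congr 1; ring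
        _ ≤ _ := (norm_add_le _ _).trans (by linarith)
    have h4 := norm_cauchyT'_le h1 hy ((hyb t ht).trans (le_abs_self _)) h2
    have h5 : √(ε n) * √(ε n) = ε n := Real.mul_self_sqrt (h.pos n).le
    rw [norm_mul, norm_mul, Complex.norm_I, one_mul, Complex.norm_real,
      Real.norm_of_nonneg (h.pos n).le]
    calc _ ≤ ε n * _ := mul_le_mul_of_nonneg_left h4 (h.pos n).le
      _ = D * √(ε n) := by
        rw [hD]
        nth_rw 1 [← h5]
        field_simp
  set H := (M * V + |D|) / (m / 2) with hH
  have hbound : ∀ᶠ n in atTop, ∀ t ∈ Metric.closedBall ζ r, ‖cauchyT (F n) t‖ ≤ H := by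
    filter_upwards [hder, h.eps.eventually (gt_mem_nhds one_pos),
      Metric.tendsto_nhds.1 h.lim (m / 2) (by positivity)] with n hn hn1 hn2 t ht
    have hs1 : √(ε n) ≤ 1 := by simpa using Real.sqrt_le_sqrt hn1.le
    have hs := h.sqrt_pos n
    -- On the circle the equation can be solved for the Cauchy transform. The maximum principle
    -- carries the bound into the disc, where division by `u + λ` is not possible.
    refine Complex.norm_le_of_forall_mem_frontier_norm_le (U := Metric.ball ζ r)
      Metric.isBounded_ball (f := cauchyT (F n)) ?_ ?_ (by rwa [closure_ball ζ hr.ne'])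
    · refine DifferentiableOn.diffContOnCl fun s hs => ?_
      rw [closure_ball ζ hr.ne'] at hs
      exact (hasDerivAt_cauchyT (h.sol n).memLp (hball hs).1).differentiableAt.differentiableWithinAt
    · rw [frontier_ball ζ hr.ne']
      intro s hs'
      have hsb := Metric.sphere_subset_closedBall hs'
      have heq := (h.sol n).cauchy s (hball hsb).1 fun p => ((hball hsb).2.1 p).symm
      have h1 : (S.ext s + lam n) * cauchyT (F n) s
          = S.src (a n) (κ n) s - (Complex.I * ε n) * cauchyT' (F n) s := by
        linear_combination -heq
      have h2 : m / 2 ≤ ‖S.ext s + lam n‖ := by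
        have h3 := hmb s hs'
        have h4 : ‖S.ext s + lam₀‖ ≤ ‖S.ext s + lam n‖ + |lam n - lam₀| := by
          rw [← Real.norm_eq_abs, ← Complex.norm_real]
          calc _ = ‖(S.ext s + lam n) - ((lam n - lam₀ : ℝ) : ℂ)‖ := by
                congr 1; push_cast; ring
            _ ≤ _ := norm_sub_le _ _
        rw [Real.dist_eq] at hn2
        linarith
      have h5 : m / 2 * ‖cauchyT (F n) s‖ ≤ M * V + |D| := by
        calc _ ≤ ‖S.ext s + lam n‖ * ‖cauchyT (F n) s‖ :=
              mul_le_mul_of_nonneg_right h2 (norm_nonneg _)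
          _ = ‖S.src (a n) (κ n) s - (Complex.I * ε n) * cauchyT' (F n) s‖ := by
              rw [← norm_mul, h1]
          _ ≤ M * V + D * √(ε n) := (norm_sub_le _ _).trans
              (add_le_add (hV M _ _ (hM n).1 (hM n).2 s hsb) (hn s hsb))
          _ ≤ M * V + |D| := by
              have : D * √(ε n) ≤ |D| * 1 :=
                mul_le_mul (le_abs_self _) hs1 hs.le (abs_nonneg _)
              linarith
      rw [hH, le_div_iff₀ (by positivity), mul_comm]
      exact h5
  -- With the transform bounded by `H`, letting `n` tend to infinity in the equation bounds the
  -- limiting source by `H` times `u + λ₀`.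
  refine IsBigO.of_bound H ?_
  filter_upwards [Metric.closedBall_mem_nhds ζ hr] with t ht
  have hlim1 := (S.toRatData.tendsto_src_of_tendsto h.a_lim h.κ_lim t).norm
  have hlim2 : Tendsto (fun n => H * ‖S.ext t + lam n‖ + D * √(ε n)) atTop
      (𝓝 (H * ‖S.ext t + lam₀‖ + D * 0)) :=
    ((((Complex.continuous_ofReal.tendsto _).comp h.lim).const_add _).norm.const_mul _).add
      (h.tendsto_sqrt.const_mul _)
  rw [mul_zero, add_zero] at hlim2
  refine le_of_tendsto_of_tendsto hlim1 hlim2 ?_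
  filter_upwards [hder, hbound] with n h1 h2
  have heq := (h.sol n).cauchy t (hball ht).1 fun p => ((hball ht).2.1 p).symm
  have h3 : S.src (a n) (κ n) t
      = (S.ext t + lam n) * cauchyT (F n) t + (Complex.I * ε n) * cauchyT' (F n) t := by
    linear_combination heq
  rw [h3]
  refine (norm_add_le _ _).trans (add_le_add ?_ (h1 t ht))
  rw [norm_mul, mul_comm]
  exact mul_le_mul_of_nonneg_right (h2 t ht) (norm_nonneg _)

end KS

/-! ### Quantization, separation and existence of eigenvalues -/

theorem integral_exp_ofReal_mul_I {p q σ : ℝ} (hσ : σ ≠ 0) :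
    ∫ x in p..q, Complex.exp (σ * x * Complex.I)
      = (Complex.exp (σ * q * Complex.I) - Complex.exp (σ * p * Complex.I)) / (σ * Complex.I) := by
  have hc : (σ * Complex.I : ℂ) ≠ 0 := by simp [hσ]
  have h := integral_exp_mul_complex (a := p) (b := q) hc
  have h1 : ∀ x : ℝ, (σ * x * Complex.I : ℂ) = σ * Complex.I * x := fun x => by ring
  simp_rw [h1]
  exact h

theorem integral_exp_ne_zero {p q σ : ℝ} (hpq : p < q) (hσ : 0 ≤ σ)
    (h : σ * (q - p) < 2 * Real.pi) : ∫ x in p..q, Complex.exp (σ * x * Complex.I) ≠ 0 := by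
  rcases eq_or_lt_of_le hσ with rfl | hσ0
  · simp only [Complex.ofReal_zero, zero_mul, Complex.exp_zero, intervalIntegral.integral_const,
      Complex.real_smul, mul_one, ne_eq, Complex.ofReal_eq_zero]
    linarith
  · rw [integral_exp_ofReal_mul_I hσ0.ne']
    refine div_ne_zero (sub_ne_zero.2 fun h1 => ?_) (by simp [hσ0.ne'])
    obtain ⟨n, hn⟩ := Complex.exp_eq_exp_iff_exists_int.1 h1
    have h2 : σ * (q - p) = n * (2 * Real.pi) := by
      have h3 : (σ * (q - p) : ℂ) * Complex.I = (n * (2 * Real.pi)) * Complex.I := by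
        linear_combination hn
      have := mul_right_cancel₀ Complex.I_ne_zero h3
      exact_mod_cast this
    have h4 : 0 < σ * (q - p) := mul_pos hσ0 (by linarith)
    have hpi := Real.pi_pos
    rw [h2] at h4 h
    have h5 : (0 : ℝ) < n := pos_of_mul_pos_left h4 (by positivity)
    have h6 : (n : ℝ) < 1 := by nlinarith
    have h7 : 0 < n := by exact_mod_cast h5
    have h8 : n < 1 := by exact_mod_cast h6
    omega

theorem integral_exp_eq_zero {p q σ : ℝ} (h : σ * (q - p) = 2 * Real.pi) :
    ∫ x in p..q, Complex.exp (σ * x * Complex.I) = 0 := by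
  have hσ : σ ≠ 0 := by
    rintro rfl
    rw [zero_mul] at h
    linarith [Real.pi_pos]
  rw [integral_exp_ofReal_mul_I hσ, div_eq_zero_iff, sub_eq_zero]
  left
  rw [Complex.exp_eq_exp_iff_exists_int]
  refine ⟨1, ?_⟩
  have h1 : (σ * (q - p) : ℂ) = 2 * Real.pi := by exact_mod_cast h
  push_cast
  linear_combination Complex.I * h1

/-- Without a source the rotating frame is constant, so `F` has constant modulus, and square
integrability leaves only zero. -/
theorem RatData.Sol.eq_zero {u : ℝ → ℝ} (d : RatData u) {ε lam : ℝ} (hε : 0 < ε) {F : ℝ → ℂ}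
    (h : d.Sol ε lam 0 0 F) : F = 0 := by
  have hz : ∀ x : ℝ, d.src 0 0 x = 0 := fun x => by simp [src]
  have hd : ∀ x, HasDerivAt (frame u ε lam F) 0 x := fun x => by
    simpa [hz] using RatData.Sol.hasDerivAt_frame d hε h x
  have hc : ∀ x y, frame u ε lam F x = frame u ε lam F y :=
    is_const_of_deriv_eq_zero (fun x => (hd x).differentiableAt) fun x => (hd x).deriv
  have hn : ∀ x y, ‖F x‖ = ‖F y‖ := fun x y => by
    have := congrArg norm (hc x y)
    rw [norm_frame u hε, norm_frame u hε] at this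
    exact mul_left_cancel₀ hε.ne' this
  funext x
  refine norm_le_zero_iff.1 (le_of_forall_pos_le_add fun η hη => ?_)
  obtain ⟨y, -, hy⟩ := exists_norm_lt_of_memLp h.memLp MeasurableSet.univ (by simp) hη
  rw [hn x y, zero_add]
  exact hy.le

/-- The source of an eigenfunction is nonzero, so it can be normalised in place of the function.
This gives compactness, since sources live in a fixed finite-dimensional space. -/
theorem RatData.exists_normalized {u : ℝ → ℝ} (d : RatData u) {ε lam : ℝ} (hε : 0 < ε)
    (h : IsEigenvalue ε u lam) : ∃ (a : Fin d.P → ℂ) (F : ℝ → ℂ), ‖a‖ = 1 ∧ d.Sol ε lam a 0 F := by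
  obtain ⟨F, hF, hs⟩ := d.exists_sol_of_isEigenvalue hε.ne' h
  set a := fun p => d.c p * cauchyT F (d.z p)
  have ha : a ≠ 0 := fun h0 => by
    rw [h0] at hs
    have := RatData.Sol.eq_zero d hε hs
    rw [this] at hF
    exact hF (ae_eq_refl _)
  have h1 := RatData.Sol.smul d hs ((‖a‖⁻¹ : ℝ) : ℂ)
  rw [mul_zero] at h1
  refine ⟨_, _, ?_, h1⟩
  change ‖((‖a‖⁻¹ : ℝ) : ℂ) • a‖ = 1
  rw [norm_smul, Complex.norm_real, norm_inv, norm_norm, inv_mul_cancel₀ (norm_ne_zero_iff.2 ha)]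

namespace KS
variable {u : ℝ → ℝ} {S : KS u}

/-- By the connection formula the amplitudes vanish together. The limiting source would then vanish
at both turning points and at the zeros above the axis, hence identically. -/
theorem SolSeq.amp_ne_zero {lam₀ : ℝ} {a₀ : Fin S.P → ℂ} {κ₀ : ℂ} {ε lam : ℕ → ℝ}
    {a : ℕ → Fin S.P → ℂ} {κ : ℕ → ℂ} {F : ℕ → ℝ → ℂ} (h : S.SolSeq lam₀ a₀ κ₀ ε lam a κ F)
    (hne : a₀ ≠ 0 ∨ κ₀ ≠ 0) : S.ampL lam₀ a₀ κ₀ ≠ 0 ∧ S.ampR lam₀ a₀ κ₀ ≠ 0 := by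
  have h1 := h.tendsto_connection
  have h2 : S.ampL lam₀ a₀ κ₀ = 0 ↔ S.ampR lam₀ a₀ κ₀ = 0 := by
    constructor <;> intro h3 <;> rw [h3] at h1
    · have h4 := h1.norm
      simp only [zero_add, norm_mul, norm_osc, one_mul, norm_zero] at h4
      exact norm_eq_zero.1 (tendsto_nhds_unique tendsto_const_nhds h4)
    · simp only [mul_zero, add_zero] at h1
      exact tendsto_nhds_unique tendsto_const_nhds h1
  have h3 : S.ampL lam₀ a₀ κ₀ ≠ 0 := fun h4 => by
    have h5 := S.src_eq_zero h.bulk₀ ((S.ampL_eq_zero_iff h.bulk₀).1 h4)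
      ((S.ampR_eq_zero_iff h.bulk₀).1 (h2.1 h4)) h.isBigO
    exact hne.elim (fun h6 => h6 h5.1) fun h6 => h6 h5.2
  exact ⟨h3, fun h4 => h3 (h2.2 h4)⟩

theorem SolSeq.tendsto_osc {lam₀ : ℝ} {a₀ : Fin S.P → ℂ} {κ₀ : ℂ} {ε lam : ℕ → ℝ}
    {a : ℕ → Fin S.P → ℂ} {κ : ℕ → ℂ} {F : ℕ → ℝ → ℂ} (h : S.SolSeq lam₀ a₀ κ₀ ε lam a κ F)
    (hne : a₀ ≠ 0 ∨ κ₀ ≠ 0) : Tendsto (fun n => osc (ε n) (action u (lam n))) atTop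
      (𝓝 (-S.ampL lam₀ a₀ κ₀ / S.ampR lam₀ a₀ κ₀)) := by
  have h0 := (h.amp_ne_zero hne).2
  have h1 := (h.tendsto_connection.sub_const (S.ampL lam₀ a₀ κ₀)).div_const (S.ampR lam₀ a₀ κ₀)
  rw [zero_sub] at h1
  refine h1.congr fun n => ?_
  field_simp
  ring

/-- Admissible homogeneous sources form a space of dimension at most one: the combination that
cancels at the left turning point is zero, hence also cancels at the right one. -/
theorem ampL_mul_ampR_eq {lam₀ : ℝ} {a₀ a₁ : Fin S.P → ℂ} (hb : lam₀ ∈ bulk u)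
    (h0 : ∀ ζ : ℂ, 0 < ζ.im → (∀ p, ζ ≠ S.z p) →
      (fun t => S.src a₀ 0 t) =O[𝓝 ζ] fun t => S.ext t + lam₀)
    (h1 : ∀ ζ : ℂ, 0 < ζ.im → (∀ p, ζ ≠ S.z p) →
      (fun t => S.src a₁ 0 t) =O[𝓝 ζ] fun t => S.ext t + lam₀) :
    S.ampL lam₀ a₀ 0 * S.ampR lam₀ a₁ 0 = S.ampL lam₀ a₁ 0 * S.ampR lam₀ a₀ 0 := by
  set s := S.src a₀ 0 (xMinus u lam₀)
  set t := S.src a₁ 0 (xMinus u lam₀)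
  have hlin : ∀ ζ, S.src (fun p => s * a₁ p - t * a₀ p) 0 ζ = s * S.src a₁ 0 ζ - t * S.src a₀ 0 ζ :=
    fun ζ => by
      simp only [RatData.src, zero_div, sub_zero, Finset.mul_sum, ← Finset.sum_sub_distrib]
      exact Finset.sum_congr rfl fun p _ => by ring
  have h2 := S.src_eq_zero_of_left hb (a := fun p => s * a₁ p - t * a₀ p)
    (by rw [hlin]; exact sub_eq_zero.2 (mul_comm s t)) fun ζ hζ hp => by
      simp_rw [hlin]
      exact ((h1 ζ hζ hp).const_mul_left s).sub ((h0 ζ hζ hp).const_mul_left t)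
  have h3 := hlin (xPlus u lam₀)
  rw [h2] at h3
  have h4 : S.src (0 : Fin S.P → ℂ) 0 (xPlus u lam₀) = 0 := by simp [RatData.src]
  rw [h4] at h3
  rw [ampL, ampL, ampR, ampR]
  change s * _ * _ = t * _ * _
  linear_combination -(fresnel (deriv u (xMinus u lam₀)) * fresnel (deriv u (xPlus u lam₀))) * h3

/-- The quantization condition: normalised homogeneous solutions force the phase of the action. -/
theorem exists_ratio (S : KS u) (lam₀ : ℝ) : ∃ R : ℂ, ‖R‖ = 1 ∧
    ∀ (a₀ : Fin S.P → ℂ) (ε lam : ℕ → ℝ) (a : ℕ → Fin S.P → ℂ) (κ : ℕ → ℂ) (F : ℕ → ℝ → ℂ),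
      S.SolSeq lam₀ a₀ 0 ε lam a κ F → a₀ ≠ 0 →
      Tendsto (fun n => osc (ε n) (action u (lam n))) atTop (𝓝 R) := by
  by_cases hex : ∃ (a₀ : Fin S.P → ℂ) (ε lam : ℕ → ℝ) (a : ℕ → Fin S.P → ℂ) (κ : ℕ → ℂ)
      (F : ℕ → ℝ → ℂ), S.SolSeq lam₀ a₀ 0 ε lam a κ F ∧ a₀ ≠ 0
  · obtain ⟨a₁, ε₁, lam₁, a', κ₁, F₁, h₁, hne₁⟩ := hex
    have hlim := h₁.tendsto_osc (Or.inl hne₁)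
    refine ⟨-S.ampL lam₀ a₁ 0 / S.ampR lam₀ a₁ 0, ?_, fun a₀ ε lam a κ F h hne => ?_⟩
    · have := hlim.norm
      simp only [norm_osc] at this
      exact (tendsto_nhds_unique tendsto_const_nhds this).symm
    · have := h.tendsto_osc (Or.inl hne)
      have h2 := ampL_mul_ampR_eq h.bulk₀ h.isBigO h₁.isBigO
      convert this using 2
      rw [div_eq_div_iff (h₁.amp_ne_zero (Or.inl hne₁)).2 (h.amp_ne_zero (Or.inl hne)).2]
      linear_combination h2
  · push Not at hex
    -- If there is no such sequence the condition is vacuous and any unimodular number serves.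
    exact ⟨1, norm_one, fun a₀ ε lam a κ F h hne => absurd (hex a₀ ε lam a κ F h) hne⟩

/-- The phase of the action forced at eigenvalues near `lam₀`. -/
def ratio (S : KS u) (lam₀ : ℝ) : ℂ := (S.exists_ratio lam₀).choose

theorem norm_ratio (S : KS u) (lam₀ : ℝ) : ‖S.ratio lam₀‖ = 1 := (S.exists_ratio lam₀).choose_spec.1

theorem SolSeq.tendsto_ratio {lam₀ : ℝ} {a₀ : Fin S.P → ℂ} {ε lam : ℕ → ℝ}
    {a : ℕ → Fin S.P → ℂ} {κ : ℕ → ℂ} {F : ℕ → ℝ → ℂ} (h : S.SolSeq lam₀ a₀ 0 ε lam a κ F)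
    (hne : a₀ ≠ 0) : Tendsto (fun n => osc (ε n) (action u (lam n))) atTop (𝓝 (S.ratio lam₀)) :=
  (S.exists_ratio lam₀).choose_spec.2 _ _ _ _ _ _ h hne

theorem norm_eq_one_of_tendsto {a : ℕ → Fin S.P → ℂ} {a₀ : Fin S.P → ℂ} (h : ∀ n, ‖a n‖ = 1)
    (ha : Tendsto a atTop (𝓝 a₀)) : a₀ ≠ 0 := by
  have := ha.norm
  simp only [h] at this
  exact norm_ne_zero_iff.1 (by rw [← tendsto_nhds_unique tendsto_const_nhds this]; norm_num)

/-- Eigenvalues satisfy the quantization condition approximately. -/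
theorem eventually_osc_near (S : KS u) {lam₀ : ℝ} (hb : lam₀ ∈ bulk u) {δ : ℝ} (hδ : 0 < δ) :
    ∀ᶠ q : ℝ × ℝ in 𝓝[>] 0 ×ˢ 𝓝 lam₀, IsEigenvalue q.1 u q.2 →
      ‖osc q.1 (action u q.2) - S.ratio lam₀‖ < δ := by
  -- A failure produces eigenvalues along a sequence. Compactness of normalised sources yields a
  -- convergent subsequence, to which the limiting condition applies.
  by_contra hcon
  have hev : ∀ᶠ q : ℝ × ℝ in 𝓝[>] 0 ×ˢ 𝓝 lam₀, 0 < q.1 ∧ q.2 ∈ bulk u :=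
    (eventually_nhdsWithin_of_forall fun x hx => hx).prod_mk (isOpen_bulk.mem_nhds hb)
  obtain ⟨s, hs, hsP⟩ := exists_seq_forall_of_frequently
    ((not_eventually.1 hcon).and_eventually hev)
  rw [tendsto_prod_iff'] at hs
  choose a F ha hsol using fun n => S.toRatData.exists_normalized (hsP n).2.1
    (Classical.not_imp.1 (hsP n).1).1
  obtain ⟨a₀, -, φ, hφ, hlim⟩ := tendsto_subseq_of_bounded (x := a)
    (Metric.isBounded_closedBall (x := 0) (r := 1)) fun n => by simp [ha n]
  have hseq : S.SolSeq lam₀ a₀ 0 (fun n => (s (φ n)).1) (fun n => (s (φ n)).2) (a ∘ φ)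
      (fun _ => 0) (F ∘ φ) :=
    ⟨hb, fun n => (hsP _).2.2, fun n => (hsP _).2.1,
      (hs.1.mono_right nhdsWithin_le_nhds).comp hφ.tendsto_atTop, hs.2.comp hφ.tendsto_atTop, hlim,
      tendsto_const_nhds, fun n => hsol _⟩
  have h1 := hseq.tendsto_ratio (norm_eq_one_of_tendsto (fun n => ha _) hlim)
  obtain ⟨n, hn⟩ := (Metric.tendsto_nhds.1 h1 δ hδ).exists
  rw [dist_eq_norm] at hn
  exact (Classical.not_imp.1 (hsP (φ n)).1).2 hn

theorem width_pos (S : KS u) {lam : ℝ} (h : lam ∈ bulk u) : 0 < xPlus u lam - xMinus u lam :=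
  sub_pos.2 (S.xMinus_lt_xPlus h)

/-- Distinct eigenvalues are separated. -/
theorem eventually_separated (S : KS u) {lam₀ : ℝ} (hb : lam₀ ∈ bulk u) :
    ∀ᶠ q : ℝ × ℝ × ℝ in 𝓝[>] 0 ×ˢ (𝓝 lam₀ ×ˢ 𝓝 lam₀), IsEigenvalue q.1 u q.2.1 →
      IsEigenvalue q.1 u q.2.2 → q.2.1 < q.2.2 → q.1 ≤ action u q.2.2 - action u q.2.1 := by
  by_contra hcon
  have hbn : ∀ᶠ t in 𝓝 lam₀, t ∈ bulk u := isOpen_bulk.mem_nhds hb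
  have hev : ∀ᶠ q : ℝ × ℝ × ℝ in 𝓝[>] 0 ×ˢ (𝓝 lam₀ ×ˢ 𝓝 lam₀),
      0 < q.1 ∧ q.2.1 ∈ bulk u ∧ q.2.2 ∈ bulk u :=
    (eventually_nhdsWithin_of_forall fun x hx => hx).prod_mk (hbn.prod_mk hbn)
  obtain ⟨s, hs, hsP⟩ := exists_seq_forall_of_frequently
    ((not_eventually.1 hcon).and_eventually hev)
  rw [tendsto_prod_iff', tendsto_prod_iff'] at hs
  obtain ⟨hs1, hs2, hs3⟩ := hs
  have hpos : ∀ n, 0 < (s n).1 := fun n => (hsP n).2.1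
  have hb1 : ∀ n, (s n).2.1 ∈ bulk u := fun n => (hsP n).2.2.1
  have hb2 : ∀ n, (s n).2.2 ∈ bulk u := fun n => (hsP n).2.2.2
  simp only [Classical.not_imp, not_le] at hsP
  choose a F ha hsol using fun n => S.toRatData.exists_normalized (hpos n) (hsP n).1.1
  choose a' F' ha' hsol' using fun n => S.toRatData.exists_normalized (hpos n) (hsP n).1.2.1
  set D := xPlus u lam₀ - xMinus u lam₀ with hD
  have hD0 : 0 < D := S.width_pos hb
  have hw : Tendsto (fun n => 1 / (xPlus u (s n).2.1 - xMinus u (s n).2.1)) atTop (𝓝 (1 / D)) :=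
    tendsto_const_nhds.div ((S.continuousAt_width hb).tendsto.comp hs2) hD0.ne'
  have hle : ∀ n, ((s n).2.2 - (s n).2.1) / (s n).1
      ≤ 1 / (xPlus u (s n).2.1 - xMinus u (s n).2.1) := fun n => by
    rw [div_le_div_iff₀ (hpos n) (S.width_pos (hb1 n)), one_mul]
    exact (S.action_sub_ge (hb1 n) (hb2 n)).trans (hsP n).1.2.2.2.le
  have hge : ∀ n, 0 ≤ ((s n).2.2 - (s n).2.1) / (s n).1 := fun n =>
    div_nonneg (by linarith [(hsP n).1.2.2.1]) (hpos n).le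
  obtain ⟨W, hW⟩ := (Metric.isBounded_range_of_tendsto _ hw).exists_norm_le
  have hle' : ∀ n, ((s n).2.2 - (s n).2.1) / (s n).1 ≤ W := fun n =>
    (hle n).trans ((le_abs_self _).trans (hW _ (mem_range_self n)))
  obtain ⟨⟨a₀, a₀', σ⟩, -, φ, hφ, hlim⟩ := tendsto_subseq_of_bounded
    (x := fun n => (a n, a' n, ((s n).2.2 - (s n).2.1) / (s n).1))
    ((Metric.isBounded_closedBall (x := (0 : Fin S.P → ℂ)) (r := 1)).prod
      ((Metric.isBounded_closedBall (x := (0 : Fin S.P → ℂ)) (r := 1)).prod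
        (Metric.isBounded_Icc 0 W)))
    fun n => by simp [ha n, ha' n, hge n, hle' n]
  rw [nhds_prod_eq, nhds_prod_eq, tendsto_prod_iff', tendsto_prod_iff'] at hlim
  obtain ⟨hl1, hl2, hl3⟩ := hlim
  have hφt := hφ.tendsto_atTop
  have hε0 := (hs1.mono_right nhdsWithin_le_nhds).comp hφt
  have hseq : S.SolSeq lam₀ a₀ 0 (fun n => (s (φ n)).1) (fun n => (s (φ n)).2.1) (a ∘ φ)
      (fun _ => 0) (F ∘ φ) :=
    ⟨hb, fun n => hb1 _, fun n => hpos _, hε0, hs2.comp hφt, hl1, tendsto_const_nhds,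
      fun n => hsol _⟩
  have hseq' : S.SolSeq lam₀ a₀' 0 (fun n => (s (φ n)).1) (fun n => (s (φ n)).2.2) (a' ∘ φ)
      (fun _ => 0) (F' ∘ φ) :=
    ⟨hb, fun n => hb2 _, fun n => hpos _, hε0, hs3.comp hφt, hl2, tendsto_const_nhds,
      fun n => hsol' _⟩
  have hin := S.tendsto_inner hseq hseq' hl3
  -- The Lagrange identity for homogeneous solutions at distinct levels is orthogonality.
  have horth : ∀ n, ∫ x, (starRingEnd ℂ) ((F ∘ φ) n x) * (F' ∘ φ) n x = 0 := fun n => by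
    have h1 := RatData.Sol.lagrange _ (hpos (φ n)).ne' (hsol (φ n)) (hsol' (φ n))
    simp only [map_zero, zero_mul, sub_zero, mul_eq_zero] at h1
    refine h1.resolve_left (sub_ne_zero.2 ?_)
    exact_mod_cast (hsP (φ n)).1.2.2.1.ne'
  simp only [horth, norm_zero, mul_zero] at hin
  have h0 := tendsto_nhds_unique tendsto_const_nhds hin
  have hσ0 : 0 ≤ σ := ge_of_tendsto' hl3 fun n => hge _
  have hσ1 : σ ≤ 1 / D := le_of_tendsto_of_tendsto' hl3 (hw.comp hφt) fun n => hle _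
  -- The bound `σ D ≤ 1` keeps the exponential integral over the well away from its first zero at
  -- `2π`.
  have hσD : σ * (xPlus u lam₀ - xMinus u lam₀) < 2 * Real.pi := by
    rw [le_div_iff₀ hD0] at hσ1
    linarith [Real.pi_gt_three]
  have h1 := (hseq.amp_ne_zero (Or.inl (norm_eq_one_of_tendsto (fun n => ha _) hl1))).1
  have h2 := (hseq'.amp_ne_zero (Or.inl (norm_eq_one_of_tendsto (fun n => ha' _) hl2))).1
  have h3 := integral_exp_ne_zero (S.xMinus_lt_xPlus hb) hσ0 hσD
  exact (mul_ne_zero (mul_ne_zero (norm_ne_zero_iff.2 h1) (norm_ne_zero_iff.2 h2))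
    (norm_ne_zero_iff.2 h3)) h0.symm

/-- If the sources were unbounded, dividing by their norm would make the inhomogeneity disappear in
the limit. A normalised homogeneous limit forces the phase to approach the ratio, which the
hypothesis forbids. -/
theorem exists_bound_of_phase (S : KS u) {lam₀ : ℝ} (hb : lam₀ ∈ bulk u) {ε lam : ℕ → ℝ}
    {a : ℕ → Fin S.P → ℂ} {F : ℕ → ℝ → ℂ} (hpos : ∀ n, 0 < ε n) (hbn : ∀ n, lam n ∈ bulk u)
    (hε : Tendsto ε atTop (𝓝 0)) (hlam : Tendsto lam atTop (𝓝 lam₀))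
    (hsol : ∀ n, S.Sol (ε n) (lam n) (a n) 1 (F n))
    (hphase : ∀ n, 1 ≤ ‖osc (ε n) (action u (lam n)) - S.ratio lam₀‖) :
    ∃ M, ∀ᶠ n in atTop, ‖a n‖ ≤ M := by
  by_contra! hcon
  obtain ⟨φ, hφ, hbig⟩ := extraction_forall_of_frequently (P := fun n k => ((n : ℝ) + 1) < ‖a k‖)
    fun n => hcon _
  have hφt := hφ.tendsto_atTop
  have hnpos : ∀ n, 0 < ‖a (φ n)‖ := fun n => lt_trans (by positivity) (hbig n)
  set t : ℕ → ℂ := fun n => ((‖a (φ n)‖⁻¹ : ℝ) : ℂ) with ht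
  have hsol' := fun n => RatData.Sol.smul S.toRatData (hsol (φ n)) (t n)
  have hn : ∀ n, ‖(fun p => t n * a (φ n) p)‖ = 1 := fun n => by
    change ‖t n • a (φ n)‖ = 1
    rw [norm_smul, ht, Complex.norm_real, norm_inv, norm_norm, inv_mul_cancel₀ (hnpos n).ne']
  have ht0 : Tendsto (fun n => t n * 1) atTop (𝓝 0) := by
    simp only [mul_one]
    refine squeeze_zero_norm (a := fun n : ℕ => 1 / ((n : ℝ) + 1)) (fun n => ?_)
      tendsto_one_div_add_atTop_nhds_zero_nat
    rw [ht, Complex.norm_real, norm_inv, norm_norm, ← one_div]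
    exact one_div_le_one_div_of_le (by positivity) (hbig n).le
  obtain ⟨a₀, -, ψ, hψ, hlim⟩ := tendsto_subseq_of_bounded (x := fun n p => t n * a (φ n) p)
    (Metric.isBounded_closedBall (x := 0) (r := 1)) fun n => by simp [hn n]
  have hψt := hψ.tendsto_atTop
  have hseq : S.SolSeq lam₀ a₀ 0 (ε ∘ φ ∘ ψ) (lam ∘ φ ∘ ψ) (fun n p => t (ψ n) * a (φ (ψ n)) p)
      (fun n => t (ψ n) * 1) (fun n x => t (ψ n) * F (φ (ψ n)) x) :=
    ⟨hb, fun n => hbn _, fun n => hpos _, hε.comp (hφt.comp hψt), hlam.comp (hφt.comp hψt), hlim,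
      ht0.comp hψt, fun n => hsol' _⟩
  have h1 := hseq.tendsto_ratio (norm_eq_one_of_tendsto (fun n => hn _) hlim)
  obtain ⟨n, hn1⟩ := (Metric.tendsto_nhds.1 h1 1 one_pos).exists
  rw [dist_eq_norm] at hn1
  exact (hphase (φ (ψ n))).not_gt hn1

/-- The two convexity inequalities for the action squeeze the quotient between reciprocal widths at
the two levels. -/
theorem tendsto_quotient (S : KS u) {lam₀ c : ℝ} (hb : lam₀ ∈ bulk u) {ε lam mu : ℕ → ℝ}
    (hpos : ∀ n, 0 < ε n) (hb1 : ∀ n, lam n ∈ bulk u) (hb2 : ∀ n, mu n ∈ bulk u)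
    (h1 : Tendsto lam atTop (𝓝 lam₀)) (h2 : Tendsto mu atTop (𝓝 lam₀))
    (hc : ∀ n, action u (mu n) - action u (lam n) = c * ε n) :
    Tendsto (fun n => (mu n - lam n) / ε n) atTop (𝓝 (c / (xPlus u lam₀ - xMinus u lam₀))) := by
  have hD := (S.width_pos hb).ne'
  have hw : ∀ {l : ℕ → ℝ}, Tendsto l atTop (𝓝 lam₀) →
      Tendsto (fun n => c / (xPlus u (l n) - xMinus u (l n))) atTop
        (𝓝 (c / (xPlus u lam₀ - xMinus u lam₀))) := fun hl =>
    tendsto_const_nhds.div ((S.continuousAt_width hb).tendsto.comp hl) hD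
  refine tendsto_of_tendsto_of_tendsto_of_le_of_le (hw h2) (hw h1) (fun n => ?_) fun n => ?_
  · dsimp only
    rw [div_le_div_iff₀ (S.width_pos (hb2 n)) (hpos n), ← hc]
    exact S.action_sub_le (hb1 n) (hb2 n)
  · dsimp only
    rw [div_le_div_iff₀ (hpos n) (S.width_pos (hb1 n)), ← hc]
    exact S.action_sub_ge (hb1 n) (hb2 n)

theorem bulk_ordConnected : OrdConnected (bulk u) := ordConnected_Ioo

theorem continuousOn_action (S : KS u) : ContinuousOn (action u) (bulk u) := fun _ h =>
  (S.hasDerivAt_action h).continuousAt.continuousWithinAt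

theorem strictMonoOn_action (S : KS u) : StrictMonoOn (action u) (bulk u) := fun x hx y hy hxy => by
  have h1 := S.action_sub_ge hx hy
  have h2 := mul_pos (sub_pos.2 hxy) (S.width_pos hx)
  linarith

theorem osc_mul_self {ε : ℝ} (hε : ε ≠ 0) (c : ℝ) : osc ε (c * ε) = Complex.exp (-(c * Complex.I)) := by
  rw [osc, mul_div_cancel_right₀ _ hε]
  push_cast
  ring_nf

theorem im_integral_eq_zero (S : KS u) {ε lam : ℝ} (hε : ε ≠ 0) {a : Fin S.P → ℂ} {F : ℝ → ℂ}
    (h : S.Sol ε lam a 1 F) : (∫ x, F x * cauchyKer Complex.I x).im = 0 := by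
  have h1 := RatData.Sol.lagrange _ hε h h
  simp only [sub_self, zero_mul, map_one, one_mul] at h1
  have := congrArg Complex.im h1
  simp at this
  linarith

/-- The Lagrange identity for two resolvent solutions. -/
theorem norm_inner_eq (S : KS u) {ε lam mu : ℝ} (hε : 0 < ε) {a a' : Fin S.P → ℂ} {F G : ℝ → ℂ}
    (h : S.Sol ε lam a 1 F) (h' : S.Sol ε mu a' 1 G) :
    |(∫ x, G x * cauchyKer Complex.I x).re - (∫ x, F x * cauchyKer Complex.I x).re|
      = |(mu - lam) / ε| * (ε * ‖∫ x, (starRingEnd ℂ) (F x) * G x‖) := by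
  have h1 := RatData.Sol.lagrange _ hε.ne' h h'
  have h2 := S.im_integral_eq_zero hε.ne' h
  have h3 := S.im_integral_eq_zero hε.ne' h'
  set m := ∫ x, F x * cauchyKer Complex.I x
  set m' := ∫ x, G x * cauchyKer Complex.I x
  simp only [map_one, one_mul] at h1
  have h4 : m' - (starRingEnd ℂ) m = ((m'.re - m.re : ℝ) : ℂ) := by
    apply Complex.ext <;> simp [h2, h3]
  rw [h4] at h1
  have h5 := congrArg norm h1
  rw [norm_mul, Complex.norm_real, Real.norm_eq_abs, ← Complex.ofReal_sub, Complex.norm_real,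
    Real.norm_eq_abs] at h5
  rw [← h5, abs_div, abs_of_pos hε]
  field_simp

/-- Every full phase period contains an eigenvalue. -/
theorem eventually_exists_eigenvalue (S : KS u) {lam₀ : ℝ} (hb : lam₀ ∈ bulk u) :
    ∀ᶠ q : ℝ × ℝ × ℝ in 𝓝[>] 0 ×ˢ (𝓝 lam₀ ×ˢ 𝓝 lam₀),
      osc q.1 (action u q.2.1) = -S.ratio lam₀ →
      action u q.2.2 - action u q.2.1 = 2 * Real.pi * q.1 →
      ∃ lam ∈ Icc q.2.1 q.2.2, IsEigenvalue q.1 u lam := by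
  by_contra hcon
  have hbn : ∀ᶠ t in 𝓝 lam₀, t ∈ bulk u := isOpen_bulk.mem_nhds hb
  have hev : ∀ᶠ q : ℝ × ℝ × ℝ in 𝓝[>] 0 ×ˢ (𝓝 lam₀ ×ˢ 𝓝 lam₀),
      0 < q.1 ∧ q.2.1 ∈ bulk u ∧ q.2.2 ∈ bulk u :=
    (eventually_nhdsWithin_of_forall fun x hx => hx).prod_mk (hbn.prod_mk hbn)
  obtain ⟨s, hs, hsP⟩ := exists_seq_forall_of_frequently
    ((not_eventually.1 hcon).and_eventually hev)
  rw [tendsto_prod_iff', tendsto_prod_iff'] at hs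
  obtain ⟨hs1, hs2, hs3⟩ := hs
  have hpos : ∀ n, 0 < (s n).1 := fun n => (hsP n).2.1
  have hb1 : ∀ n, (s n).2.1 ∈ bulk u := fun n => (hsP n).2.2.1
  have hb2 : ∀ n, (s n).2.2 ∈ bulk u := fun n => (hsP n).2.2.2
  simp only [Classical.not_imp, not_exists, not_and] at hsP
  have hph : ∀ n, osc (s n).1 (action u (s n).2.1) = -S.ratio lam₀ := fun n => (hsP n).1.1
  have hper : ∀ n, action u (s n).2.2 - action u (s n).2.1 = 2 * Real.pi * (s n).1 :=
    fun n => (hsP n).1.2.1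
  have hno : ∀ n, ∀ lam ∈ Icc (s n).2.1 (s n).2.2, ¬IsEigenvalue (s n).1 u lam :=
    fun n => (hsP n).1.2.2
  have hpi := Real.pi_pos
  have hlt : ∀ n, (s n).2.1 < (s n).2.2 := fun n => by
    refine (S.strictMonoOn_action.lt_iff_lt (hb1 n) (hb2 n)).1 ?_
    have := hper n
    have := mul_pos (mul_pos two_pos hpi) (hpos n)
    linarith
  have hsub : ∀ n, Icc (s n).2.1 (s n).2.2 ⊆ bulk u := fun n =>
    bulk_ordConnected.out (hb1 n) (hb2 n)
  -- A quarter of the period is used because at its middle the phase factor equals the ratio itself,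
  -- where the sources need not stay bounded. At both ends and at the quarter the factor is `-R`,
  -- `-R` and `iR`, at distance at least `1` from `R`.
  have hquarter : ∀ n, ∃ l ∈ Icc (s n).2.1 (s n).2.2,
      action u l = action u (s n).2.1 + Real.pi / 2 * (s n).1 := fun n => by
    refine intermediate_value_Icc (hlt n).le (S.continuousOn_action.mono (hsub n)) ⟨?_, ?_⟩
    · have := mul_pos hpi (hpos n); linarith
    · have := mul_pos hpi (hpos n); linarith [hper n]
  choose l hl hla using hquarter
  have hb3 : ∀ n, l n ∈ bulk u := fun n => hsub n (hl n)
  have hl3 : Tendsto l atTop (𝓝 lam₀) :=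
    tendsto_of_tendsto_of_tendsto_of_le_of_le hs2 hs3 (fun n => (hl n).1) fun n => (hl n).2
  choose F hF hmono using fun n => S.toRatData.exists_monotone_family (hpos n)
    (show (s n).2.2 < 0 by have := hb2 n; rw [S.bulk_eq] at this; exact this.2) (hno n)
  have hε0 := hs1.mono_right nhdsWithin_le_nhds
  have hm1 : ∀ n, (s n).2.1 ∈ Icc (s n).2.1 (s n).2.2 := fun n => left_mem_Icc.2 (hlt n).le
  have hm2 : ∀ n, (s n).2.2 ∈ Icc (s n).2.1 (s n).2.2 := fun n => right_mem_Icc.2 (hlt n).le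
  have hR := S.norm_ratio lam₀
  have hph2 : ∀ n, osc (s n).1 (action u (s n).2.2) = -S.ratio lam₀ := fun n => by
    rw [show action u (s n).2.2 = action u (s n).2.1 + 2 * Real.pi * (s n).1 by linarith [hper n],
      osc_add, hph, osc_mul_self (hpos n).ne', Complex.exp_neg]
    push_cast
    rw [Complex.exp_two_pi_mul_I, inv_one, mul_one]
  have hph3 : ∀ n, osc (s n).1 (action u (l n)) = Complex.I * S.ratio lam₀ := fun n => by
    rw [hla, osc_add, hph, osc_mul_self (hpos n).ne', Complex.exp_neg]
    push_cast
    rw [Complex.exp_pi_div_two_mul_I, Complex.inv_I]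
    ring
  have hne1 : 1 ≤ ‖-S.ratio lam₀ - S.ratio lam₀‖ := by
    rw [show -S.ratio lam₀ - S.ratio lam₀ = -2 * S.ratio lam₀ by ring, norm_mul, hR]
    norm_num
  have hne3 : 1 ≤ ‖Complex.I * S.ratio lam₀ - S.ratio lam₀‖ := by
    rw [show Complex.I * S.ratio lam₀ - S.ratio lam₀ = (Complex.I - 1) * S.ratio lam₀ by ring,
      norm_mul, hR, mul_one]
    have := Complex.abs_im_le_norm (Complex.I - 1)
    simpa using this
  obtain ⟨M₁, hM₁⟩ := S.exists_bound_of_phase hb hpos hb1 hε0 hs2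
    (fun n => hF n _ (hm1 n)) fun n => by rw [hph]; exact hne1
  obtain ⟨M₂, hM₂⟩ := S.exists_bound_of_phase hb hpos hb2 hε0 hs3
    (fun n => hF n _ (hm2 n)) fun n => by rw [hph2]; exact hne1
  obtain ⟨M₃, hM₃⟩ := S.exists_bound_of_phase hb hpos hb3 hε0 hl3
    (fun n => hF n _ (hl n)) fun n => by rw [hph3]; exact hne3
  set A : ℕ → ℝ → Fin S.P → ℂ := fun n lam p => S.c p * cauchyT (F n lam) (S.z p) with hA
  obtain ⟨⟨a₁, a₂, a₃⟩, -, φ, hφ, hlim⟩ := tendsto_subseq_of_frequently_bounded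
    (x := fun n => (A n (s n).2.1, A n (s n).2.2, A n (l n)))
    ((Metric.isBounded_closedBall (x := (0 : Fin S.P → ℂ)) (r := M₁)).prod
      ((Metric.isBounded_closedBall (x := (0 : Fin S.P → ℂ)) (r := M₂)).prod
        (Metric.isBounded_closedBall (x := (0 : Fin S.P → ℂ)) (r := M₃))))
    (Eventually.frequently (by
      filter_upwards [hM₁, hM₂, hM₃] with n h1 h2 h3
      refine ⟨?_, ?_, ?_⟩ <;> rw [mem_closedBall_zero_iff] <;> assumption))
  rw [nhds_prod_eq, nhds_prod_eq, tendsto_prod_iff', tendsto_prod_iff'] at hlim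
  obtain ⟨hl₁, hl₂, hl₃⟩ := hlim
  have hφt := hφ.tendsto_atTop
  have hseq : ∀ (t : ℕ → ℝ) (a₀ : Fin S.P → ℂ), (∀ n, t n ∈ Icc (s n).2.1 (s n).2.2) →
      Tendsto t atTop (𝓝 lam₀) → Tendsto (fun n => A (φ n) (t (φ n))) atTop (𝓝 a₀) →
      S.SolSeq lam₀ a₀ 1 (fun n => (s (φ n)).1) (fun n => t (φ n)) (fun n => A (φ n) (t (φ n)))
        (fun _ => 1) (fun n => F (φ n) (t (φ n))) := fun t a₀ ht htl hta =>
    ⟨hb, fun n => hsub _ (ht _), fun n => hpos _, hε0.comp hφt, htl.comp hφt, hta,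
      tendsto_const_nhds, fun n => hF _ _ (ht _)⟩
  have q1 := hseq _ a₁ hm1 hs2 hl₁
  have q2 := hseq _ a₂ hm2 hs3 hl₂
  have q3 := hseq _ a₃ hl hl3 hl₃
  have hσ2 := (S.tendsto_quotient hb hpos hb1 hb2 hs2 hs3 hper).comp hφt
  have hσ3 := (S.tendsto_quotient hb hpos hb1 hb3 hs2 hl3
    (fun n => by rw [hla, add_sub_cancel_left])).comp hφt
  -- By `norm_inner_eq` these are the increments of the Weyl function over the full period and over
  -- the first quarter. The former tends to zero, as the exponential completes one turn over the
  -- well; the latter has a positive limit. Monotonicity orders them the other way.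
  have i2 := hσ2.abs.mul (S.tendsto_inner q1 q2 hσ2)
  have i3 := hσ3.abs.mul (S.tendsto_inner q1 q3 hσ3)
  have hD := S.width_pos hb
  have hz : ∫ x in xMinus u lam₀..xPlus u lam₀,
      Complex.exp ((2 * Real.pi / (xPlus u lam₀ - xMinus u lam₀) : ℝ) * x * Complex.I) = 0 :=
    integral_exp_eq_zero (div_mul_cancel₀ _ hD.ne')
  rw [hz, norm_zero, mul_zero, mul_zero] at i2
  have hle := le_of_tendsto_of_tendsto' i3 i2 fun n => by
    have e2 := S.norm_inner_eq (hpos (φ n)) (q1.sol n) (q2.sol n)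
    have e3 := S.norm_inner_eq (hpos (φ n)) (q1.sol n) (q3.sol n)
    have m1 := hmono (φ n) (hm1 _) (hl _) (hl (φ n)).1
    have m2 := hmono (φ n) (hl _) (hm2 _) (hl (φ n)).2
    simp only [Function.comp]
    rw [← e2, ← e3, abs_of_nonneg (sub_nonneg.2 m1), abs_of_nonneg (sub_nonneg.2 (m1.trans m2))]
    exact sub_le_sub_right m2 _
  have n1 := (q1.amp_ne_zero (Or.inr one_ne_zero)).1
  have n3 := (q3.amp_ne_zero (Or.inr one_ne_zero)).1
  have hσpos : 0 < Real.pi / 2 / (xPlus u lam₀ - xMinus u lam₀) := by positivity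
  have n4 := integral_exp_ne_zero (S.xMinus_lt_xPlus hb) hσpos.le
    (by rw [div_mul_cancel₀ _ hD.ne']; linarith)
  refine hle.not_gt (mul_pos (abs_pos.2 hσpos.ne') ?_)
  exact mul_pos (mul_pos (norm_pos_iff.2 n1) (norm_pos_iff.2 n3)) (norm_pos_iff.2 n4)

end KS

/-! ### Counting the eigenvalues -/

theorem four_mul_abs_le_norm_exp_sub_one {x : ℝ} (hx : |x| ≤ 1 / 2) :
    4 * |x| ≤ ‖Complex.exp (Complex.I * (2 * Real.pi * x : ℝ)) - 1‖ := by
  have hpi := Real.pi_pos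
  rw [Complex.norm_exp_I_mul_ofReal_sub_one, norm_mul, Real.norm_ofNat, Real.norm_eq_abs,
    show 2 * Real.pi * x / 2 = Real.pi * x by ring]
  have h1 : 2 * |x| ≤ |Real.sin (Real.pi * x)| := by
    have h2 := Real.mul_abs_le_abs_sin (x := Real.pi * x) (by
      rw [abs_mul, abs_of_pos hpi]; nlinarith)
    rw [abs_mul, abs_of_pos hpi] at h2
    calc 2 * |x| = 2 / Real.pi * (Real.pi * |x|) := by field_simp
      _ ≤ _ := h2
  linarith

/-- Counting points that lie near integers in a monotone coordinate. -/
theorem ncard_sub_le_of_near_integers {ψ : ℝ → ℝ} {c d : ℝ} (hcd : c ≤ d)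
    (hmono : StrictMonoOn ψ (Icc c d)) (hcont : ContinuousOn ψ (Icc c d)) {E : Set ℝ}
    (hE : E ⊆ Icc c d) (hnear : ∀ x ∈ E, |ψ x - round (ψ x)| < 1 / 40)
    (hsep : ∀ x ∈ E, ∀ y ∈ E, x < y → 1 / 20 ≤ ψ y - ψ x)
    (hex : ∀ k : ℤ, ∀ p ∈ Icc c d, ∀ q ∈ Icc c d, ψ p = k - 1 / 2 → ψ q = k + 1 / 2 →
      ∃ x ∈ Icc p q, x ∈ E) : E.Finite ∧ |(E.ncard : ℝ) - (ψ d - ψ c)| ≤ 3 := by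
  have hc := left_mem_Icc.2 hcd
  have hd := right_mem_Icc.2 hcd
  -- Points rounding to the same integer differ by less than `2 / 40` in `ψ`, below the separation
  -- `1 / 20`.
  have hinj : InjOn (fun x => round (ψ x)) E := by
    have h : ∀ x ∈ E, ∀ y ∈ E, round (ψ x) = round (ψ y) → ¬x < y := fun x hx y hy hxy hlt => by
      have h1 := hsep x hx y hy hlt
      have h2 := abs_lt.1 (hnear x hx)
      have h3 := abs_lt.1 (hnear y hy)
      rw [← hxy] at h3
      linarith [h2.1, h3.2]
    exact fun x hx y hy hxy => le_antisymm (not_lt.1 (h y hy x hx hxy.symm))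
      (not_lt.1 (h x hx y hy hxy))
  have hmaps : (fun x => round (ψ x)) '' E ⊆ (Finset.Icc ⌊ψ c⌋ ⌈ψ d⌉ : Finset ℤ) := by
    rintro _ ⟨x, hx, rfl⟩
    have h1 := abs_lt.1 (hnear x hx)
    have h2 := hmono.monotoneOn hc (hE hx) (hE hx).1
    have h3 := hmono.monotoneOn (hE hx) hd (hE hx).2
    rw [Finset.coe_Icc]
    constructor
    · have h4 : ((⌊ψ c⌋ : ℤ) : ℝ) < ((round (ψ x) + 1 : ℤ) : ℝ) := by
        push_cast; linarith [Int.floor_le (ψ c)]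
      have : ⌊ψ c⌋ < round (ψ x) + 1 := by exact_mod_cast h4
      change _ ≤ round (ψ x)
      omega
    · have h4 : ((round (ψ x) : ℤ) : ℝ) < ((⌈ψ d⌉ + 1 : ℤ) : ℝ) := by
        push_cast; linarith [Int.le_ceil (ψ d)]
      have : round (ψ x) < ⌈ψ d⌉ + 1 := by exact_mod_cast h4
      change round (ψ x) ≤ _
      omega
  have hfin : E.Finite := ((Finset.finite_toSet _).subset hmaps).of_finite_image hinj
  -- Integers next to the two ends are dropped so that `k ± 1/2` are values of `ψ` on the interval.
  -- These losses and the rounding add up to at most `3`.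
  have hsub : ((Finset.Icc (⌈ψ c⌉ + 1) (⌊ψ d⌋ - 1) : Finset ℤ) : Set ℤ)
      ⊆ (fun x => round (ψ x)) '' E := by
    intro k hk
    rw [Finset.coe_Icc] at hk
    have h1 : (⌈ψ c⌉ + 1 : ℝ) ≤ k := by exact_mod_cast hk.1
    have h2 : (k : ℝ) ≤ ⌊ψ d⌋ - 1 := by exact_mod_cast hk.2
    have h3 := Int.le_ceil (ψ c)
    have h4 := Int.floor_le (ψ d)
    obtain ⟨p, hp, hpe⟩ := intermediate_value_Icc hcd hcont
      (show (k : ℝ) - 1 / 2 ∈ Icc (ψ c) (ψ d) from ⟨by linarith, by linarith⟩)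
    obtain ⟨q, hq, hqe⟩ := intermediate_value_Icc hcd hcont
      (show (k : ℝ) + 1 / 2 ∈ Icc (ψ c) (ψ d) from ⟨by linarith, by linarith⟩)
    obtain ⟨x, hx, hxE⟩ := hex k p hp q hq hpe hqe
    have h5 := hmono.monotoneOn hp (hE hxE) hx.1
    have h6 := hmono.monotoneOn (hE hxE) hq hx.2
    rw [hpe] at h5
    rw [hqe] at h6
    have h7 := abs_lt.1 (hnear x hxE)
    refine ⟨x, hxE, ?_⟩
    have h8 : ((round (ψ x) : ℤ) : ℝ) < ((k + 1 : ℤ) : ℝ) := by push_cast; linarith [h7.1]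
    have h9 : ((k : ℤ) : ℝ) < ((round (ψ x) + 1 : ℤ) : ℝ) := by push_cast; linarith [h7.2]
    have h8' : round (ψ x) < k + 1 := by exact_mod_cast h8
    have h9' : k < round (ψ x) + 1 := by exact_mod_cast h9
    change round (ψ x) = k
    omega
  have hup := ncard_le_ncard hmaps (Finset.finite_toSet _)
  have hlow := ncard_le_ncard hsub (hfin.image _)
  rw [hinj.ncard_image, ncard_coe_finset, Int.card_Icc] at hup hlow
  have h1 : (E.ncard : ℤ) ≤ ⌈ψ d⌉ + 1 - ⌊ψ c⌋ := by
    have : ⌊ψ c⌋ ≤ ⌈ψ d⌉ + 1 :=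
      (Int.floor_le_ceil _).trans ((Int.ceil_le_ceil (hmono.monotoneOn hc hd hcd)).trans (by omega))
    omega
  have h2 : ⌊ψ d⌋ - 1 + 1 - (⌈ψ c⌉ + 1) ≤ (E.ncard : ℤ) := by omega
  have h1' : (E.ncard : ℝ) ≤ ⌈ψ d⌉ + 1 - ⌊ψ c⌋ := by exact_mod_cast h1
  have h2' : (⌊ψ d⌋ : ℝ) - 1 + 1 - (⌈ψ c⌉ + 1) ≤ E.ncard := by exact_mod_cast h2
  refine ⟨hfin, abs_le.2 ⟨?_, ?_⟩⟩
  · linarith [Int.sub_one_lt_floor (ψ d), Int.ceil_lt_add_one (ψ c)]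
  · linarith [Int.sub_one_lt_floor (ψ c), Int.ceil_lt_add_one (ψ d)]

namespace KS
variable {u : ℝ → ℝ}

/-- The Bohr-Sommerfeld count near a level, up to a bounded error. -/
theorem exists_nhds_count (S : KS u) {lam₀ : ℝ} (hb : lam₀ ∈ bulk u) :
    ∃ U : Set ℝ, IsOpen U ∧ lam₀ ∈ U ∧ ∀ᶠ ε in 𝓝[>] (0 : ℝ), ∀ c d, c ≤ d → Icc c d ⊆ U →
      (eigenvaluesIn ε u c d).Finite ∧ |((eigenvaluesIn ε u c d).ncard : ℝ)
        - (action u d - action u c) / (2 * Real.pi * ε)| ≤ 3 := by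
  -- The tolerance `1 / 10` becomes `1 / 40` in `ψ`, through `‖exp(2πix) - 1‖ ≥ 4 |x|`.
  obtain ⟨e₁, he₁, t₁, ht₁, H₁⟩ :=
    eventually_prod_iff.1 (S.eventually_osc_near hb (δ := 1 / 10) (by norm_num))
  obtain ⟨e₂, he₂, t₂, ht₂, H₂⟩ := eventually_prod_iff.1 (S.eventually_separated hb)
  obtain ⟨e₃, he₃, t₃, ht₃, H₃⟩ := eventually_prod_iff.1 (S.eventually_exists_eigenvalue hb)
  obtain ⟨s₂, hs₂, hs₂'⟩ := eventually_prod_self_iff'.1 ht₂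
  obtain ⟨s₃, hs₃, hs₃'⟩ := eventually_prod_self_iff'.1 ht₃
  obtain ⟨U, hU, hUo, hUm⟩ := mem_nhds_iff.1
    (inter_mem (inter_mem ht₁ (inter_mem hs₂ hs₃)) (isOpen_bulk.mem_nhds hb))
  refine ⟨U, hUo, hUm, ?_⟩
  filter_upwards [he₁, he₂, he₃, self_mem_nhdsWithin] with ε h1 h2 h3 hε c d hcd hsub
  have hε0 : 0 < ε := hε
  have hpi := Real.pi_pos
  have hbulk : Icc c d ⊆ bulk u := fun x hx => (hU (hsub hx)).2
  set R := S.ratio lam₀ with hR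
  set θ := -R.arg with hθ
  have hRe : R = osc 1 θ := by
    have := Complex.norm_mul_exp_arg_mul_I R
    rw [hR, S.norm_ratio, ← hR, Complex.ofReal_one, one_mul] at this
    rw [osc, hθ, neg_div, neg_neg, div_one]
    exact this.symm
  -- In this coordinate the phase factor equals `R` at integers and `-R` at half-integers.
  set ψ : ℝ → ℝ := fun x => (action u x / ε - θ) / (2 * Real.pi) with hψ
  have hψsub : ∀ x y, ψ y - ψ x = (action u y - action u x) / (2 * Real.pi * ε) := fun x y => by
    simp only [hψ]
    field_simp
    ring
  have hosc : ∀ x, osc ε (action u x) = R * osc 1 (2 * Real.pi * ψ x) := fun x => by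
    rw [hRe, ← osc_add, osc, osc]
    congr 3
    simp only [hψ]
    field_simp
    ring
  have hint : ∀ (k : ℤ) (x : ℝ), osc 1 (2 * Real.pi * (x - k)) = osc 1 (2 * Real.pi * x) :=
    fun k x => by
      rw [osc, osc]
      rw [Complex.exp_eq_exp_iff_exists_int]
      refine ⟨k, ?_⟩
      push_cast
      ring
  have hac : ContinuousOn (action u) (Icc c d) := S.continuousOn_action.mono hbulk
  have hmono : StrictMonoOn ψ (Icc c d) := fun x hx y hy hxy => by
    have h4 := S.strictMonoOn_action (hbulk hx) (hbulk hy) hxy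
    rw [← sub_pos, hψsub]
    exact div_pos (sub_pos.2 h4) (by positivity)
  have hcount := ncard_sub_le_of_near_integers hcd hmono
    (((hac.div_const ε).sub continuousOn_const).div_const _)
    (E := eigenvaluesIn ε u c d) (fun x hx => hx.1) (fun x hx => ?_) (fun x hx y hy hxy => ?_)
    (fun k p hp q hq hpk hqk => ?_)
  · rw [hψsub] at hcount
    exact hcount
  · have h4 := H₁ h1 (hU (hsub hx.1)).1.1 hx.2
    simp only at h4
    rw [hosc, ← hint (round (ψ x)), show R * osc 1 (2 * Real.pi * (ψ x - round (ψ x))) - S.ratio lam₀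
      = R * (osc 1 (2 * Real.pi * (ψ x - round (ψ x))) - 1) by rw [← hR]; ring, norm_mul, hR,
      S.norm_ratio, one_mul] at h4
    have h5 := four_mul_abs_le_norm_exp_sub_one (x := -(ψ x - round (ψ x)))
      (by rw [abs_neg]; exact abs_sub_round _)
    have h6 : Complex.exp (Complex.I * (2 * Real.pi * -(ψ x - round (ψ x)) : ℝ))
        = osc 1 (2 * Real.pi * (ψ x - round (ψ x))) := by
      rw [osc]
      congr 1
      push_cast
      ring
    rw [h6, abs_neg] at h5
    linarith
  -- A gap of `ε` in the action is a gap of `1 / (2π)` in `ψ`, which exceeds `1 / 20`.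
  · have h4 := H₂ h2 (hs₂' x (hU (hsub hx.1)).1.2.1 y (hU (hsub hy.1)).1.2.1) hx.2 hy.2 hxy
    simp only at h4
    rw [hψsub, div_le_div_iff₀ (by norm_num) (by positivity)]
    nlinarith [Real.pi_le_four]
  · have h4 : osc ε (action u p) = -R := by
      rw [hosc, hpk, ← hint k, show 2 * Real.pi * ((k : ℝ) - 1 / 2 - k) = -Real.pi by ring]
      rw [osc, div_one, neg_neg, Complex.exp_pi_mul_I]
      ring
    have h5 : action u q - action u p = 2 * Real.pi * ε := by
      have h6 := hψsub p q
      rw [hpk, hqk, eq_div_iff (by positivity)] at h6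
      linarith
    obtain ⟨x, hx, hxe⟩ := H₃ h3 (hs₃' p (hU (hsub hp)).1.2.2 q (hU (hsub hq)).1.2.2) h4 h5
    exact ⟨x, hx, ⟨hp.1.trans hx.1, hx.2.trans hq.2⟩, hxe⟩

theorem eigenvaluesIn_union {ε a b c : ℝ} (hab : a ≤ b) (hbc : b ≤ c) :
    eigenvaluesIn ε u a c = eigenvaluesIn ε u a b ∪ eigenvaluesIn ε u b c := by
  ext x
  simp only [eigenvaluesIn, mem_union, mem_ofPred_eq, ← or_and_right]
  rw [← mem_union, Icc_union_Icc_eq_Icc hab hbc]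

/-- The Bohr-Sommerfeld count, up to a bounded error. -/
theorem exists_count (S : KS u) {a b : ℝ} (hab : a ≤ b) (hb : Icc a b ⊆ bulk u) :
    ∃ C, ∀ᶠ ε in 𝓝[>] (0 : ℝ), (eigenvaluesIn ε u a b).Finite ∧
      |((eigenvaluesIn ε u a b).ncard : ℝ) - (action u b - action u a) / (2 * Real.pi * ε)| ≤ C := by
  choose U hUo hUm hU using fun t : Icc a b => S.exists_nhds_count (hb t.2)
  -- By compactness `[a, b]` is cut into finitely many pieces, each inside one neighbourhood; the
  -- partition does not depend on `ε`, so the errors add up to a constant.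
  obtain ⟨t, ht0, htm, ⟨m, hm⟩, ht⟩ := exists_monotone_Icc_subset_open_cover_Icc hab
    (c := fun i => Subtype.val ⁻¹' U i) (fun i => (hUo i).preimage continuous_subtype_val)
    fun x _ => mem_iUnion.2 ⟨x, hUm x⟩
  have key : ∀ n, ∃ C, ∀ᶠ ε in 𝓝[>] (0 : ℝ), (eigenvaluesIn ε u a (t n)).Finite ∧
      |((eigenvaluesIn ε u a (t n)).ncard : ℝ)
        - (action u (t n) - action u a) / (2 * Real.pi * ε)| ≤ C := by
    intro n
    induction n with
    | zero =>
      refine ⟨1, Eventually.of_forall fun ε => ?_⟩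
      have hsub : eigenvaluesIn ε u a a ⊆ {a} := fun x hx => by
        have := hx.1
        rwa [Icc_self] at this
      rw [ht0, sub_self, zero_div, sub_zero, Nat.abs_cast]
      refine ⟨(finite_singleton a).subset hsub, ?_⟩
      have := ncard_le_ncard hsub (finite_singleton a)
      rw [ncard_singleton] at this
      exact_mod_cast this
    | succ n ih =>
      obtain ⟨C, hC⟩ := ih
      obtain ⟨i, hi⟩ := ht n
      -- The new piece costs `3`, and its left endpoint may be an eigenvalue counted twice.
      refine ⟨C + 3 + 1, ?_⟩
      have h0 : (t n : ℝ) ≤ t (n + 1) := htm (Nat.le_succ n)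
      have hsub : Icc (t n : ℝ) (t (n + 1)) ⊆ U i := fun x hx => by
        have hx' : x ∈ Icc a b := ⟨(t n).2.1.trans hx.1, hx.2.trans (t (n + 1)).2.2⟩
        exact hi (show (⟨x, hx'⟩ : Icc a b) ∈ Icc (t n) (t (n + 1)) from hx)
      filter_upwards [hC, hU i] with ε h1 h2
      obtain ⟨h3, h4⟩ := h2 _ _ h0 hsub
      rw [eigenvaluesIn_union (t n).2.1 h0]
      refine ⟨h1.1.union h3, ?_⟩
      have h5 := ncard_union_add_ncard_inter (eigenvaluesIn ε u a (t n))
        (eigenvaluesIn ε u (t n) (t (n + 1))) h1.1 h3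
      have h6 : (eigenvaluesIn ε u a (t n) ∩ eigenvaluesIn ε u (t n) (t (n + 1))).ncard ≤ 1 := by
        rw [← ncard_singleton (t n : ℝ)]
        exact ncard_le_ncard (fun x hx => le_antisymm hx.1.1.2 hx.2.1.1) (finite_singleton _)
      have h5' : ((eigenvaluesIn ε u a (t n) ∪ eigenvaluesIn ε u (t n) (t (n + 1))).ncard : ℝ)
          + (eigenvaluesIn ε u a (t n) ∩ eigenvaluesIn ε u (t n) (t (n + 1))).ncard
          = (eigenvaluesIn ε u a (t n)).ncard + (eigenvaluesIn ε u (t n) (t (n + 1))).ncard := by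
        exact_mod_cast h5
      have h6' : ((eigenvaluesIn ε u a (t n) ∩ eigenvaluesIn ε u (t n) (t (n + 1))).ncard : ℝ) ≤ 1 := by
        exact_mod_cast h6
      have h7 : (0 : ℝ) ≤ (eigenvaluesIn ε u a (t n) ∩ eigenvaluesIn ε u (t n) (t (n + 1))).ncard :=
        Nat.cast_nonneg _
      have h8 : (action u (t (n + 1)) - action u a) / (2 * Real.pi * ε)
          = (action u (t n) - action u a) / (2 * Real.pi * ε)
            + (action u (t (n + 1)) - action u (t n)) / (2 * Real.pi * ε) := by ring
      have h9 := abs_le.1 h1.2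
      have h10 := abs_le.1 h4
      rw [h8]
      exact abs_le.2 ⟨by linarith [h9.1, h10.1], by linarith [h9.2, h10.2]⟩
  have := key m
  rwa [hm m le_rfl] at this

end KS

end BenjaminOno

end

theorem mainTheorem4 (u : ℝ → ℝ) (hu : BenjaminOno.IsRKS u) (hpos : ∀ x, 0 < u x)
    (a b : ℝ) (hab : a ≤ b) (hbulk : Icc a b ⊆ BenjaminOno.bulk u) :
    IntervalIntegrable (BenjaminOno.matsunoDensity u) volume a b ∧
    (∀ᶠ ε : ℝ in 𝓝[>] 0, (BenjaminOno.eigenvaluesIn ε u a b).Finite) ∧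
    (fun ε : ℝ => ((BenjaminOno.eigenvaluesIn ε u a b).ncard : ℝ)
        - (1 / ε) * ∫ ev in a..b, BenjaminOno.matsunoDensity u ev)
      =O[𝓝[>] 0] (fun _ : ℝ => (1 : ℝ)) := by
  obtain ⟨S⟩ := hu.exists_ks hpos
  obtain ⟨C, hC⟩ := S.exists_count hab hbulk
  refine ⟨?_, hC.mono fun _ h => h.1, IsBigO.of_bound C (hC.mono fun ε h => ?_)⟩
  · refine (S.continuousOn_matsunoDensity.mono ?_).intervalIntegrable
    rwa [uIcc_of_le hab]
  · rw [norm_one, mul_one, Real.norm_eq_abs, S.integral_matsunoDensity hab hbulk,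
      one_div_mul_eq_div, div_div]
    exact h.2
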